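/- Let $K$ be a field that is complete for a discrete valuation $\mathrm{val}$ (normalized by $\mathrm{val}(K^\times)=\mathbb Z$), $K^\circ$ its valuation ring, $\pi$ a uniformizer and $k=K^\circ/\pi K^\circ$. Let $K^\circ\{\mathbf X\}$, $\mathbf X=(X_1,\dots,X_n)$, be the ring of power series $\sum a_{\mathbf i}\mathbf X^{\mathbf i}$ with $a_{\mathbf i}\in K^\circ$ and $\mathrm{val}(a_{\mathbf i})\to+\infty$, with the Gauss valuation $\mathrm{val}(f)=\min_{\mathbf i}\mathrm{val}(a_{\mathbf i})$. Fix a monomial order $\le_\omega$ on $\mathbb N^n$. The monomial of a nonzero term $a\mathbf X^{\mathbf i}$ is the pair $(\mathrm{val}(a),\mathbf i)\in\mathbb N\times\mathbb N^n$; monomials are multiplied (and divisibility and lcm are taken) componentwise and are ordered by putting $(a,\mathbf i)<(b,\mathbf j)$ if $a>b$, or if $a=b$ and $\mathbf i<_\omega\mathbf j$. $LT(f)$ is the largest term of $f\neq0$ and $LM(f)$ its monomial; $0$ counts as a monomial smaller than all others, and $LM(0)=0$. A finite set $G\subset I$ is a Gröbner basis of an ideal $I\subset K^\circ\{\mathbf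 X\}$ if for every nonzero $f\in I$ some $LM(g)$, $g\in G$, divides $LM(f)$; Gröbner bases in $k[\mathbf X]$ are taken for $\le_\omega$. *The algorithm VaPoTe.* Signatures are monomials or $0$. For pairs $p_i=(u_i,v_i)$ (signature, series) with $v_1v_2\ne0$, let $t=\mathrm{lcm}(LM(v_1),LM(v_2))$ and $t_i=t/LM(v_i)$; the J-pair of $(p_1,p_2)$ is $t_1p_1$ if $t_1u_1>t_2u_2$, is $t_2p_2$ if $t_1u_1<t_2u_2$, and is not defined if $t_1u_1=t_2u_2$. (Here $t_iv_i$ is the product of $v_i$ with the term $\pi^a\mathbf X^{\mathbf i}$ whose monomial is $t_i$.) A pair $(u,v)$ is covered by $G$ if there are $(u_i,v_i)\in G$ and a monomial $t$ with $u=t\,u_i$ and $t\,LM(v_i)<LM(v)$. $\mathsf{regular\_reduce}(u,v,G)$ replaces $v$ by $v-\tau g$, where $(s,g)\in G$, $g\neq 0$, and $\tau$ is a term with $\tau\, LT(g)=LT(v)$ and $\mathrm{mon}(\tau)\,s<u$, as long as this is possible; it returns the final value of $v$ or, if the process is infinite, its limit. Input: $f_1,\dots,f_m\in K^\circ\{\mathbf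 X\}$. Start with the list $Q=(f_1,\dots,f_m)$ and $\mathsf{GBasis}=\emptyset$. While $Q\ne\emptyset$: 1. pop from $Q$ an $f$ of smallest valuation; set $G=\{(0,g):g\in\mathsf{GBasis}\}\cup\{(1,f)\}$, $S=\{LM(g):g\in\mathsf{GBasis}\}$, and let $B$ be the set of the J-pairs of $((1,f),(0,g))$, $g\in\mathsf{GBasis}$, that are defined; 2. while $B\neq\emptyset$: pop from $B$ a pair $(u,v)$ with smallest $u$; if it is covered by $G$, or if $u$ is divisible by an element of $S$, continue with the next pair; otherwise let $v_0=\mathsf{regular\_reduce}(u,v,G)$; if $\mathrm{val}(v_0)>\mathrm{val}(f)$, add $u$ to $S$ and $v_0$ to $Q$; else add to $B$ all J-pairs of $((u,v_0),(s,g))$, $(s,g)\in G$, that are defined, and then add $(u,v_0)$ to $G$; 3. set $\mathsf{GBasis}=\{v:(u,v)\in G\text{ for some }u\}$. One step of an execution is the execution of item 1, of one pass through the loop of item 2, or of item 3; a call to $\mathsf{regular\_reduce}$ counts as part of one step. Once the main loop is left, nothing changes any more. *Theorem.* Let $f_1,\dots,f_m\in K^\circ\{\mathbf X\}$ and $I=\langle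 f_1,\dots,f_m\rangle$. An execution of VaPoTe never gets stuck: as long as the main loop has not been left, a next step is possible. In every execution of VaPoTe on $f_1,\dots,f_m$ (whatever choices are made among elements of $Q$ of smallest valuation, among elements of $B$ with smallest signature, and among reducers), the variable $\mathsf{GBasis}$ has a constant value $G$ after finitely many steps, and: * $G$ is a Gröbner basis of $I$; * for every $N\ge0$, $\rho(G_{\le N})$ is a Gröbner basis of $\bar I_N$, where $G_{\le N}=\{g\in G:\mathrm{val}(g)\le N\}$, $\rho(g)\in k[\mathbf X]$ is the reduction modulo $\pi$ of $\pi^{-\mathrm{val}(g)}g$, and $\bar I_N$ is the image of $\pi^{-N}(I\cap\pi^NK^\circ\{\mathbf X\})$ in $k[\mathbf X]$. -/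

import Mathlib

noncomputable section

namespace VaPoTe

open MvPowerSeries

/-! ### The integral Tate algebra over a discrete valuation ring -/

section Tate

variable (R : Type*) [CommRing R] [IsDomain R] [IsDiscreteValuationRing R] (n : ℕ)

/-- The ring of power series in `X₁, …, Xₙ` over `R` whose coefficients tend to zero, i.e. for
every `N` only finitely many coefficients have valuation `< N`. For `R = K°` this is `K°{X}`. -/
def Tate : Subring (MvPowerSeries (Fin n) R) where
  carrier := {f | ∀ N : ℕ, {i | IsDiscreteValuationRing.addVal R (coeff i f) < N}.Finite}
  zero_mem' N := by simp
  one_mem' N := by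
    refine (Set.finite_singleton (0 : Fin n →₀ ℕ)).subset fun i hi => ?_
    by_contra h
    simp only [Set.mem_singleton_iff] at h
    simp [coeff_one, h] at hi
  add_mem' {f g} hf hg N := by
    refine ((hf N).union (hg N)).subset fun i hi => ?_
    by_contra h
    simp only [Set.mem_union, Set.mem_ofPred_eq, not_or, not_lt] at h hi
    rw [map_add] at hi
    exact absurd hi (not_lt.mpr ((le_min h.1 h.2).trans (AddValuation.map_add _ _ _)))
  neg_mem' {f} hf N := by simpa [AddValuation.map_neg] using hf N
  mul_mem' {f g} hf hg N := by
    classical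
    refine (Set.Finite.image2 (· + ·) (hf N) (hg N)).subset fun i hi => ?_
    by_contra h
    simp only [Set.mem_ofPred_eq] at hi
    rw [coeff_mul] at hi
    refine absurd hi (not_lt.mpr (AddValuation.map_le_sum _ fun p hp => ?_))
    rw [Finset.HasAntidiagonal.mem_antidiagonal] at hp
    rw [AddValuation.map_mul]
    by_contra hlt
    rw [not_le] at hlt
    exact h ⟨p.1, lt_of_le_of_lt le_self_add hlt, p.2, lt_of_le_of_lt le_add_self hlt, hp⟩

end Tate

variable {R : Type*} [CommRing R] [IsDomain R] [IsDiscreteValuationRing R] {n : ℕ}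

/-- The Gauss valuation: the minimum of the valuations of the coefficients (`⊤` for `f = 0`). -/
def gaussVal (f : Tate R n) : ℕ∞ :=
  ⨅ i, IsDiscreteValuationRing.addVal R (coeff i f.1)

/-- The Tate term `c X^d`. -/
def term (c : R) (d : Fin n →₀ ℕ) : Tate R n :=
  ⟨monomial d c, fun N => by
    classical
    refine (Set.finite_singleton d).subset fun i hi => ?_
    by_contra h
    simp only [Set.mem_singleton_iff] at h
    simp [coeff_monomial, h] at hi⟩

lemma residue_support_finite (f : Tate R n) :
    (Function.support fun i => IsLocalRing.residue R (coeff i f.1)).Finite := by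
  refine (f.2 1).subset fun i hi => ?_
  by_contra h
  refine hi ?_
  simp only [Set.mem_ofPred_eq, Nat.cast_one, Order.lt_one_iff] at h
  rw [IsLocalRing.residue_eq_zero_iff, IsLocalRing.mem_maximalIdeal, mem_nonunits_iff]
  intro hu
  exact h ((IsDiscreteValuationRing.addVal_eq_zero_iff).mpr hu)

/-- The underlying map of `red`. -/
def redFun (f : Tate R n) : MvPolynomial (Fin n) (IsLocalRing.ResidueField R) :=
  AddMonoidAlgebra.ofCoeff (Finsupp.ofSupportFinite _ (residue_support_finite f))

lemma coe_redFun (f : Tate R n) :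
    (redFun f : MvPowerSeries (Fin n) (IsLocalRing.ResidueField R)) =
      MvPowerSeries.map (IsLocalRing.residue R) f.1 := by
  ext i
  rw [MvPolynomial.coeff_coe, coeff_map]
  rfl

/-- Reduction modulo the maximal ideal, `K°{X} → k[X]`. -/
def red : Tate R n →+* MvPolynomial (Fin n) (IsLocalRing.ResidueField R) where
  toFun := redFun
  map_one' := MvPolynomial.coe_injective _ _ (by simp [coe_redFun])
  map_mul' f g := MvPolynomial.coe_injective _ _ (by simp [coe_redFun])
  map_zero' := MvPolynomial.coe_injective _ _ (by simp [coe_redFun])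
  map_add' f g := MvPolynomial.coe_injective _ _ (by simp [coe_redFun])

/-! ### Monomials, leading terms and Gröbner bases -/

/-- Monomials of Tate terms: `(a, i)` is the class of the terms `c X^i` with `val c = a`.
The monoid is written additively, so a product of monomials is a sum, a quotient is a difference,
and the lcm is the supremum for the componentwise order. -/
abbrev TMon (n : ℕ) : Type := ℕ × (Fin n →₀ ℕ)

/-- A monomial or zero; `⊥` stands for the zero monomial (`t * 0 = 0` reads `t + ⊥ = ⊥`). -/
abbrev TMon₀ (n : ℕ) : Type := WithBot (TMon n)

/-- The order on monomials induced by a monomial order `ω`, given by an embedding into a linear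
order: first compare valuations, for the reverse order, then exponents, for `ω`.
The zero monomial is the smallest. -/
def tKey (ω : MonomialOrder (Fin n)) (x : TMon₀ n) : WithBot (ℕᵒᵈ ×ₗ ω.syn) :=
  x.map fun a => toLex (OrderDual.toDual a.1, ω.toSyn a.2)

/-- `s` divides the monomial `u`. -/
def MonDvd (s u : TMon₀ n) : Prop := ∃ t : TMon n, u = (t : TMon₀ n) + s

/-- The monomial of the (nonzero) term `c X^d`. -/
def mon (c : R) (d : Fin n →₀ ℕ) : TMon n := ((IsDiscreteValuationRing.addVal R c).toNat, d)

/-- `i` is the exponent at which the nonzero terms of `f` attain their maximum. -/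
def IsLeadExp (ω : MonomialOrder (Fin n)) (f : Tate R n) (i : Fin n →₀ ℕ) : Prop :=
  coeff i f.1 ≠ 0 ∧
    ∀ j, coeff j f.1 ≠ 0 → tKey ω (mon (coeff j f.1) j) ≤ tKey ω (mon (coeff i f.1) i)

open Classical in
/-- The exponent of the leading term of `f ≠ 0`. -/
def leadExp (ω : MonomialOrder (Fin n)) (f : Tate R n) : Fin n →₀ ℕ :=
  if h : ∃ i, IsLeadExp ω f i then h.choose else 0

/-- The coefficient of the leading term of `f ≠ 0`. -/
def leadCoeff (ω : MonomialOrder (Fin n)) (f : Tate R n) : R := coeff (leadExp ω f) f.1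

/-- The leading monomial of `f ≠ 0`. -/
def lm (ω : MonomialOrder (Fin n)) (f : Tate R n) : TMon n := mon (leadCoeff ω f) (leadExp ω f)

open Classical in
/-- The leading monomial, with value zero for `f = 0`. -/
def LM (ω : MonomialOrder (Fin n)) (f : Tate R n) : TMon₀ n :=
  if f = 0 then ⊥ else (lm ω f : TMon₀ n)

/-- `G` is a (finite) Gröbner basis of the ideal `I` of `K°{X}`. -/
def IsTateGB (ω : MonomialOrder (Fin n)) (I : Ideal (Tate R n)) (G : Set (Tate R n)) : Prop :=
  G.Finite ∧ G ⊆ I ∧ ∀ f ∈ I, f ≠ 0 → ∃ g ∈ G, MonDvd (LM ω g) (LM ω f)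

/-- `A` is a (finite) Gröbner basis of the ideal `J` of `k[X]`. -/
def IsPolyGB {k : Type*} [Field k] (ω : MonomialOrder (Fin n))
    (J : Ideal (MvPolynomial (Fin n) k)) (A : Set (MvPolynomial (Fin n) k)) : Prop :=
  A.Finite ∧ A ⊆ J ∧ ∀ p ∈ J, p ≠ 0 → ∃ q ∈ A, q ≠ 0 ∧ ω.degree q ≤ ω.degree p

/-- `π^{-N} I_N`, where `I_N = I ∩ π^N K°{X}`. -/
def divPow (ϖ : R) (N : ℕ) (I : Ideal (Tate R n)) : Ideal (Tate R n) where
  carrier := {h | term ϖ 0 ^ N * h ∈ I}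
  zero_mem' := by simp
  add_mem' {a b} ha hb := by
    simp only [Set.mem_ofPred_eq] at ha hb ⊢
    rw [mul_add]; exact I.add_mem ha hb
  smul_mem' c x hx := by
    simp only [Set.mem_ofPred_eq, smul_eq_mul] at hx ⊢
    rw [mul_left_comm]; exact I.mul_mem_left c hx

/-- `Ī_N`, the image of `π^{-N} I_N` in `k[X]` (an ideal, because `red` is surjective). -/
def barIdeal (ϖ : R) (N : ℕ) (I : Ideal (Tate R n)) :
    Ideal (MvPolynomial (Fin n) (IsLocalRing.ResidueField R)) :=
  (divPow ϖ N I).map red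

/-- `p = ρ(f)`: `f ≠ 0` and `p` is the reduction of `ν(f) = π^{-val f} f`. -/
def IsRho (ϖ : R) (f : Tate R n)
    (p : MvPolynomial (Fin n) (IsLocalRing.ResidueField R)) : Prop :=
  f ≠ 0 ∧ ∃ h : Tate R n, f = term ϖ 0 ^ (gaussVal f).toNat * h ∧ p = red h

/-- `ρ(A)` for a set `A` of series. -/
def rho (ϖ : R) (A : Set (Tate R n)) :
    Set (MvPolynomial (Fin n) (IsLocalRing.ResidueField R)) :=
  {p | ∃ f ∈ A, IsRho ϖ f p}

/-! ### The signature machinery -/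

variable (R n) in
/-- Pairs `(u, v)` where `u` is a signature (a monomial or zero) and `v` is a series. -/
abbrev SPair : Type _ := TMon₀ n × Tate R n

/-- The product of the pair `p` with the term `π^a X^i`, where `t = (a, i)`. -/
def SPair.scale (ϖ : R) (t : TMon n) (p : SPair R n) : SPair R n :=
  ((t : TMon₀ n) + p.1, term (ϖ ^ t.1) t.2 * p.2)

/-- The J-pair of `p₁` and `p₂` is defined and equal to `p`. -/
def IsJPair (ω : MonomialOrder (Fin n)) (ϖ : R) (p₁ p₂ p : SPair R n) : Prop :=
  p₁.2 ≠ 0 ∧ p₂.2 ≠ 0 ∧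
    let t := lm ω p₁.2 ⊔ lm ω p₂.2
    let t₁ := t - lm ω p₁.2
    let t₂ := t - lm ω p₂.2
    (tKey ω ((t₁ : TMon₀ n) + p₁.1) < tKey ω ((t₂ : TMon₀ n) + p₂.1) ∧ p = p₂.scale ϖ t₂) ∨
    (tKey ω ((t₂ : TMon₀ n) + p₂.1) < tKey ω ((t₁ : TMon₀ n) + p₁.1) ∧ p = p₁.scale ϖ t₁)

/-- `p = (u, v)` is covered by `G`: some `(uᵢ, vᵢ) ∈ G` has `u = t uᵢ` and `t LM(vᵢ) < LM(v)`. -/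
def Covered (ω : MonomialOrder (Fin n)) (G : Set (SPair R n)) (p : SPair R n) : Prop :=
  ∃ q ∈ G, ∃ t : TMon n, p.1 = (t : TMon₀ n) + q.1 ∧
    tKey ω ((t : TMon₀ n) + LM ω q.2) < tKey ω (LM ω p.2)

/-- One regular top-reduction of `v`, at signature `u`, by some `(s, g) ∈ G`:
`LT(v) = c X^d LT(g)`, `mon(c X^d) s < u` and `v' = v - c X^d g`. -/
def RegTopRed (ω : MonomialOrder (Fin n)) (u : TMon₀ n) (G : Set (SPair R n))
    (v v' : Tate R n) : Prop :=
  v ≠ 0 ∧ ∃ q ∈ G, q.2 ≠ 0 ∧ ∃ (c : R) (d : Fin n →₀ ℕ),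
    leadCoeff ω v = c * leadCoeff ω q.2 ∧ leadExp ω v = d + leadExp ω q.2 ∧
    tKey ω ((mon c d : TMon₀ n) + q.1) < tKey ω u ∧
    v' = v - term c d * q.2

/-- `v₀` is a possible result of `regular_reduce(u, v, G)`: regular top-reductions are applied
to `v` as long as possible. Either this stops after finitely many reductions, and `v₀` is what
is left, or it goes on forever, and `v₀` is the limit for the Gauss valuation. -/
def RegularReduce (ω : MonomialOrder (Fin n)) (u : TMon₀ n) (v : Tate R n) (G : Set (SPair R n))
    (v₀ : Tate R n) : Prop :=
  (Relation.ReflTransGen (RegTopRed ω u G) v v₀ ∧ ¬ ∃ v', RegTopRed ω u G v₀ v') ∨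
  ∃ w : ℕ → Tate R n, w 0 = v ∧ (∀ j, RegTopRed ω u G (w j) (w (j + 1))) ∧
    ∀ N : ℕ, ∃ J, ∀ j ≥ J, (N : ℕ∞) ≤ gaussVal (w j - v₀)

/-! ### The VaPoTe algorithm as a transition system -/

variable (R n) in
/-- States of the algorithm. `outer Q GBasis`: at the test of the main loop `while Q ≠ ∅`.
`inner Q GBasis f G S B`: at the test of the inner loop `while B ≠ ∅`. -/
inductive State : Type _
  | outer (Q : Multiset (Tate R n)) (GBasis : Set (Tate R n)) : State
  | inner (Q : Multiset (Tate R n)) (GBasis : Set (Tate R n)) (f : Tate R n)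
      (G : Set (SPair R n)) (S : Set (TMon₀ n)) (B : Set (SPair R n)) : State

/-- The current value of the variable `GBasis`. -/
def State.gbasis : State R n → Set (Tate R n)
  | .outer _ GBasis => GBasis
  | .inner _ GBasis _ _ _ _ => GBasis

/-- The algorithm has left the main loop: `Q = ∅`. -/
def State.Final : State R n → Prop
  | .outer Q _ => Q = 0
  | .inner _ _ _ _ _ _ => False

/-- `p` may be popped from `B`: its signature is smallest. -/
def IsMinSig (ω : MonomialOrder (Fin n)) (B : Set (SPair R n)) (p : SPair R n) : Prop :=
  p ∈ B ∧ ∀ q ∈ B, tKey ω p.1 ≤ tKey ω q.1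

/-- One of the two criteria (`continue` statements) applies to `p = (u, v)`: it is covered by `G`,
or `u` is divisible by an element of `S`. -/
def Criterion (ω : MonomialOrder (Fin n)) (G : Set (SPair R n)) (S : Set (TMon₀ n))
    (p : SPair R n) : Prop :=
  Covered ω G p ∨ ∃ s ∈ S, MonDvd s p.1

/-- The transitions of the algorithm: the initialisation part of the main loop (`pop`), one pass
through the inner loop (`skip`, `syzygy`, `add`), and the end of the main loop's body (`finish`). -/
inductive Step (ω : MonomialOrder (Fin n)) (ϖ : R) : State R n → State R n → Prop
  | pop (Q : Multiset (Tate R n)) (GBasis : Set (Tate R n)) (f : Tate R n)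
      (hmin : ∀ q ∈ Q, gaussVal f ≤ gaussVal q) :
      Step ω ϖ (.outer (f ::ₘ Q) GBasis)
        (.inner Q GBasis f
          ({p | ∃ g ∈ GBasis, p = (⊥, g)} ∪ {(((0 : TMon n) : TMon₀ n), f)})
          {s | ∃ g ∈ GBasis, s = LM ω g}
          {p | ∃ g ∈ GBasis, IsJPair ω ϖ (((0 : TMon n) : TMon₀ n), f) (⊥, g) p})
  | skip (Q : Multiset (Tate R n)) (GBasis : Set (Tate R n)) (f : Tate R n)
      (G : Set (SPair R n)) (S : Set (TMon₀ n)) (B : Set (SPair R n)) (p : SPair R n)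
      (hp : IsMinSig ω B p) (hc : Criterion ω G S p) :
      Step ω ϖ (.inner Q GBasis f G S B) (.inner Q GBasis f G S (B \ {p}))
  | syzygy (Q : Multiset (Tate R n)) (GBasis : Set (Tate R n)) (f : Tate R n)
      (G : Set (SPair R n)) (S : Set (TMon₀ n)) (B : Set (SPair R n)) (p : SPair R n)
      (v₀ : Tate R n) (hp : IsMinSig ω B p) (hc : ¬ Criterion ω G S p)
      (hr : RegularReduce ω p.1 p.2 G v₀) (hval : gaussVal f < gaussVal v₀) :
      Step ω ϖ (.inner Q GBasis f G S B)
        (.inner (v₀ ::ₘ Q) GBasis f G (S ∪ {p.1}) (B \ {p}))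
  | add (Q : Multiset (Tate R n)) (GBasis : Set (Tate R n)) (f : Tate R n)
      (G : Set (SPair R n)) (S : Set (TMon₀ n)) (B : Set (SPair R n)) (p : SPair R n)
      (v₀ : Tate R n) (hp : IsMinSig ω B p) (hc : ¬ Criterion ω G S p)
      (hr : RegularReduce ω p.1 p.2 G v₀) (hval : ¬ gaussVal f < gaussVal v₀) :
      Step ω ϖ (.inner Q GBasis f G S B)
        (.inner Q GBasis f (G ∪ {(p.1, v₀)}) S
          ((B \ {p}) ∪ {p' | ∃ q ∈ G, IsJPair ω ϖ (p.1, v₀) q p'}))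
  | finish (Q : Multiset (Tate R n)) (GBasis : Set (Tate R n)) (f : Tate R n)
      (G : Set (SPair R n)) (S : Set (TMon₀ n)) :
      Step ω ϖ (.inner Q GBasis f G S ∅) (.outer Q {v | ∃ u, (u, v) ∈ G})

/-- The initial state: `Q` is the input and `GBasis` is empty. -/
def initState {m : ℕ} (f : Fin m → Tate R n) : State R n :=
  .outer (Multiset.map f Finset.univ.val) ∅

/-- `st` is an execution of the algorithm on the input `f`: it performs transitions as long as the
algorithm has not left the main loop, and is constant afterwards. -/
def IsExecution (ω : MonomialOrder (Fin n)) (ϖ : R) {m : ℕ} (f : Fin m → Tate R n)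
    (st : ℕ → State R n) : Prop :=
  st 0 = initState f ∧
    ∀ i, Step ω ϖ (st i) (st (i + 1)) ∨ ((st i).Final ∧ st (i + 1) = st i)

end VaPoTe

end

/-!
The proof follows the valuation. All pairs with a nonzero signature which occur in the inner loop
for an `f` of valuation `N` have a series of valuation exactly `N`, and their signature has
valuation `0`; so signatures and leading monomials at this level are exponents, which a monomial
order well-orders. Series are compared through the groups `low N E`: the series of valuation at
least `N` whose terms of valuation exactly `N` have exponents in the initial segment `E`. Only
multiples by terms are formed, so multiplicativity of the Gauss valuation is not needed, except for
the easy inequality.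

*Buchberger's criterion.* The main loop keeps the property `Closed GB Q`: the difference of two
term multiples, with the same leading term, of elements of `GB` is a sum of term multiples of
elements of `GB` with smaller leading monomials and of multiples of elements of `GB` and `Q` of
larger valuation. Since the valuation must be strictly larger, an element of `Q` may later be moved
to `GB` without harm. When `Q` is empty this is Buchberger's criterion, proved one valuation
after the other (`std_of_low`, `exists_lm_le_of_mem_span`). There each valuation level needs
only an induction over exponents, so no limit is taken.

*The inner loop* restores this property (`CoverData.closed`). An S-pair at valuation `N`
involving a new element is a combination `a f + ∑ b g` whose signature is the leading exponent of
`a`. Standard representations are obtained by induction on this signature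
(`CoverData.sigStd_of_low_upTo`), from the cover criterion (`CoverData.exists_irreducible`): among
the multiples of signature `X^d` of elements of `G`, one with the smallest leading monomial is
irreducible, since otherwise it would be a multiple of a J-pair, and a pair covering this J-pair
would have a smaller multiple. If `X^d` is the signature of a syzygy, up to elements which were
put off, one passes to smaller signatures.

*Completeness* of the base ring is used at one point only: leading monomials of an infinite sequence
of reductions tend to zero (`null_of_regTopRed`), so `regular_reduce` returns `0`; to see that the
signature is that of a syzygy, the infinitely many multipliers have to be summed up
(`mem_tail_of_null`, `exists_mem_tail_of_regTopRed`).

*Termination.* Each pair added to `G` gives a (signature, leading exponent) not divisible by an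
earlier one (`InnerInv.sigLeadExps_lt`), so the inner loop ends by Dickson's lemma. For the main
loop, the set `L` of monomials divisible by a leading monomial of the basis cannot grow for ever. If
it does not grow for a popped `f ≠ 0`, then the first J-pair `(1, f)` is skipped or leads to a
syzygy, all others are skipped, and at most one series enters `Q`; it is zero or its leading
monomial is outside `L`, so a weighted count of `Q` decreases (`InnerInv.outerRank_lt`).
-/

noncomputable section
namespace VaPoTe
open MvPowerSeries IsDiscreteValuationRing
variable {R : Type*} [CommRing R] [IsDomain R] [IsDiscreteValuationRing R] {n : ℕ}

/-! ### The Gauss valuation -/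

lemma coeff_term_mul (c : R) (d m : Fin n →₀ ℕ) (f : Tate R n) :
    coeff m (term c d * f).1 = if d ≤ m then c * coeff (m - d) f.1 else 0 :=
  coeff_monomial_mul ..

lemma coeff_add_term_mul (c : R) (d m : Fin n →₀ ℕ) (f : Tate R n) :
    coeff (d + m) (term c d * f).1 = c * coeff m f.1 :=
  coeff_add_monomial_mul ..

lemma coeff_term (c : R) (d m : Fin n →₀ ℕ) [Decidable (m = d)] :
    coeff m (term c d : Tate R n).1 = if m = d then c else 0 := by
  classical
  refine (coeff_monomial ..).trans ?_
  congr

@[simp] lemma coeff_add' (i : Fin n →₀ ℕ) (f g : Tate R n) :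
    coeff i (f + g).1 = coeff i f.1 + coeff i g.1 := map_add (coeff i) f.1 g.1

@[simp] lemma coeff_sub' (i : Fin n →₀ ℕ) (f g : Tate R n) :
    coeff i (f - g).1 = coeff i f.1 - coeff i g.1 := map_sub (coeff i) f.1 g.1

@[simp] lemma coeff_neg' (i : Fin n →₀ ℕ) (f : Tate R n) :
    coeff i (-f).1 = -coeff i f.1 := map_neg (coeff i) f.1

@[simp] lemma coeff_zero' (i : Fin n →₀ ℕ) :
    coeff i (0 : Tate R n).1 = 0 := map_zero (coeff i)

lemma coeff_sum' {ι : Type*} (s : Finset ι) (F : ι → Tate R n) (i : Fin n →₀ ℕ) :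
    coeff i (∑ k ∈ s, F k).1 = ∑ k ∈ s, coeff i (F k).1 := by
  classical
  induction s using Finset.induction_on with
  | empty => simp
  | insert a s ha ih => rw [Finset.sum_insert ha, Finset.sum_insert ha, coeff_add', ih]

lemma tate_ext {f g : Tate R n} (h : ∀ i, coeff i f.1 = coeff i g.1) : f = g :=
  Subtype.ext (MvPowerSeries.ext h)

lemma term_mul_term (c c' : R) (d d' : Fin n →₀ ℕ) :
    (term c d * term c' d' : Tate R n) = term (c * c') (d + d') :=
  Subtype.ext (monomial_mul_monomial ..)

lemma term_add (c c' : R) (d : Fin n →₀ ℕ) :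
    (term (c + c') d : Tate R n) = term c d + term c' d :=
  Subtype.ext (map_add (monomial d) c c')

lemma term_neg (c : R) (d : Fin n →₀ ℕ) :
    (term (-c) d : Tate R n) = -term c d :=
  Subtype.ext (map_neg (monomial d) c)

lemma term_zero (d : Fin n →₀ ℕ) : (term (0 : R) d : Tate R n) = 0 :=
  Subtype.ext (map_zero (monomial d))

lemma term_one_zero : (term (1 : R) 0 : Tate R n) = 1 := rfl

lemma term_pow_zero (c : R) (N : ℕ) : (term c 0 : Tate R n) ^ N = term (c ^ N) 0 := by
  induction N with
  | zero => simp [term_one_zero]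
  | succ N ih => rw [pow_succ, ih, term_mul_term, add_zero, pow_succ]

lemma le_gaussVal_iff {f : Tate R n} {a : ℕ∞} :
    a ≤ gaussVal f ↔ ∀ i, a ≤ addVal R (coeff i f.1) := le_iInf_iff

lemma gaussVal_le (f : Tate R n) (i : Fin n →₀ ℕ) : gaussVal f ≤ addVal R (coeff i f.1) :=
  iInf_le _ i

lemma exists_gaussVal_eq (f : Tate R n) : ∃ i, addVal R (coeff i f.1) = gaussVal f :=
  ciInf_mem fun i => addVal R (coeff i f.1)

lemma gaussVal_eq_top_iff {f : Tate R n} : gaussVal f = ⊤ ↔ f = 0 := by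
  constructor
  · intro h
    refine tate_ext fun i => ?_
    have := gaussVal_le f i
    rw [h, top_le_iff, addVal_eq_top_iff] at this
    simpa using this
  · rintro rfl
    rw [← top_le_iff, le_gaussVal_iff]
    simp

@[simp] lemma gaussVal_zero : gaussVal (0 : Tate R n) = ⊤ := gaussVal_eq_top_iff.mpr rfl

lemma le_gaussVal_add {f g : Tate R n} {a : ℕ∞} (hf : a ≤ gaussVal f) (hg : a ≤ gaussVal g) :
    a ≤ gaussVal (f + g) := by
  rw [le_gaussVal_iff] at *
  intro i
  rw [coeff_add']
  exact (le_min (hf i) (hg i)).trans addVal_add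

@[simp] lemma gaussVal_neg (f : Tate R n) : gaussVal (-f) = gaussVal f := by
  simp [gaussVal, AddValuation.map_neg]

lemma le_gaussVal_sub {f g : Tate R n} {a : ℕ∞} (hf : a ≤ gaussVal f) (hg : a ≤ gaussVal g) :
    a ≤ gaussVal (f - g) := by
  rw [sub_eq_add_neg]
  exact le_gaussVal_add hf (by simpa using hg)

lemma le_gaussVal_sum {ι : Type*} {s : Finset ι} {F : ι → Tate R n} {a : ℕ∞}
    (h : ∀ k ∈ s, a ≤ gaussVal (F k)) : a ≤ gaussVal (∑ k ∈ s, F k) := by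
  classical
  induction s using Finset.induction_on with
  | empty => simp
  | insert k s hk ih =>
    rw [Finset.sum_insert hk]
    exact le_gaussVal_add (h k (by simp)) (ih fun j hj => h j (by simp [hj]))

lemma gaussVal_add_le_mul (f g : Tate R n) : gaussVal f + gaussVal g ≤ gaussVal (f * g) := by
  classical
  rw [le_gaussVal_iff]
  intro i
  have : coeff i (f * g).1 =
      ∑ p ∈ Finset.HasAntidiagonal.antidiagonal i, coeff p.1 f.1 * coeff p.2 g.1 := coeff_mul ..
  rw [this]
  refine AddValuation.map_le_sum _ fun p _ => ?_
  rw [addVal_mul]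
  exact add_le_add (gaussVal_le f _) (gaussVal_le g _)

lemma gaussVal_term_mul (c : R) (d : Fin n →₀ ℕ) (f : Tate R n) :
    gaussVal (term c d * f) = addVal R c + gaussVal f := by
  refine le_antisymm ?_ ?_
  · obtain ⟨i, hi⟩ := exists_gaussVal_eq f
    rw [← hi, ← addVal_mul, ← coeff_add_term_mul]
    exact gaussVal_le _ _
  · rw [le_gaussVal_iff]
    intro i
    rw [coeff_term_mul]
    split_ifs
    · rw [addVal_mul]
      exact add_le_add le_rfl (gaussVal_le _ _)
    · simp

lemma gaussVal_one : gaussVal (1 : Tate R n) = 0 := by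
  classical
  refine le_antisymm ?_ zero_le
  have := gaussVal_le (1 : Tate R n) 0
  rwa [← term_one_zero, coeff_term, if_pos rfl, addVal_one] at this

lemma gaussVal_term (c : R) (d : Fin n →₀ ℕ) : gaussVal (term c d : Tate R n) = addVal R c := by
  have := gaussVal_term_mul c d 1
  rwa [mul_one, gaussVal_one, add_zero] at this

/-! ### Initial segments of exponents and leading monomials -/

/-- The exponents strictly below `e`. -/
def below (ω : MonomialOrder (Fin n)) (e : Fin n →₀ ℕ) : Set (Fin n →₀ ℕ) :=
  {i | ω.toSyn i < ω.toSyn e}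

/-- The exponents at most `e`. -/
def upTo (ω : MonomialOrder (Fin n)) (e : Fin n →₀ ℕ) : Set (Fin n →₀ ℕ) :=
  {i | ω.toSyn i ≤ ω.toSyn e}

/-- `E` is an initial segment for the monomial order. -/
def IsInitial (ω : MonomialOrder (Fin n)) (E : Set (Fin n →₀ ℕ)) : Prop :=
  ∀ i ∈ E, ∀ j, ω.toSyn j ≤ ω.toSyn i → j ∈ E

lemma isInitial_below (ω : MonomialOrder (Fin n)) (e : Fin n →₀ ℕ) : IsInitial ω (below ω e) :=
  fun _ hi _ hj => lt_of_le_of_lt hj hi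

lemma isInitial_upTo (ω : MonomialOrder (Fin n)) (e : Fin n →₀ ℕ) : IsInitial ω (upTo ω e) :=
  fun _ hi _ hj => le_trans hj hi

lemma isInitial_empty (ω : MonomialOrder (Fin n)) : IsInitial ω ∅ :=
  fun _ hi => hi.elim

lemma IsInitial.upTo_subset {ω : MonomialOrder (Fin n)} {E : Set (Fin n →₀ ℕ)}
    (hE : IsInitial ω E) {e : Fin n →₀ ℕ} (he : e ∈ E) : upTo ω e ⊆ E :=
  fun _ hi => hE e he _ hi

lemma below_subset_upTo (ω : MonomialOrder (Fin n)) (e : Fin n →₀ ℕ) : below ω e ⊆ upTo ω e :=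
  fun _ hi => le_of_lt hi

lemma upTo_subset_below {ω : MonomialOrder (Fin n)} {d e : Fin n →₀ ℕ}
    (h : ω.toSyn d < ω.toSyn e) : upTo ω d ⊆ below ω e :=
  (isInitial_below ω e).upTo_subset h

/-- The series of Gauss valuation at least `N` whose coefficients of valuation exactly `N` have
their exponent in `E`. For `E = below ω e` these are the series whose leading monomial is smaller
than `(N, e)`. -/
def low (N : ℕ) (E : Set (Fin n →₀ ℕ)) : AddSubgroup (Tate R n) where
  carrier := {f | ∀ i, (N : ℕ∞) ≤ addVal R (coeff i f.1) ∧
    (i ∉ E → ((N + 1 : ℕ) : ℕ∞) ≤ addVal R (coeff i f.1))}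
  zero_mem' i := by simp
  add_mem' {f g} hf hg i := by
    rw [coeff_add']
    exact ⟨(le_min (hf i).1 (hg i).1).trans addVal_add,
      fun h => (le_min ((hf i).2 h) ((hg i).2 h)).trans addVal_add⟩
  neg_mem' {f} hf i := by
    rw [coeff_neg', AddValuation.map_neg]
    exact hf i

lemma mem_low {N : ℕ} {E : Set (Fin n →₀ ℕ)} {f : Tate R n} :
    f ∈ low N E ↔ ∀ i, (N : ℕ∞) ≤ addVal R (coeff i f.1) ∧
      (i ∉ E → ((N + 1 : ℕ) : ℕ∞) ≤ addVal R (coeff i f.1)) := Iff.rfl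

lemma low_mono {N : ℕ} {E E' : Set (Fin n →₀ ℕ)} (h : E ⊆ E') :
    (low N E : AddSubgroup (Tate R n)) ≤ low N E' :=
  fun _ hf i => ⟨(hf i).1, fun hi => (hf i).2 fun h' => hi (h h')⟩

lemma mem_low_univ {N : ℕ} {f : Tate R n} : f ∈ low N Set.univ ↔ (N : ℕ∞) ≤ gaussVal f := by
  simp [mem_low, le_gaussVal_iff]

lemma mem_low_empty {N : ℕ} {f : Tate R n} :
    f ∈ low N ∅ ↔ ((N + 1 : ℕ) : ℕ∞) ≤ gaussVal f := by
  rw [mem_low, le_gaussVal_iff]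
  refine ⟨fun h i => (h i).2 id, fun h i => ⟨le_trans ?_ (h i), fun _ => h i⟩⟩
  exact_mod_cast Nat.le_succ N

lemma low_of_lt {N : ℕ} {E : Set (Fin n →₀ ℕ)} {f : Tate R n}
    (h : ((N + 1 : ℕ) : ℕ∞) ≤ gaussVal f) : f ∈ low N E :=
  low_mono (Set.empty_subset E) (mem_low_empty.mpr h)

lemma le_gaussVal_of_low {N : ℕ} {E : Set (Fin n →₀ ℕ)} {f : Tate R n} (h : f ∈ low N E) :
    (N : ℕ∞) ≤ gaussVal f := le_gaussVal_iff.mpr fun i => (h i).1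

lemma low_term_mul {N a : ℕ} {c : R} (hc : (a : ℕ∞) ≤ addVal R c) {E E' : Set (Fin n →₀ ℕ)}
    {d : Fin n →₀ ℕ} (hE : ∀ i ∈ E, d + i ∈ E') {f : Tate R n} (hf : f ∈ low N E) :
    term c d * f ∈ low (a + N) E' := by
  intro i
  rw [coeff_term_mul]
  split_ifs with h
  · rw [addVal_mul]
    refine ⟨?_, fun hi => ?_⟩
    · push_cast
      exact add_le_add hc (hf _).1
    · have := (hf (i - d)).2 fun h' => hi (by simpa [add_tsub_cancel_of_le h] using hE _ h')
      rw [add_assoc]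
      push_cast at this ⊢
      exact add_le_add hc this
  · simp

lemma low_term_mul_below {ω : MonomialOrder (Fin n)} {N a : ℕ} {c : R}
    (hc : (a : ℕ∞) ≤ addVal R c) (d : Fin n →₀ ℕ) {e : Fin n →₀ ℕ} {f : Tate R n}
    (hf : f ∈ low N (below ω e)) : term c d * f ∈ low (a + N) (below ω (d + e)) :=
  low_term_mul hc (fun i (hi : _ < _) => by simpa [below] using hi) hf

lemma low_term_mul_upTo {ω : MonomialOrder (Fin n)} {N a : ℕ} {c : R}
    (hc : (a : ℕ∞) ≤ addVal R c) (d : Fin n →₀ ℕ) {e : Fin n →₀ ℕ} {f : Tate R n}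
    (hf : f ∈ low N (upTo ω e)) : term c d * f ∈ low (a + N) (upTo ω (d + e)) :=
  low_term_mul hc (fun i (hi : _ ≤ _) => by simpa [upTo] using hi) hf

/-- `T` is the leading monomial of the nonzero series `f`. -/
def IsLead (ω : MonomialOrder (Fin n)) (f : Tate R n) (T : TMon n) : Prop :=
  addVal R (coeff T.2 f.1) = T.1 ∧ f ∈ low T.1 (upTo ω T.2)

lemma IsLead.ne_zero {ω : MonomialOrder (Fin n)} {f : Tate R n} {T : TMon n}
    (h : IsLead ω f T) : f ≠ 0 := by
  rintro rfl
  simpa using h.1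

lemma IsLead.gaussVal {ω : MonomialOrder (Fin n)} {f : Tate R n} {T : TMon n}
    (h : IsLead ω f T) : gaussVal f = T.1 :=
  le_antisymm ((gaussVal_le f T.2).trans h.1.le) (le_gaussVal_of_low h.2)

lemma exists_isLead (ω : MonomialOrder (Fin n)) {f : Tate R n} (hf : f ≠ 0) :
    ∃ T, IsLead ω f T := by
  have htop : gaussVal f ≠ ⊤ := fun h => hf (gaussVal_eq_top_iff.mp h)
  lift gaussVal f to ℕ using htop with N hN
  obtain ⟨i₀, hi₀⟩ := exists_gaussVal_eq f
  have hfin : {i | addVal R (coeff i f.1) = N}.Finite :=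
    (f.2 (N + 1)).subset fun i (hi : _ = _) => by
      simp only [Set.mem_ofPred_eq, hi]
      exact_mod_cast Nat.lt_succ_self N
  obtain ⟨e, he, hmax⟩ := Set.exists_max_image _ ω.toSyn hfin ⟨i₀, hi₀.trans hN.symm⟩
  refine ⟨(N, e), he, fun i => ?_⟩
  have hle : (N : ℕ∞) ≤ addVal R (coeff i f.1) := hN.le.trans (gaussVal_le f i)
  refine ⟨hle, fun hi => ?_⟩
  push_cast
  refine Order.add_one_le_of_lt (lt_of_le_of_ne hle fun h => hi (hmax i h.symm))

lemma isLead_unique {ω : MonomialOrder (Fin n)} {f : Tate R n} {T T' : TMon n}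
    (h : IsLead ω f T) (h' : IsLead ω f T') : T = T' := by
  have h1 : T.1 = T'.1 := by exact_mod_cast h.gaussVal.symm.trans h'.gaussVal
  have key : ∀ {T T' : TMon n}, T.1 = T'.1 → IsLead ω f T → IsLead ω f T' →
      ω.toSyn T.2 ≤ ω.toSyn T'.2 := by
    intro T T' h1 h h'
    by_contra hlt
    have := (h'.2 T.2).2 hlt
    rw [h.1, h1] at this
    exact absurd this (by exact_mod_cast Nat.not_succ_le_self _)
  exact Prod.ext h1 (ω.toSyn.injective ((key h1 h h').antisymm (key h1.symm h' h)))

lemma tKey_coe_lt {ω : MonomialOrder (Fin n)} {T T' : TMon n} :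
    tKey ω (T : TMon₀ n) < tKey ω (T' : TMon₀ n) ↔
      T'.1 < T.1 ∨ T.1 = T'.1 ∧ ω.toSyn T.2 < ω.toSyn T'.2 := by
  simp [tKey, Prod.Lex.toLex_lt_toLex]

lemma tKey_coe_le {ω : MonomialOrder (Fin n)} {T T' : TMon n} :
    tKey ω (T : TMon₀ n) ≤ tKey ω (T' : TMon₀ n) ↔
      T'.1 < T.1 ∨ T.1 = T'.1 ∧ ω.toSyn T.2 ≤ ω.toSyn T'.2 := by
  simp [tKey, Prod.Lex.toLex_le_toLex]

@[simp] lemma tKey_bot (ω : MonomialOrder (Fin n)) : tKey ω ⊥ = ⊥ := rfl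

lemma bot_lt_tKey_coe (ω : MonomialOrder (Fin n)) (T : TMon n) :
    ⊥ < tKey ω (T : TMon₀ n) := WithBot.bot_lt_coe _

lemma tKey_injective (ω : MonomialOrder (Fin n)) : Function.Injective (tKey ω) := by
  refine WithBot.map_injective fun a b h => ?_
  have h' := toLex.injective h
  simp only [Prod.mk.injEq, EmbeddingLike.apply_eq_iff_eq] at h'
  exact Prod.ext h'.1 h'.2

lemma mon_of_addVal {c : R} {a : ℕ} (h : addVal R c = a) (d : Fin n →₀ ℕ) : mon c d = (a, d) := by
  simp [mon, h]

lemma isLead_iff_isLeadExp {ω : MonomialOrder (Fin n)} {f : Tate R n} {T : TMon n}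
    (h : IsLead ω f T) {i : Fin n →₀ ℕ} : IsLeadExp ω f i ↔ i = T.2 := by
  have hexp : IsLeadExp ω f T.2 := by
    refine ⟨fun h0 => by simpa [h0] using h.1, fun j hj => ?_⟩
    rw [mon_of_addVal h.1, tKey_coe_le]
    have hj' : addVal R (coeff j f.1) ≠ ⊤ := fun h => hj (addVal_eq_top_iff.mp h)
    obtain ⟨a, ha⟩ := ENat.ne_top_iff_exists.mp hj'
    rw [mon_of_addVal ha.symm]
    have h1 := (h.2 j).1
    have h2 := (h.2 j).2
    rw [← ha] at h1 h2
    have h1' : T.1 ≤ a := by exact_mod_cast h1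
    rcases h1'.lt_or_eq with hlt | heq
    · exact Or.inl hlt
    · refine Or.inr ⟨heq.symm, not_lt.mp fun hlt => ?_⟩
      have : T.1 + 1 ≤ a := by exact_mod_cast h2 (not_le.mpr hlt)
      omega
  refine ⟨fun hi => ?_, fun hi => hi ▸ hexp⟩
  have := tKey_injective ω ((hexp.2 i hi.1).antisymm (hi.2 _ hexp.1))
  exact congrArg Prod.snd (WithBot.coe_injective this)

lemma IsLead.leadExp {ω : MonomialOrder (Fin n)} {f : Tate R n} {T : TMon n}
    (h : IsLead ω f T) : leadExp ω f = T.2 := by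
  have hex : ∃ i, IsLeadExp ω f i := ⟨T.2, (isLead_iff_isLeadExp h).mpr rfl⟩
  rw [VaPoTe.leadExp, dif_pos hex]
  exact (isLead_iff_isLeadExp h).mp hex.choose_spec

lemma IsLead.leadCoeff {ω : MonomialOrder (Fin n)} {f : Tate R n} {T : TMon n}
    (h : IsLead ω f T) : leadCoeff ω f = coeff T.2 f.1 := by
  rw [VaPoTe.leadCoeff, h.leadExp]

lemma IsLead.lm_eq {ω : MonomialOrder (Fin n)} {f : Tate R n} {T : TMon n}
    (h : IsLead ω f T) : lm ω f = T := by
  rw [lm, h.leadCoeff, h.leadExp, mon_of_addVal h.1]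

lemma isLead_lm (ω : MonomialOrder (Fin n)) {f : Tate R n} (hf : f ≠ 0) : IsLead ω f (lm ω f) := by
  obtain ⟨T, hT⟩ := exists_isLead ω hf
  rwa [hT.lm_eq]

lemma gaussVal_eq_lm (ω : MonomialOrder (Fin n)) {f : Tate R n} (hf : f ≠ 0) :
    gaussVal f = (lm ω f).1 := (isLead_lm ω hf).gaussVal

lemma LM_of_ne {ω : MonomialOrder (Fin n)} {f : Tate R n} (hf : f ≠ 0) :
    LM ω f = (lm ω f : TMon₀ n) := if_neg hf

@[simp] lemma LM_zero (ω : MonomialOrder (Fin n)) : LM ω (0 : Tate R n) = ⊥ := if_pos rfl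

lemma IsLead.term_mul {ω : MonomialOrder (Fin n)} {f : Tate R n} {T : TMon n}
    (h : IsLead ω f T) {c : R} {a : ℕ} (hc : addVal R c = a) (d : Fin n →₀ ℕ) :
    IsLead ω (term c d * f) (a + T.1, d + T.2) := by
  refine ⟨?_, low_term_mul_upTo hc.ge d h.2⟩
  rw [coeff_add_term_mul, addVal_mul, hc, h.1]
  rfl

/-- The leading monomial of a term multiple, with the valuation of the coefficient recovered from
the leading monomials. -/
lemma IsLead.of_term_mul {ω : MonomialOrder (Fin n)} {f : Tate R n} {T T' : TMon n} {c : R}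
    {d : Fin n →₀ ℕ} (h : IsLead ω f T) (h' : IsLead ω (term c d * f) T') :
    ∃ a : ℕ, addVal R c = a ∧ T' = (a + T.1, d + T.2) := by
  have hc : addVal R c ≠ ⊤ := fun hc => h'.ne_zero (by
    rw [addVal_eq_top_iff.mp hc, term_zero, zero_mul])
  obtain ⟨a, ha⟩ := ENat.ne_top_iff_exists.mp hc
  exact ⟨a, ha.symm, isLead_unique h' (h.term_mul ha.symm d)⟩

/-- A series of `low N (upTo ω e)` either is in `low N (below ω e)` or has leading monomial
`(N, e)`. -/
lemma low_below_or_isLead {ω : MonomialOrder (Fin n)} {N : ℕ} {e : Fin n →₀ ℕ} {f : Tate R n}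
    (h : f ∈ low N (upTo ω e)) : f ∈ low N (below ω e) ∨ IsLead ω f (N, e) := by
  by_cases he : addVal R (coeff e f.1) = N
  · exact Or.inr ⟨he, h⟩
  · refine Or.inl fun i => ⟨(h i).1, fun hi => ?_⟩
    rcases (not_lt.mp hi).lt_or_eq with hlt | heq
    · exact (h i).2 (not_le.mpr hlt)
    · rw [ω.toSyn.injective heq.symm]
      push_cast
      exact Order.add_one_le_of_lt (lt_of_le_of_ne (h e).1 (Ne.symm he))

lemma IsLead.not_mem_low {ω : MonomialOrder (Fin n)} {N : ℕ} {e : Fin n →₀ ℕ} {f : Tate R n}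
    (h : IsLead ω f (N, e)) {E : Set (Fin n →₀ ℕ)} (he : e ∉ E) : f ∉ low N E := by
  intro hf
  have := (hf e).2 he
  rw [h.1] at this
  exact absurd this (by exact_mod_cast Nat.not_succ_le_self _)

lemma not_mem_below (ω : MonomialOrder (Fin n)) (e : Fin n →₀ ℕ) : e ∉ below ω e :=
  lt_irrefl (ω.toSyn e)

/-- Two series with the same leading term cancel to a smaller leading monomial. -/
lemma IsLead.sub_mem_low {ω : MonomialOrder (Fin n)} {T : TMon n} {f g : Tate R n}
    (hf : IsLead ω f T) (hg : IsLead ω g T) (h : coeff T.2 f.1 = coeff T.2 g.1) :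
    f - g ∈ low T.1 (below ω T.2) := by
  rcases low_below_or_isLead (sub_mem hf.2 hg.2) with h' | h'
  · exact h'
  · have := h'.1
    rw [coeff_sub', h, sub_self, addVal_zero] at this
    exact absurd this (ENat.top_ne_natCast _)

lemma low_lm_lt {ω : MonomialOrder (Fin n)} {N : ℕ} {e : Fin n →₀ ℕ} {f : Tate R n}
    (h : f ∈ low N (below ω e)) (hf : f ≠ 0) :
    N < (lm ω f).1 ∨ (lm ω f).1 = N ∧ ω.toSyn (lm ω f).2 < ω.toSyn e := by
  have hl := isLead_lm ω hf
  have h1 : N ≤ (lm ω f).1 := by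
    have := le_gaussVal_of_low h
    rw [hl.gaussVal] at this
    exact_mod_cast this
  rcases h1.lt_or_eq with hlt | heq
  · exact Or.inl hlt
  · refine Or.inr ⟨heq.symm, ?_⟩
    by_contra hge
    have := (h (lm ω f).2).2 hge
    rw [hl.1, ← heq] at this
    exact absurd this (by exact_mod_cast Nat.not_succ_le_self _)

lemma LM_lt_of_low {ω : MonomialOrder (Fin n)} {N : ℕ} {e : Fin n →₀ ℕ} {f : Tate R n}
    (h : f ∈ low N (below ω e)) : tKey ω (LM ω f) < tKey ω (((N, e) : TMon n) : TMon₀ n) := by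
  by_cases hf : f = 0
  · rw [hf, LM_zero]
    exact bot_lt_tKey_coe ω _
  · rw [LM_of_ne hf, tKey_coe_lt]
    exact low_lm_lt h hf

/-- A series is the finite sum of its terms of minimal valuation, plus a rest of larger
valuation. -/
lemma exists_sum_term_add {N : ℕ} {E : Set (Fin n →₀ ℕ)} {f : Tate R n} (h : f ∈ low N E) :
    ∃ (s : Finset (Fin n →₀ ℕ)) (g : Tate R n),
      (∀ i ∈ s, i ∈ E) ∧ ((N + 1 : ℕ) : ℕ∞) ≤ gaussVal g ∧
      f = ∑ i ∈ s, term (coeff i f.1) i + g := by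
  classical
  refine ⟨(f.2 (N + 1)).toFinset, f - ∑ i ∈ (f.2 (N + 1)).toFinset, term (coeff i f.1) i,
    fun i hi => ?_, ?_, by abel⟩
  · rw [Set.Finite.mem_toFinset, Set.mem_ofPred_eq] at hi
    by_contra hE
    exact absurd ((h i).2 hE) (not_le.mpr (by exact_mod_cast hi))
  · rw [le_gaussVal_iff]
    intro i
    rw [coeff_sub', coeff_sum']
    simp only [coeff_term]
    rw [Finset.sum_ite_eq]
    split_ifs with hi
    · simp
    · rw [Set.Finite.mem_toFinset, Set.mem_ofPred_eq, not_lt] at hi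
      rw [sub_zero]
      exact_mod_cast hi

/-! ### Standard representations and Buchberger's criterion, one valuation at a time -/

lemma le_gaussVal_mul {a : ℕ∞} {f : Tate R n} (g : Tate R n) (h : a ≤ gaussVal f) :
    a ≤ gaussVal (g * f) :=
  h.trans (le_add_self.trans (gaussVal_add_le_mul g f))

lemma mem_of_mem_span {Y : Set (Tate R n)} {A : AddSubgroup (Tate R n)}
    (h : ∀ y ∈ Y, ∀ a : Tate R n, a * y ∈ A) {z : Tate R n} (hz : z ∈ Ideal.span Y) : z ∈ A := by
  suffices ∀ a : Tate R n, a * z ∈ A by simpa using this 1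
  induction hz using Submodule.span_induction with
  | mem x hx => exact h x hx
  | zero => intro a; simp [zero_mem]
  | add x y _ _ hx hy => intro a; rw [mul_add]; exact add_mem (hx a) (hy a)
  | smul b x _ hx => intro a; rw [smul_eq_mul, ← mul_assoc]; exact hx _

/-- The ideal generated by the products `b x`, with `x ∈ P`, which are bound to have valuation
greater than `N`. -/
def tail (N : ℕ) (P : Set (Tate R n)) : Ideal (Tate R n) :=
  Ideal.span {y | ∃ x ∈ P, ∃ b : Tate R n,
    ((N + 1 : ℕ) : ℕ∞) ≤ gaussVal b + gaussVal x ∧ y = b * x}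

lemma mul_mem_tail {N : ℕ} {P : Set (Tate R n)} {x b : Tate R n} (hx : x ∈ P)
    (h : ((N + 1 : ℕ) : ℕ∞) ≤ gaussVal b + gaussVal x) : b * x ∈ tail N P :=
  Ideal.subset_span ⟨x, hx, b, h, rfl⟩

lemma tail_mono {N : ℕ} {P P' : Set (Tate R n)} (h : P ⊆ P') : tail N P ≤ tail N P' :=
  Ideal.span_mono fun _ ⟨x, hx, b, hb, hy⟩ => ⟨x, h hx, b, hb, hy⟩

lemma le_gaussVal_of_mem_tail {N : ℕ} {P : Set (Tate R n)} {y : Tate R n} (h : y ∈ tail N P) :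
    ((N + 1 : ℕ) : ℕ∞) ≤ gaussVal y := by
  rw [← mem_low_empty]
  refine mem_of_mem_span ?_ h
  rintro _ ⟨x, -, b, hb, rfl⟩ a
  exact mem_low_empty.mpr (le_gaussVal_mul a (hb.trans (gaussVal_add_le_mul b x)))

lemma term_mul_mem_tail {N k : ℕ} {P : Set (Tate R n)} {c : R} (hc : addVal R c = k)
    (d : Fin n →₀ ℕ) {y : Tate R n} (h : y ∈ tail N P) : term c d * y ∈ tail (k + N) P := by
  induction h using Submodule.span_induction with
  | mem y hy =>
    obtain ⟨x, hx, b, hb, rfl⟩ := hy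
    rw [← mul_assoc]
    refine mul_mem_tail hx ?_
    rw [gaussVal_term_mul, hc, add_assoc, add_assoc]
    push_cast at hb ⊢
    exact add_le_add le_rfl hb
  | zero => simp
  | add x y _ _ hx hy => rw [mul_add]; exact add_mem hx hy
  | smul b x _ hx =>
    rw [smul_eq_mul, mul_left_comm]
    exact Ideal.mul_mem_left _ _ hx

/-- The sums of term multiples of elements of `P` belonging to `low N E`, up to `W`. -/
def std (P : Set (Tate R n)) (W : Ideal (Tate R n)) (N : ℕ) (E : Set (Fin n →₀ ℕ)) :
    AddSubgroup (Tate R n) :=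
  AddSubgroup.closure {y | ∃ x ∈ P, ∃ (c : R) (d : Fin n →₀ ℕ), y = term c d * x ∧ y ∈ low N E} ⊔
    W.toAddSubgroup

lemma term_mul_mem_std {P : Set (Tate R n)} {W : Ideal (Tate R n)} {N : ℕ}
    {E : Set (Fin n →₀ ℕ)} {x : Tate R n} (hx : x ∈ P) {c : R} {d : Fin n →₀ ℕ}
    (h : term c d * x ∈ low N E) : term c d * x ∈ std P W N E :=
  AddSubgroup.mem_sup_left (AddSubgroup.subset_closure ⟨x, hx, c, d, rfl, h⟩)

lemma le_std {P : Set (Tate R n)} {W : Ideal (Tate R n)} {N : ℕ} {E : Set (Fin n →₀ ℕ)} :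
    W.toAddSubgroup ≤ std P W N E := le_sup_right

lemma std_le {P : Set (Tate R n)} {W : Ideal (Tate R n)} {N : ℕ} {E : Set (Fin n →₀ ℕ)}
    {A : AddSubgroup (Tate R n)}
    (h : ∀ x ∈ P, ∀ (c : R) (d : Fin n →₀ ℕ), term c d * x ∈ low N E → term c d * x ∈ A)
    (hW : W.toAddSubgroup ≤ A) : std P W N E ≤ A := by
  refine sup_le ((AddSubgroup.closure_le A).mpr ?_) hW
  rintro _ ⟨x, hx, c, d, rfl, hl⟩
  exact h x hx c d hl

lemma std_mono {P P' : Set (Tate R n)} (hP : P ⊆ P') {W W' : Ideal (Tate R n)} (hW : W ≤ W')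
    {N : ℕ} {E E' : Set (Fin n →₀ ℕ)} (hE : E ⊆ E') : std P W N E ≤ std P' W' N E' :=
  std_le (fun _ hx _ _ hl => term_mul_mem_std (hP hx) (low_mono hE hl)) fun _ h => le_std (hW h)

lemma std_le_low {P : Set (Tate R n)} {W : Ideal (Tate R n)} {N : ℕ} {E : Set (Fin n →₀ ℕ)}
    (hW : ∀ y ∈ W, ((N + 1 : ℕ) : ℕ∞) ≤ gaussVal y) : std P W N E ≤ low N E :=
  std_le (fun _ _ _ _ hl => hl) fun y h => low_of_lt (hW y h)

lemma low_cases {ω : MonomialOrder (Fin n)} {N : ℕ} {E : Set (Fin n →₀ ℕ)} {f : Tate R n}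
    (h : f ∈ low N E) : f ∈ low N ∅ ∨ ∃ e ∈ E, IsLead ω f (N, e) := by
  by_cases h0 : ((N + 1 : ℕ) : ℕ∞) ≤ gaussVal f
  · exact Or.inl (mem_low_empty.mpr h0)
  · have hne : f ≠ 0 := by
      rintro rfl
      simp at h0
    obtain ⟨⟨a, e⟩, hT⟩ := exists_isLead ω hne
    have h1 := le_gaussVal_of_low h
    rw [hT.gaussVal] at h0 h1
    have : a = N := by
      have h1' : N ≤ a := by exact_mod_cast h1
      have h0' : ¬ N + 1 ≤ a := by exact_mod_cast h0
      omega
    subst this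
    refine Or.inr ⟨e, ?_, hT⟩
    by_contra he
    exact hT.not_mem_low he h

/-- A sum of finitely many elements indexed by members of an initial segment is supported on a
principal initial segment, or on the empty one. -/
lemma closure_initial_cases {ω : MonomialOrder (Fin n)} {E : Set (Fin n →₀ ℕ)}
    {A : Set (Fin n →₀ ℕ) → AddSubgroup (Tate R n)} (hA : Monotone A) {Y : Set (Tate R n)}
    (hY : ∀ y ∈ Y, y ∈ A ∅ ∨ ∃ e ∈ E, y ∈ A (upTo ω e)) {v : Tate R n}
    (hv : v ∈ AddSubgroup.closure Y) : v ∈ A ∅ ∨ ∃ e ∈ E, v ∈ A (upTo ω e) := by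
  induction hv using AddSubgroup.closure_induction with
  | mem y hy => exact hY y hy
  | zero => exact Or.inl (zero_mem _)
  | neg y _ h =>
    rcases h with h | ⟨e, he, h⟩
    · exact Or.inl (neg_mem h)
    · exact Or.inr ⟨e, he, neg_mem h⟩
  | add y z _ _ hy hz =>
    rcases hy with hy | ⟨e, he, hy⟩ <;> rcases hz with hz | ⟨e', he', hz⟩
    · exact Or.inl (add_mem hy hz)
    · exact Or.inr ⟨e', he', add_mem (hA (Set.empty_subset _) hy) hz⟩
    · exact Or.inr ⟨e, he, add_mem hy (hA (Set.empty_subset _) hz)⟩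
    · rcases le_total (ω.toSyn e) (ω.toSyn e') with h | h
      · exact Or.inr ⟨e', he', add_mem (hA ((isInitial_upTo ω e').upTo_subset h) hy) hz⟩
      · exact Or.inr ⟨e, he, add_mem hy (hA ((isInitial_upTo ω e).upTo_subset h) hz)⟩

lemma std_cases {ω : MonomialOrder (Fin n)} {P : Set (Tate R n)} {W : Ideal (Tate R n)} {N : ℕ}
    {E : Set (Fin n →₀ ℕ)} {v : Tate R n} (hv : v ∈ std P W N E) :
    v ∈ std P W N ∅ ∨ ∃ e ∈ E, v ∈ std P W N (upTo ω e) := by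
  obtain ⟨y, hy, w, hw, rfl⟩ := AddSubgroup.mem_sup.mp hv
  have hA : Monotone (std P W N) := fun _ _ h => std_mono le_rfl le_rfl h
  have key : y ∈ std P W N ∅ ∨ ∃ e ∈ E, y ∈ std P W N (upTo ω e) := by
    refine closure_initial_cases (ω := ω) hA ?_ hy
    rintro _ ⟨x, hx, c, d, rfl, hl⟩
    rcases low_cases (ω := ω) hl with h | ⟨e, he, h⟩
    · exact Or.inl (term_mul_mem_std hx h)
    · exact Or.inr ⟨e, he, term_mul_mem_std hx h.2⟩
  rcases key with h | ⟨e, he, h⟩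
  · exact Or.inl (add_mem h (le_std hw))
  · exact Or.inr ⟨e, he, add_mem h (le_std hw)⟩

/-- Two term multiples of elements of `P` with the same leading term, of monomial `(N, e)`, have a
difference with a standard representation up to `W`. -/
def SPairsAt (ω : MonomialOrder (Fin n)) (P : Set (Tate R n)) (W : Ideal (Tate R n)) (N : ℕ)
    (e : Fin n →₀ ℕ) : Prop :=
  ∀ x₁ ∈ P, ∀ x₂ ∈ P, ∀ (c₁ c₂ : R) (d₁ d₂ : Fin n →₀ ℕ),
    IsLead ω (term c₁ d₁ * x₁) (N, e) → IsLead ω (term c₂ d₂ * x₂) (N, e) →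
    coeff e (term c₁ d₁ * x₁).1 = coeff e (term c₂ d₂ * x₂).1 →
    term c₁ d₁ * x₁ - term c₂ d₂ * x₂ ∈ std P W N (below ω e)

lemma term_mul_mem_std_below {ω : MonomialOrder (Fin n)} {P : Set (Tate R n)} {N k : ℕ}
    {Q : Set (Tate R n)} {e : Fin n →₀ ℕ} {c : R} (hc : addVal R c = k) (d : Fin n →₀ ℕ)
    {y : Tate R n} (h : y ∈ std P (tail N Q) N (below ω e)) :
    term c d * y ∈ std P (tail (k + N) Q) (k + N) (below ω (d + e)) := by
  obtain ⟨z, hz, w, hw, rfl⟩ := AddSubgroup.mem_sup.mp h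
  rw [mul_add]
  refine add_mem ?_ (le_std (term_mul_mem_tail hc d hw))
  clear hw h w
  induction hz using AddSubgroup.closure_induction with
  | mem y hy =>
    obtain ⟨x, hx, c', d', rfl, hl⟩ := hy
    have := low_term_mul_below hc.ge d hl
    rw [← mul_assoc, term_mul_term] at this ⊢
    exact term_mul_mem_std hx this
  | zero => simp [zero_mem]
  | neg y _ h => rw [mul_neg]; exact neg_mem h
  | add y z _ _ hy hz => rw [mul_add]; exact add_mem hy hz

/-- Elements of the same valuation differ by a unit. -/
lemma exists_mul_of_addVal_eq {a b : R} (h : addVal R a = addVal R b) :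
    ∃ r : R, addVal R r = 0 ∧ b = r * a := by
  obtain ⟨u, hu⟩ := (addVal_eq_iff_associated a b).mp h
  exact ⟨u, addVal_eq_zero_of_unit u, by rw [mul_comm, hu]⟩

/-- If the terms of monomial `(N, e)` cancel in a standard representation, then `S`-pairs allow to
rewrite it with strictly smaller monomials. -/
lemma std_below_of_coeff {ω : MonomialOrder (Fin n)} {P : Set (Tate R n)} {W : Ideal (Tate R n)}
    {N : ℕ} {e : Fin n →₀ ℕ} (hW : ∀ y ∈ W, ((N + 1 : ℕ) : ℕ∞) ≤ gaussVal y)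
    (hS : SPairsAt ω P W N e) {v : Tate R n} (hv : v ∈ std P W N (upTo ω e))
    (he : ((N + 1 : ℕ) : ℕ∞) ≤ addVal R (coeff e v.1)) : v ∈ std P W N (below ω e) := by
  by_cases hex : ∃ x ∈ P, ∃ (c : R) (d : Fin n →₀ ℕ), IsLead ω (term c d * x) (N, e)
  swap
  · refine std_le (fun x hx c d hl => ?_) le_std hv
    rcases low_below_or_isLead hl with h | h
    · exact term_mul_mem_std hx h
    · exact absurd ⟨x, hx, c, d, h⟩ hex
  -- all generators of leading monomial `(N, e)` are constant multiples of a fixed one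
  obtain ⟨x₀, hx₀, c₀, d₀, h₀⟩ := hex
  have key : ∃ r : R, v - term r 0 * (term c₀ d₀ * x₀) ∈ std P W N (below ω e) := by
    obtain ⟨z, hz, w, hw, rfl⟩ := AddSubgroup.mem_sup.mp hv
    suffices ∃ r : R, z - term r 0 * (term c₀ d₀ * x₀) ∈ std P W N (below ω e) by
      obtain ⟨r, hr⟩ := this
      refine ⟨r, ?_⟩
      rw [add_sub_right_comm]
      exact add_mem hr (le_std hw)
    clear hv hw he w
    induction hz using AddSubgroup.closure_induction with
    | mem y hy =>
      obtain ⟨x, hx, c, d, rfl, hl⟩ := hy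
      rcases low_below_or_isLead hl with h | h
      · exact ⟨0, by rw [term_zero, zero_mul, sub_zero]; exact term_mul_mem_std hx h⟩
      · obtain ⟨r, hr, hreq⟩ := exists_mul_of_addVal_eq (h₀.1.trans h.1.symm)
        refine ⟨r, ?_⟩
        have h1 := h₀.term_mul (c := r) (a := 0) (by simpa using hr) 0
        simp only [zero_add] at h1
        have h2 : coeff e (term r 0 * (term c₀ d₀ * x₀)).1 = coeff e (term c d * x).1 := by
          have := coeff_add_term_mul r 0 e (term c₀ d₀ * x₀)
          rw [zero_add] at this
          rw [this, ← hreq]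
        rw [← mul_assoc, term_mul_term] at h1 h2 ⊢
        exact hS x hx x₀ hx₀ _ _ _ _ h h1 h2.symm
    | zero => exact ⟨0, by simp [term_zero, zero_mem]⟩
    | neg y _ h =>
      obtain ⟨r, hr⟩ := h
      refine ⟨-r, ?_⟩
      have := neg_mem hr
      rwa [neg_sub', ← neg_mul, ← term_neg] at this
    | add y z _ _ hy hz =>
      obtain ⟨r, hr⟩ := hy
      obtain ⟨s, hs⟩ := hz
      refine ⟨r + s, ?_⟩
      have := add_mem hr hs
      rwa [← add_sub_add_comm, ← add_mul, ← term_add] at this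
  obtain ⟨r, hr⟩ := key
  have hr' := (std_le_low hW hr e).2 (not_mem_below ω e)
  have hc : coeff e (term r 0 * (term c₀ d₀ * x₀)).1 = r * coeff e (term c₀ d₀ * x₀).1 := by
    have := coeff_add_term_mul r 0 e (term c₀ d₀ * x₀)
    rwa [zero_add] at this
  have hlow : term r 0 * (term c₀ d₀ * x₀) ∈ low N (below ω e) := by
    have h1 := low_term_mul_upTo (ω := ω) (a := 0) (c := r) zero_le 0 h₀.2
    simp only [zero_add] at h1
    rcases low_below_or_isLead h1 with h | h
    · exact h
    · have h2 : ((N + 1 : ℕ) : ℕ∞) ≤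
          addVal R (coeff e (v - (v - term r 0 * (term c₀ d₀ * x₀))).1) := by
        rw [coeff_sub']
        exact (le_min he hr').trans (AddValuation.map_sub _ _ _)
      rw [sub_sub_cancel, h.1] at h2
      exact absurd h2 (by exact_mod_cast Nat.not_succ_le_self _)
  rw [← sub_add_cancel v (term r 0 * (term c₀ d₀ * x₀))]
  refine add_mem hr ?_
  rw [← mul_assoc, term_mul_term] at hlow ⊢
  exact term_mul_mem_std hx₀ hlow

/-- Buchberger's criterion at valuation `N`: an element with a representation of valuation at
least `N` has a standard representation, up to `W`. -/
theorem std_of_low {ω : MonomialOrder (Fin n)} {P : Set (Tate R n)} {W : Ideal (Tate R n)}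
    {N : ℕ} (hW : ∀ y ∈ W, ((N + 1 : ℕ) : ℕ∞) ≤ gaussVal y)
    (hS : ∀ e, SPairsAt ω P W N e) {E : Set (Fin n →₀ ℕ)} (hE : IsInitial ω E) {v : Tate R n}
    (hv : v ∈ std P W N Set.univ) (hl : v ∈ low N E) : v ∈ std P W N E := by
  rcases std_cases (ω := ω) hv with h | ⟨e, -, h⟩
  · exact std_mono le_rfl le_rfl (Set.empty_subset E) h
  clear hv
  induction e using (InvImage.wf ω.toSyn (wellFounded_lt (α := ω.syn))).induction with
  | _ e ih =>
  by_cases he : e ∈ E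
  · exact std_mono le_rfl le_rfl (hE.upTo_subset he) h
  · rcases std_cases (ω := ω) (std_below_of_coeff hW (hS e) h ((hl e).2 he)) with h | ⟨e', he', h⟩
    · exact std_mono le_rfl le_rfl (Set.empty_subset E) h
    · exact ih e' he' h

lemma mul_mem_std_univ {P : Set (Tate R n)} {W : Ideal (Tate R n)} {N : ℕ} (hW : tail N P ≤ W)
    {x b : Tate R n} (hx : x ∈ P) (h : (N : ℕ∞) ≤ gaussVal b + gaussVal x) :
    b * x ∈ std P W N Set.univ := by
  by_cases hx0 : x = 0
  · rw [hx0, mul_zero]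
    exact zero_mem _
  have htop : gaussVal x ≠ ⊤ := fun h => hx0 (gaussVal_eq_top_iff.mp h)
  obtain ⟨a, ha⟩ := ENat.ne_top_iff_exists.mp htop
  have hb : b ∈ low (N - a) Set.univ := by
    rw [mem_low_univ]
    rw [← ha] at h
    push_cast
    exact tsub_le_iff_right.mpr h
  obtain ⟨s, g, -, hg, hsum⟩ := exists_sum_term_add hb
  rw [hsum, add_mul, Finset.sum_mul]
  refine add_mem (sum_mem fun i _ => term_mul_mem_std hx ?_) (le_std (hW (mul_mem_tail hx ?_)))
  · rw [mem_low_univ, gaussVal_term_mul]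
    exact h.trans (add_le_add (gaussVal_le b i) le_rfl)
  · rw [← ha]
    refine le_trans ?_ (add_le_add hg le_rfl)
    have : N + 1 ≤ (N - a + 1) + a := by omega
    exact_mod_cast this

/-- The `S`-pairs of `P` have standard representations, where multiples of elements of `Q` may be
used as long as their valuation is large. -/
def Closed (ω : MonomialOrder (Fin n)) (P Q : Set (Tate R n)) : Prop :=
  ∀ N e, SPairsAt ω P (tail N (P ∪ Q)) N e

lemma mem_std_of_mem_span {ω : MonomialOrder (Fin n)} {P : Set (Tate R n)}
    (hP : Closed ω P ∅) {h : Tate R n} (hh : h ∈ Ideal.span P) {N : ℕ}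
    (hN : (N : ℕ∞) ≤ gaussVal h) : h ∈ std P (tail N P) N Set.univ := by
  induction N with
  | zero =>
    refine mem_of_mem_span (fun y hy a => ?_) hh
    exact mul_mem_std_univ le_rfl hy (by simp)
  | succ N ih =>
    have hN' : (N : ℕ∞) ≤ gaussVal h := le_trans (by exact_mod_cast Nat.le_succ N) hN
    have hS : ∀ e, SPairsAt ω P (tail N P) N e := fun e => by simpa using hP N e
    have := std_of_low (fun y hy => le_gaussVal_of_mem_tail hy) hS (isInitial_empty ω) (ih hN')
      (mem_low_empty.mpr hN)
    refine std_le (fun x hx c d hl => ?_) (fun y hy => ?_) this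
    · exact term_mul_mem_std hx (mem_low_univ.mpr (mem_low_empty.mp hl))
    · refine mem_of_mem_span ?_ hy
      rintro _ ⟨x, hx, b, hb, rfl⟩ a
      rw [← mul_assoc]
      refine mul_mem_std_univ le_rfl hx (hb.trans (add_le_add ?_ le_rfl))
      exact le_gaussVal_mul a le_rfl

/-- Buchberger's criterion. -/
theorem exists_lm_le_of_mem_span {ω : MonomialOrder (Fin n)} {P : Set (Tate R n)}
    (hP : Closed ω P ∅) {h : Tate R n} (hh : h ∈ Ideal.span P) (h0 : h ≠ 0) :
    ∃ g ∈ P, g ≠ 0 ∧ lm ω g ≤ lm ω h := by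
  have hT := isLead_lm ω h0
  generalize lm ω h = T at hT ⊢
  obtain ⟨N, e⟩ := T
  have hS : ∀ e, SPairsAt ω P (tail N P) N e := fun e => by simpa using hP N e
  have hstd := std_of_low (fun y hy => le_gaussVal_of_mem_tail hy) hS (isInitial_upTo ω e)
    (mem_std_of_mem_span hP hh hT.gaussVal.ge) hT.2
  by_contra hcon
  refine hT.not_mem_low (not_mem_below ω e) (std_le (fun x hx c d hl => ?_) (fun y hy => ?_) hstd)
  · rcases low_below_or_isLead hl with h | h
    · exact h
    · have hx0 : x ≠ 0 := by
        rintro rfl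
        exact h.ne_zero (mul_zero _)
      obtain ⟨a, -, heq⟩ := (isLead_lm ω hx0).of_term_mul h
      exact absurd ⟨x, hx, hx0, heq ▸ Prod.mk_le_mk.mpr ⟨le_add_self, le_add_self⟩⟩ hcon
  · exact low_of_lt (le_gaussVal_of_mem_tail hy)

/-! ### Convergent sums in the Tate algebra -/

variable (R) in
/-- Completeness of `R`, in the form in which it is used: a series whose terms tend to zero has a
sum, and the partial sums approximate it as well as the size of the remaining terms allows. -/
def NullSeriesConverge : Prop :=
  ∀ s : ℕ → R, (∀ N : ℕ, ∃ J, ∀ j ≥ J, (N : ℕ∞) ≤ addVal R (s j)) →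
    ∃ a : R, ∀ N J : ℕ, (∀ j ≥ J, (N : ℕ∞) ≤ addVal R (s j)) →
      (N : ℕ∞) ≤ addVal R (a - ∑ k ∈ Finset.range J, s k)

lemma exists_sum_of_null (hR : NullSeriesConverge R) (b : ℕ → Tate R n)
    (hb : ∀ N : ℕ, ∃ J, ∀ j ≥ J, (N : ℕ∞) ≤ gaussVal (b j)) :
    ∃ A : Tate R n, ∀ N J : ℕ, (∀ j ≥ J, (N : ℕ∞) ≤ gaussVal (b j)) →
      (N : ℕ∞) ≤ gaussVal (A - ∑ k ∈ Finset.range J, b k) := by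
  have hcoeff : ∀ i : Fin n →₀ ℕ, ∀ N : ℕ, ∃ J, ∀ j ≥ J,
      (N : ℕ∞) ≤ addVal R (coeff i (b j).1) := fun i N => by
    obtain ⟨J, hJ⟩ := hb N
    exact ⟨J, fun j hj => (hJ j hj).trans (gaussVal_le _ _)⟩
  choose a ha using fun i => hR _ (hcoeff i)
  have key : ∀ N J : ℕ, (∀ j ≥ J, (N : ℕ∞) ≤ gaussVal (b j)) → ∀ i : Fin n →₀ ℕ,
      (N : ℕ∞) ≤ addVal R (a i - coeff i (∑ k ∈ Finset.range J, b k).1) := by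
    intro N J h i
    rw [coeff_sum']
    exact ha i N J fun j hj => (h j hj).trans (gaussVal_le _ _)
  let A : MvPowerSeries (Fin n) R := fun i => a i
  have hA : ∀ i, coeff i A = a i := fun i => rfl
  refine ⟨⟨A, fun N => ?_⟩, fun N J h => ?_⟩
  · obtain ⟨J, hJ⟩ := hb N
    refine ((∑ k ∈ Finset.range J, b k).2 N).subset fun i hi => ?_
    simp only [Set.mem_ofPred_eq, hA] at hi ⊢
    by_contra hlt
    rw [not_lt] at hlt
    have h1 := (le_min (key N J hJ i) hlt).trans addVal_add
    rw [sub_add_cancel] at h1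
    exact absurd hi (not_lt.mpr h1)
  · rw [le_gaussVal_iff]
    intro i
    rw [coeff_sub']
    exact key N J h i

/-- A null sequence obtained by subtracting multiples of elements of a finite set starts in the
ideal generated by this set: the multipliers can be summed up. -/
lemma mem_tail_of_null (hR : NullSeriesConverge R) {F : Set (Tate R n)} (hF : F.Finite)
    {w b x : ℕ → Tate R n} (hx : ∀ j, x j ∈ F) (hw : ∀ j, w (j + 1) = w j - b j * x j)
    (hlim : ∀ N : ℕ, ∃ J, ∀ j ≥ J, (N : ℕ∞) ≤ gaussVal (w j))
    (hb : ∀ N : ℕ, ∃ J, ∀ j ≥ J, (N : ℕ∞) ≤ gaussVal (b j)) {N : ℕ}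
    (hN : ∀ j, ((N + 1 : ℕ) : ℕ∞) ≤ gaussVal (b j) + gaussVal (x j)) : w 0 ∈ tail N F := by
  classical
  let by' : Tate R n → ℕ → Tate R n := fun y j => if x j = y then b j else 0
  have hby : ∀ y, ∀ M : ℕ, ∃ J, ∀ j ≥ J, (M : ℕ∞) ≤ gaussVal (by' y j) := fun y M => by
    obtain ⟨J, hJ⟩ := hb M
    refine ⟨J, fun j hj => ?_⟩
    by_cases h : x j = y
    · simpa [by', h] using hJ j hj
    · simp [by', h]
  choose A hA using fun y => exists_sum_of_null hR (by' y) (hby y)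
  have hsum : w 0 = ∑ y ∈ hF.toFinset, A y * y := by
    rw [← sub_eq_zero, ← gaussVal_eq_top_iff, ENat.eq_top_iff_forall_ge]
    intro M
    obtain ⟨J₁, hJ₁⟩ := hlim M
    obtain ⟨J₂, hJ₂⟩ := hb M
    have hJ₂' : ∀ y, ∀ j ≥ J₁ + J₂, (M : ℕ∞) ≤ gaussVal (by' y j) := fun y j hj => by
      by_cases h : x j = y
      · simpa [by', h] using hJ₂ j (by omega)
      · simp [by', h]
    have hpart : ∀ J, w 0 - w J = ∑ y ∈ hF.toFinset, (∑ k ∈ Finset.range J, by' y k) * y := by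
      intro J
      induction J with
      | zero => simp
      | succ J ih =>
        have : ∑ y ∈ hF.toFinset, by' y J * y = b J * x J := by
          rw [Finset.sum_eq_single (x J)]
          · simp [by']
          · intro y _ hy
            simp [by', hy.symm]
          · intro h
            exact absurd (hF.mem_toFinset.mpr (hx J)) h
        simp only [Finset.sum_range_succ, add_mul, Finset.sum_add_distrib]
        rw [← ih, this, hw J]
        ring
    have heq : w 0 - ∑ y ∈ hF.toFinset, A y * y = w (J₁ + J₂) -
        ∑ y ∈ hF.toFinset, (A y - ∑ k ∈ Finset.range (J₁ + J₂), by' y k) * y := by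
      simp only [sub_mul, Finset.sum_sub_distrib]
      rw [← hpart]
      ring
    rw [heq]
    refine le_gaussVal_sub (hJ₁ _ (by omega)) (le_gaussVal_sum fun y _ => ?_)
    rw [mul_comm]
    exact le_gaussVal_mul _ (hA y M _ (hJ₂' y))
  rw [hsum]
  refine sum_mem fun y hy => mul_mem_tail (hF.mem_toFinset.mp hy) ?_
  by_cases hy0 : y = 0
  · simp [hy0]
  have htop : gaussVal y ≠ ⊤ := fun h => hy0 (gaussVal_eq_top_iff.mp h)
  obtain ⟨a, ha⟩ := ENat.ne_top_iff_exists.mp htop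
  have h1 : ((N + 1 - a : ℕ) : ℕ∞) ≤ gaussVal (A y) := by
    have := hA y (N + 1 - a) 0 fun j _ => ?_
    · simpa using this
    · by_cases h : x j = y
      · have := hN j
        rw [h, ← ha] at this
        simp only [by', h, if_true]
        push_cast at this ⊢
        exact tsub_le_iff_right.mpr this
      · simp [by', h]
  rw [← ha]
  refine le_trans ?_ (add_le_add h1 le_rfl)
  have : N + 1 ≤ (N + 1 - a) + a := by omega
  exact_mod_cast this

/-! ### Regular top-reductions -/

lemma RegTopRed.spec {ω : MonomialOrder (Fin n)} {u : TMon₀ n} {G : Set (SPair R n)}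
    {v v' : Tate R n} (h : RegTopRed ω u G v v') :
    v ≠ 0 ∧ ∃ q ∈ G, q.2 ≠ 0 ∧ ∃ (c : R) (d : Fin n →₀ ℕ) (a : ℕ), addVal R c = a ∧
      IsLead ω (term c d * q.2) (lm ω v) ∧ lm ω v = (a, d) + lm ω q.2 ∧
      tKey ω ((((a, d) : TMon n) : TMon₀ n) + q.1) < tKey ω u ∧
      v' = v - term c d * q.2 ∧ v' ∈ low (lm ω v).1 (below ω (lm ω v).2) := by
  obtain ⟨hv, q, hq, hq0, c, d, hc, hd, hlt, hv'⟩ := h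
  have hLv := isLead_lm ω hv
  have hLq := isLead_lm ω hq0
  have hc' : coeff (lm ω v).2 v.1 = c * coeff (lm ω q.2).2 q.2.1 := by
    rwa [← hLv.leadCoeff, ← hLq.leadCoeff]
  have hd' : (lm ω v).2 = d + (lm ω q.2).2 := by rwa [← hLv.leadExp, ← hLq.leadExp]
  have hctop : addVal R c ≠ ⊤ := fun h => by
    have := hLv.1
    rw [hc', addVal_eq_top_iff.mp h, zero_mul, addVal_zero] at this
    exact absurd this (ENat.top_ne_natCast _)
  obtain ⟨a, ha⟩ := ENat.ne_top_iff_exists.mp hctop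
  have hlm : lm ω v = (a, d) + lm ω q.2 := by
    refine Prod.ext ?_ hd'
    have := hLv.1
    rw [hc', addVal_mul, hLq.1, ← ha] at this
    exact_mod_cast this.symm
  have hl : IsLead ω (term c d * q.2) (lm ω v) := by
    rw [hlm]
    exact hLq.term_mul ha.symm d
  refine ⟨hv, q, hq, hq0, c, d, a, ha.symm, hl, hlm, ?_, hv', ?_⟩
  · rwa [mon_of_addVal ha.symm] at hlt
  · rw [hv']
    refine hLv.sub_mem_low hl ?_
    rw [hc', hd', coeff_add_term_mul]

lemma exists_regTopRed {ω : MonomialOrder (Fin n)} {u : TMon₀ n} {G : Set (SPair R n)}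
    {v : Tate R n} (hv : v ≠ 0) {q : SPair R n} (hq : q ∈ G) (hq0 : q.2 ≠ 0) {t : TMon n}
    (ht : lm ω v = t + lm ω q.2) (hlt : tKey ω ((t : TMon₀ n) + q.1) < tKey ω u) :
    ∃ v', RegTopRed ω u G v v' := by
  have hLv := isLead_lm ω hv
  have hLq := isLead_lm ω hq0
  have hdvd : leadCoeff ω q.2 ∣ leadCoeff ω v := by
    rw [← addVal_le_iff_dvd, hLv.leadCoeff, hLq.leadCoeff, hLv.1, hLq.1, ht]
    exact_mod_cast Nat.le_add_left _ _
  obtain ⟨c, hc⟩ := hdvd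
  have hval : addVal R c = t.1 := by
    have h1 : addVal R (leadCoeff ω v) = (lm ω v).1 := by rw [hLv.leadCoeff, hLv.1]
    have h2 : addVal R (leadCoeff ω q.2) = (lm ω q.2).1 := by rw [hLq.leadCoeff, hLq.1]
    rw [hc, addVal_mul, h2, ht, Prod.fst_add, Nat.cast_add, add_comm] at h1
    generalize addVal R c = k at h1 ⊢
    induction k with
    | top =>
      rw [top_add, ← Nat.cast_add] at h1
      exact absurd h1 (ENat.top_ne_natCast _)
    | coe k =>
      have h1' : k + (lm ω q.2).1 = t.1 + (lm ω q.2).1 := by exact_mod_cast h1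
      exact_mod_cast Nat.add_right_cancel h1'
  refine ⟨_, hv, q, hq, hq0, c, t.2, by rw [hc, mul_comm], ?_, ?_, rfl⟩
  · rw [hLv.leadExp, hLq.leadExp, ht]
    rfl
  · rwa [mon_of_addVal hval]

lemma RegTopRed.LM_lt {ω : MonomialOrder (Fin n)} {u : TMon₀ n} {G : Set (SPair R n)}
    {v v' : Tate R n} (h : RegTopRed ω u G v v') : tKey ω (LM ω v') < tKey ω (LM ω v) := by
  obtain ⟨hv, q, -, -, c, d, a, -, -, -, -, -, hlow⟩ := h.spec
  rw [LM_of_ne hv]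
  exact LM_lt_of_low hlow

lemma RegTopRed.gaussVal_le {ω : MonomialOrder (Fin n)} {u : TMon₀ n} {G : Set (SPair R n)}
    {v v' : Tate R n} (h : RegTopRed ω u G v v') : gaussVal v ≤ gaussVal v' := by
  obtain ⟨hv, q, -, -, c, d, a, -, -, -, -, -, hlow⟩ := h.spec
  rw [gaussVal_eq_lm ω hv]
  exact le_gaussVal_of_low hlow

lemma RegTopRed.mono {ω : MonomialOrder (Fin n)} {u : TMon₀ n} {G G' : Set (SPair R n)}
    (hG : G ⊆ G') {v v' : Tate R n} (h : RegTopRed ω u G v v') : RegTopRed ω u G' v v' := by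
  obtain ⟨hv, q, hq, hrest⟩ := h
  exact ⟨hv, q, hG hq, hrest⟩

/-- An infinite sequence of regular top-reductions tends to zero: its leading monomials decrease,
and for a given valuation the exponents are well-ordered. -/
lemma null_of_regTopRed {ω : MonomialOrder (Fin n)} {u : TMon₀ n} {G : Set (SPair R n)}
    {w : ℕ → Tate R n} (hw : ∀ j, RegTopRed ω u G (w j) (w (j + 1))) (N : ℕ) :
    ∃ J, ∀ j ≥ J, (N : ℕ∞) ≤ gaussVal (w j) := by
  have hmono : Monotone fun j => gaussVal (w j) :=
    monotone_nat_of_le_succ fun j => (hw j).gaussVal_le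
  suffices ∃ J, (N : ℕ∞) ≤ gaussVal (w J) by
    obtain ⟨J, hJ⟩ := this
    exact ⟨J, fun j hj => hJ.trans (hmono hj)⟩
  induction N with
  | zero => exact ⟨0, by simp⟩
  | succ N ih =>
    obtain ⟨J, hJ⟩ := ih
    by_contra! hcon
    have hval : ∀ j, (lm ω (w (J + j))).1 = N := fun j => by
      have h1 := hJ.trans (hmono (Nat.le_add_right J j))
      have h2 := hcon (J + j)
      simp only [gaussVal_eq_lm ω (hw (J + j)).1] at h1 h2
      have h1' : N ≤ (lm ω (w (J + j))).1 := by exact_mod_cast h1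
      have h2' : (lm ω (w (J + j))).1 < N + 1 := by exact_mod_cast h2
      omega
    obtain ⟨_, ⟨j, rfl⟩, hmin⟩ := (wellFounded_lt (α := ω.syn)).has_min
      (Set.range fun j => ω.toSyn (lm ω (w (J + j))).2) ⟨_, ⟨0, rfl⟩⟩
    obtain ⟨-, q, -, -, c, d, a, -, -, -, -, -, hlow⟩ := (hw (J + j)).spec
    rcases low_lm_lt hlow (hw (J + j + 1)).1 with h | h
    · have h1 := hval j
      have h2 := hval (j + 1)
      rw [← add_assoc] at h2
      omega
    · exact hmin _ ⟨j + 1, rfl⟩ h.2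

lemma RegularReduce.cases {ω : MonomialOrder (Fin n)} {u : TMon₀ n} {v v₀ : Tate R n}
    {G : Set (SPair R n)} (h : RegularReduce ω u v G v₀) :
    (Relation.ReflTransGen (RegTopRed ω u G) v v₀ ∧ ¬ ∃ v', RegTopRed ω u G v₀ v') ∨
    (v₀ = 0 ∧ ∃ w : ℕ → Tate R n, w 0 = v ∧ ∀ j, RegTopRed ω u G (w j) (w (j + 1))) := by
  rcases h with h | ⟨w, hw0, hw, hlim⟩
  · exact Or.inl h
  · refine Or.inr ⟨?_, w, hw0, hw⟩
    rw [← gaussVal_eq_top_iff, ENat.eq_top_iff_forall_ge]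
    intro N
    obtain ⟨J, hJ⟩ := hlim N
    obtain ⟨J', hJ'⟩ := null_of_regTopRed hw N
    have := le_gaussVal_sub (hJ' (J + J') (by omega)) (hJ (J + J') (by omega))
    rwa [sub_sub_cancel] at this

lemma RegularReduce.irreducible {ω : MonomialOrder (Fin n)} {u : TMon₀ n} {v v₀ : Tate R n}
    {G : Set (SPair R n)} (h : RegularReduce ω u v G v₀) : ¬ ∃ v', RegTopRed ω u G v₀ v' := by
  rcases h.cases with h | ⟨rfl, -⟩
  · exact h.2
  · rintro ⟨v', hv'⟩
    exact hv'.1 rfl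

/-- A property kept by reductions and true for `0` holds for the result of `regular_reduce`. -/
lemma RegularReduce.induct {ω : MonomialOrder (Fin n)} {u : TMon₀ n} {v v₀ : Tate R n}
    {G : Set (SPair R n)} (h : RegularReduce ω u v G v₀) {p : Tate R n → Prop} (h0 : p 0)
    (hv : p v) (hp : ∀ w w', RegTopRed ω u G w w' → p w → p w') : p v₀ := by
  rcases h.cases with ⟨h', -⟩ | ⟨rfl, -⟩
  · clear h
    induction h' with
    | refl => exact hv
    | tail _ hst ih => exact hp _ _ hst ih
  · exact h0

lemma RegularReduce.LM_lt {ω : MonomialOrder (Fin n)} {u : TMon₀ n} {v v₀ : Tate R n}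
    {G : Set (SPair R n)} (h : RegularReduce ω u v G v₀) (hv : ∃ v', RegTopRed ω u G v v') :
    tKey ω (LM ω v₀) < tKey ω (LM ω v) := by
  have hv0 : v ≠ 0 := hv.choose_spec.1
  have hne : v₀ ≠ v := fun hh => h.irreducible (hh ▸ hv)
  have key : v₀ = v ∨ tKey ω (LM ω v₀) < tKey ω (LM ω v) := by
    refine h.induct (p := fun w => w = v ∨ tKey ω (LM ω w) < tKey ω (LM ω v)) ?_ (Or.inl rfl) ?_
    · right
      rw [LM_zero, LM_of_ne hv0]
      exact bot_lt_tKey_coe ω _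
    · rintro w w' hst (rfl | hlt)
      · exact Or.inr hst.LM_lt
      · exact Or.inr (hst.LM_lt.trans hlt)
  exact key.resolve_left hne

lemma exists_regularReduce (ω : MonomialOrder (Fin n)) (u : TMon₀ n) (v : Tate R n)
    (G : Set (SPair R n)) : ∃ v₀, RegularReduce ω u v G v₀ := by
  by_cases h : ∃ v₀, Relation.ReflTransGen (RegTopRed ω u G) v v₀ ∧ ¬ ∃ v', RegTopRed ω u G v₀ v'
  · obtain ⟨v₀, hv₀⟩ := h
    exact ⟨v₀, Or.inl hv₀⟩
  · push Not at h
    choose! next hnext using h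
    have hreach : ∀ j, Relation.ReflTransGen (RegTopRed ω u G) v (next^[j] v) := by
      intro j
      induction j with
      | zero => exact .refl
      | succ j ih =>
        rw [Function.iterate_succ_apply']
        exact ih.tail (hnext _ ih)
    have hstep : ∀ j, RegTopRed ω u G (next^[j] v) (next^[j + 1] v) := fun j => by
      rw [Function.iterate_succ_apply']
      exact hnext _ (hreach j)
    refine ⟨0, Or.inr ⟨fun j => next^[j] v, rfl, hstep, fun N => ?_⟩⟩
    simpa using null_of_regTopRed hstep N

/-- After sufficiently many steps, an infinite sequence of reductions lies in the part of large
valuation of the ideal generated by the reducers. -/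
lemma exists_mem_tail_of_regTopRed (hR : NullSeriesConverge R) {ω : MonomialOrder (Fin n)}
    {u : TMon₀ n} {G : Set (SPair R n)} (hG : G.Finite) {w : ℕ → Tate R n}
    (hw : ∀ j, RegTopRed ω u G (w j) (w (j + 1))) (N : ℕ) :
    ∃ J, w J ∈ tail N {v | ∃ s, (s, v) ∈ G} := by
  have hF : {v : Tate R n | ∃ s, (s, v) ∈ G}.Finite :=
    (hG.image Prod.snd).subset fun v ⟨s, hs⟩ => ⟨_, hs, rfl⟩
  -- a bound for the valuations of the reducers
  obtain ⟨B, hB⟩ : ∃ B : ℕ, ∀ q ∈ G, (lm ω q.2).1 ≤ B := by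
    obtain ⟨B, hB⟩ := (hG.image fun q => (lm ω q.2).1).bddAbove
    exact ⟨B, fun q hq => hB ⟨q, hq, rfl⟩⟩
  choose hne q hq hq0 c d a hc hl hlm hlt heq hlow using fun j => (hw j).spec
  obtain ⟨J, hJ⟩ := null_of_regTopRed hw (N + 1)
  have hval : ∀ j, gaussVal (w j) = gaussVal (term (c j) (d j)) + gaussVal (q j).2 := fun j => by
    rw [gaussVal_term, ← gaussVal_term_mul, (hl j).gaussVal, gaussVal_eq_lm ω (hne j)]
  refine ⟨J, mem_tail_of_null hR (w := fun j => w (J + j))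
    (b := fun j => term (c (J + j)) (d (J + j)))
    (x := fun j => (q (J + j)).2) hF (fun j => ⟨_, hq (J + j)⟩) (fun j => heq (J + j))
    (fun M => ?_) (fun M => ?_) (fun j => ?_)⟩
  · obtain ⟨J', hJ'⟩ := null_of_regTopRed hw M
    exact ⟨J', fun j hj => hJ' _ (by omega)⟩
  · obtain ⟨J', hJ'⟩ := null_of_regTopRed hw (M + B)
    refine ⟨J', fun j hj => ?_⟩
    have h1 := hJ' (J + j) (by omega)
    have h2 := hB _ (hq (J + j))
    rw [hval, gaussVal_term, hc, gaussVal_eq_lm ω (hq0 _)] at h1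
    rw [gaussVal_term, hc]
    have h1' : M + B ≤ a (J + j) + (lm ω (q (J + j)).2).1 := by exact_mod_cast h1
    have : M ≤ a (J + j) := by omega
    exact_mod_cast this
  · rw [← hval]
    exact hJ _ (by omega)

/-! ### Signatures -/

/-- The part of the ideal generated by `f` and `GB` to which no signature is attached at
valuation `N`: the multiples of `f` by series of positive valuation, and the multiples `b g`, for
`g ∈ GB`, which are bound to have valuation at least `N`. -/
def unsigned (f : Tate R n) (GB : Set (Tate R n)) (N : ℕ) : Ideal (Tate R n) :=
  Ideal.span {y | ∃ x b : Tate R n, y = b * x ∧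
    ((x = f ∧ 1 ≤ gaussVal b) ∨ (x ∈ GB ∧ (N : ℕ∞) ≤ gaussVal b + gaussVal x))}

/-- The combinations `a f + ∑ b g` of valuation at least `N` all of whose signatures, i.e. the
exponents of the terms of `a` with unit coefficient, are in `D`. -/
def signed (f : Tate R n) (GB : Set (Tate R n)) (N : ℕ) (D : Set (Fin n →₀ ℕ)) :
    AddSubgroup (Tate R n) :=
  AddSubgroup.closure {y | ∃ j ∈ D, ∃ c : R, y = term c j * f} ⊔ (unsigned f GB N).toAddSubgroup

/-- `v` is a combination of `f` and `GB` with signature exactly `X^i`. -/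
def HasSig (ω : MonomialOrder (Fin n)) (f : Tate R n) (GB : Set (Tate R n)) (N : ℕ)
    (i : Fin n →₀ ℕ) (v : Tate R n) : Prop :=
  v - term 1 i * f ∈ signed f GB N (below ω i)

section signed

variable {f : Tate R n} {GB : Set (Tate R n)} {N : ℕ} {ω : MonomialOrder (Fin n)}

lemma unsigned_le_signed {D : Set (Fin n →₀ ℕ)} :
    (unsigned f GB N).toAddSubgroup ≤ signed f GB N D := le_sup_right

lemma mul_mem_unsigned_left {b : Tate R n} (hb : 1 ≤ gaussVal b) : b * f ∈ unsigned f GB N :=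
  Ideal.subset_span ⟨f, b, rfl, Or.inl ⟨rfl, hb⟩⟩

lemma mul_mem_unsigned_right {b g : Tate R n} (hg : g ∈ GB)
    (hb : (N : ℕ∞) ≤ gaussVal b + gaussVal g) : b * g ∈ unsigned f GB N :=
  Ideal.subset_span ⟨g, b, rfl, Or.inr ⟨hg, hb⟩⟩

lemma term_mul_mem_signed {D : Set (Fin n →₀ ℕ)} {j : Fin n →₀ ℕ} (hj : j ∈ D) (c : R) :
    term c j * f ∈ signed f GB N D :=
  AddSubgroup.mem_sup_left (AddSubgroup.subset_closure ⟨j, hj, c, rfl⟩)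

lemma signed_le {D : Set (Fin n →₀ ℕ)} {A : AddSubgroup (Tate R n)}
    (h : ∀ j ∈ D, ∀ c : R, term c j * f ∈ A) (hU : (unsigned f GB N).toAddSubgroup ≤ A) :
    signed f GB N D ≤ A := by
  refine sup_le ((AddSubgroup.closure_le A).mpr ?_) hU
  rintro _ ⟨j, hj, c, rfl⟩
  exact h j hj c

lemma signed_mono {D D' : Set (Fin n →₀ ℕ)} (h : D ⊆ D') : signed f GB N D ≤ signed f GB N D' :=
  signed_le (fun _ hj c => term_mul_mem_signed (h hj) c) unsigned_le_signed

lemma signed_empty : signed f GB N ∅ ≤ (unsigned f GB N).toAddSubgroup :=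
  signed_le (fun _ hj => hj.elim) le_rfl

lemma term_mul_mem_signed_of_mem {D D' : Set (Fin n →₀ ℕ)} (c : R) {d : Fin n →₀ ℕ}
    (h : ∀ i ∈ D, d + i ∈ D') {y : Tate R n} (hy : y ∈ signed f GB N D) :
    term c d * y ∈ signed f GB N D' := by
  refine signed_le (A := (signed f GB N D').comap (AddMonoidHom.mulLeft (term c d)))
    (fun j hj c' => ?_) (fun y hy => ?_) hy
  · simp only [AddSubgroup.mem_comap, AddMonoidHom.coe_mulLeft]
    rw [← mul_assoc, term_mul_term]
    exact term_mul_mem_signed (h j hj) _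
  · exact unsigned_le_signed (Ideal.mul_mem_left _ _ hy)

lemma term_mul_mem_unsigned {D : Set (Fin n →₀ ℕ)} {c : R} (hc : 1 ≤ addVal R c) (d : Fin n →₀ ℕ)
    {y : Tate R n} (hy : y ∈ signed f GB N D) : term c d * y ∈ unsigned f GB N := by
  refine signed_le (A := (unsigned f GB N).toAddSubgroup.comap (AddMonoidHom.mulLeft (term c d)))
    (fun j hj c' => ?_) (fun y hy => ?_) hy
  · change term c d * (term c' j * f) ∈ unsigned f GB N
    rw [← mul_assoc, term_mul_term]
    refine mul_mem_unsigned_left ?_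
    rw [gaussVal_term, addVal_mul]
    exact hc.trans le_self_add
  · exact Ideal.mul_mem_left _ _ hy

lemma signed_cases {D : Set (Fin n →₀ ℕ)} {v : Tate R n} (hv : v ∈ signed f GB N D) :
    v ∈ unsigned f GB N ∨ ∃ d ∈ D, v ∈ signed f GB N (upTo ω d) := by
  obtain ⟨y, hy, w, hw, rfl⟩ := AddSubgroup.mem_sup.mp hv
  have key : y ∈ signed f GB N ∅ ∨ ∃ d ∈ D, y ∈ signed f GB N (upTo ω d) := by
    refine closure_initial_cases (fun _ _ h => signed_mono h) ?_ hy
    rintro _ ⟨j, hj, c, rfl⟩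
    exact Or.inr ⟨j, hj, term_mul_mem_signed (le_refl (ω.toSyn j)) c⟩
  rcases key with h | ⟨d, hd, h⟩
  · exact Or.inl (add_mem (signed_empty h) hw)
  · exact Or.inr ⟨d, hd, add_mem h (unsigned_le_signed hw)⟩

lemma exists_sub_mem_signed_below {d : Fin n →₀ ℕ} {v : Tate R n}
    (hv : v ∈ signed f GB N (upTo ω d)) :
    ∃ c : R, v - term c d * f ∈ signed f GB N (below ω d) := by
  obtain ⟨y, hy, w, hw, rfl⟩ := AddSubgroup.mem_sup.mp hv
  suffices ∃ c : R, y - term c d * f ∈ signed f GB N (below ω d) by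
    obtain ⟨c, hc⟩ := this
    refine ⟨c, ?_⟩
    rw [add_sub_right_comm]
    exact add_mem hc (unsigned_le_signed hw)
  clear hv hw w
  induction hy using AddSubgroup.closure_induction with
  | mem y hy =>
    obtain ⟨j, hj, c, rfl⟩ := hy
    rcases (show ω.toSyn j ≤ ω.toSyn d from hj).lt_or_eq with h | h
    · exact ⟨0, by rw [term_zero, zero_mul, sub_zero]; exact term_mul_mem_signed h c⟩
    · rw [ω.toSyn.injective h]
      exact ⟨c, by rw [sub_self]; exact zero_mem _⟩
  | zero => exact ⟨0, by simp [term_zero, zero_mem]⟩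
  | neg y _ h =>
    obtain ⟨r, hr⟩ := h
    refine ⟨-r, ?_⟩
    have := neg_mem hr
    rwa [neg_sub', ← neg_mul, ← term_neg] at this
  | add y z _ _ hy hz =>
    obtain ⟨r, hr⟩ := hy
    obtain ⟨s, hs⟩ := hz
    refine ⟨r + s, ?_⟩
    have := add_mem hr hs
    rwa [← add_sub_add_comm, ← add_mul, ← term_add] at this

lemma HasSig.mem_signed {i : Fin n →₀ ℕ} {v : Tate R n} (h : HasSig ω f GB N i v) :
    v ∈ signed f GB N (upTo ω i) := by
  have := add_mem (signed_mono (below_subset_upTo ω i) h)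
    (term_mul_mem_signed (f := f) (GB := GB) (N := N) (D := upTo ω i) (le_refl (ω.toSyn i)) (1 : R))
  rwa [sub_add_cancel] at this

lemma HasSig.term_mul {i : Fin n →₀ ℕ} {v : Tate R n} (h : HasSig ω f GB N i v)
    (d : Fin n →₀ ℕ) : HasSig ω f GB N (d + i) (term 1 d * v) := by
  have := term_mul_mem_signed_of_mem (D' := below ω (d + i)) (1 : R) (d := d)
    (fun j (hj : _ < _) => by simpa [below] using hj) h
  rwa [mul_sub, ← mul_assoc, term_mul_term, one_mul] at this

lemma signed_le_span {D : Set (Fin n →₀ ℕ)} :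
    signed f GB N D ≤ (Ideal.span (insert f GB)).toAddSubgroup := by
  refine signed_le (fun j _ c => ?_) ?_
  · exact Ideal.mul_mem_left _ _ (Ideal.subset_span (Set.mem_insert _ _))
  · refine Ideal.span_le.mpr ?_
    rintro _ ⟨x, b, rfl, ⟨rfl, -⟩ | ⟨hx, -⟩⟩
    · exact Ideal.mul_mem_left _ _ (Ideal.subset_span (Set.mem_insert _ _))
    · exact Ideal.mul_mem_left _ _ (Ideal.subset_span (Set.mem_insert_of_mem _ hx))

lemma HasSig.mem_span {i : Fin n →₀ ℕ} {v : Tate R n} (h : HasSig ω f GB N i v) :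
    v ∈ Ideal.span (insert f GB) := signed_le_span h.mem_signed

/-- A basis element `g` whose leading monomial is `X^i` makes `X^i` the signature of a syzygy:
`g f` has signature `X^i` as a multiple of `f`, and none as a multiple of `g`. -/
lemma term_mul_mem_signed_below_of_isLead (hf : gaussVal f = N) {g : Tate R n} (hg : g ∈ GB)
    {i : Fin n →₀ ℕ} (hi : IsLead ω g (0, i)) : term 1 i * f ∈ signed f GB N (below ω i) := by
  classical
  have hterm : IsLead ω (term (coeff i g.1) i) (0, i) := by
    refine ⟨by rw [coeff_term, if_pos rfl]; exact hi.1, fun j => ⟨by simp, fun hj => ?_⟩⟩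
    rw [coeff_term, if_neg]
    · simp
    · rintro rfl
      exact hj (le_refl (ω.toSyn j))
  have hlow := hi.sub_mem_low hterm (by rw [coeff_term, if_pos rfl])
  have hmem : (g - term (coeff i g.1) i) * f ∈ signed f GB N (below ω i) := by
    obtain ⟨s, r, hs, hr, hsum⟩ := exists_sum_term_add hlow
    rw [hsum, add_mul, Finset.sum_mul]
    exact add_mem (sum_mem fun j hj => term_mul_mem_signed (hs j hj) _)
      (unsigned_le_signed (mul_mem_unsigned_left (by simpa using hr)))
  have hgf : g * f ∈ signed f GB N (below ω i) := by
    rw [mul_comm]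
    exact unsigned_le_signed (mul_mem_unsigned_right hg (hf ▸ le_self_add))
  have h1 := sub_mem hgf hmem
  rw [← sub_mul, sub_sub_cancel] at h1
  obtain ⟨r, -, hr⟩ := exists_mul_of_addVal_eq (a := coeff i g.1) (b := 1)
    (by rw [hi.1, addVal_one]; rfl)
  have h2 := term_mul_mem_signed_of_mem (D' := below ω i) r (d := 0) (by simp) h1
  rwa [← mul_assoc, term_mul_term, zero_add, ← hr] at h2

end signed

/-- `p` carries a signature `X^i`, and its series has valuation exactly `N`. -/
def IsSigPair (ω : MonomialOrder (Fin n)) (f : Tate R n) (GB : Set (Tate R n)) (N : ℕ)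
    (p : SPair R n) : Prop :=
  ∃ i, p.1 = (((0, i) : TMon n) : TMon₀ n) ∧ HasSig ω f GB N i p.2 ∧ gaussVal p.2 = N

/-- The pairs occurring in the set `G` of the inner loop. -/
def IsGPair (ω : MonomialOrder (Fin n)) (f : Tate R n) (GB : Set (Tate R n)) (N : ℕ)
    (p : SPair R n) : Prop :=
  (p.1 = ⊥ ∧ p.2 ∈ GB) ∨ IsSigPair ω f GB N p

lemma isSigPair_one (ω : MonomialOrder (Fin n)) {f : Tate R n} (GB : Set (Tate R n)) {N : ℕ}
    (hf : gaussVal f = N) : IsSigPair ω f GB N (((0 : TMon n) : TMon₀ n), f) := by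
  refine ⟨0, rfl, ?_, hf⟩
  rw [HasSig, term_one_zero, one_mul, sub_self]
  exact zero_mem _

lemma IsSigPair.ne_zero {ω : MonomialOrder (Fin n)} {f : Tate R n} {GB : Set (Tate R n)} {N : ℕ}
    {p : SPair R n} (h : IsSigPair ω f GB N p) : p.2 ≠ 0 := by
  obtain ⟨i, -, -, hv⟩ := h
  intro h0
  rw [h0, gaussVal_zero] at hv
  exact ENat.top_ne_natCast _ hv

/-- The values of the pairs in `G`. -/
def values (G : Set (SPair R n)) : Set (Tate R n) := {v | ∃ u, (u, v) ∈ G}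

lemma mem_values {G : Set (SPair R n)} {q : SPair R n} (h : q ∈ G) : q.2 ∈ values G := ⟨q.1, h⟩

lemma values_mono {G G' : Set (SPair R n)} (h : G ⊆ G') : values G ⊆ values G' :=
  fun _ ⟨u, hu⟩ => ⟨u, h hu⟩

section reduction

variable {f : Tate R n} {GB : Set (Tate R n)} {N : ℕ} {ω : MonomialOrder (Fin n)}
  {G : Set (SPair R n)}

lemma coe_add_coe (s t : TMon n) : ((s : TMon₀ n) + (t : TMon₀ n)) = ((s + t : TMon n) : TMon₀ n) :=
  rfl

lemma HasSig.regTopRed (hG : ∀ q ∈ G, IsGPair ω f GB N q) {i : Fin n →₀ ℕ} {v v' : Tate R n}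
    (h : HasSig ω f GB N i v) (hv : (N : ℕ∞) ≤ gaussVal v)
    (hr : RegTopRed ω (((0, i) : TMon n) : TMon₀ n) G v v') : HasSig ω f GB N i v' := by
  obtain ⟨hv0, q, hq, hq0, c, d, a, hc, hl, hlm, hlt, rfl, -⟩ := hr.spec
  suffices term c d * q.2 ∈ signed f GB N (below ω i) by
    rw [HasSig, sub_right_comm]
    exact sub_mem h this
  rcases hG q hq with ⟨-, hqGB⟩ | ⟨j, hj, hsig, -⟩
  · refine unsigned_le_signed (mul_mem_unsigned_right hqGB ?_)
    rwa [gaussVal_term, ← gaussVal_term_mul, hl.gaussVal, ← gaussVal_eq_lm ω hv0]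
  · rw [hj, coe_add_coe, tKey_coe_lt] at hlt
    rcases hlt with hlt | ⟨ha, hlt⟩
    · refine unsigned_le_signed (term_mul_mem_unsigned ?_ d hsig.mem_signed)
      rw [hc]
      have : 1 ≤ a := by simpa [Nat.one_le_iff_ne_zero, Nat.pos_iff_ne_zero] using hlt
      exact_mod_cast this
    · refine term_mul_mem_signed_of_mem c (fun k hk => ?_) hsig.mem_signed
      have hk' : ω.toSyn k ≤ ω.toSyn j := hk
      refine lt_of_le_of_lt ?_ hlt
      change ω.toSyn (d + k) ≤ ω.toSyn (d + j)
      rw [map_add, map_add]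
      exact add_le_add le_rfl hk'

lemma hasSig_of_reflTransGen (hG : ∀ q ∈ G, IsGPair ω f GB N q) {i : Fin n →₀ ℕ} {v v' : Tate R n}
    (h : HasSig ω f GB N i v) (hv : (N : ℕ∞) ≤ gaussVal v)
    (hr : Relation.ReflTransGen (RegTopRed ω (((0, i) : TMon n) : TMon₀ n) G) v v') :
    HasSig ω f GB N i v' ∧ (N : ℕ∞) ≤ gaussVal v' := by
  induction hr with
  | refl => exact ⟨h, hv⟩
  | tail _ hst ih => exact ⟨ih.1.regTopRed hG ih.2 hst, ih.2.trans hst.gaussVal_le⟩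

/-- When `regular_reduce` returns a series of valuation greater than `N`, the signature is that of
a syzygy, up to series of valuation greater than `N`. -/
lemma term_mul_mem_of_regularReduce (hR : NullSeriesConverge R) (hfin : G.Finite)
    (hG : ∀ q ∈ G, IsGPair ω f GB N q) {i : Fin n →₀ ℕ} {v v₀ : Tate R n}
    (h : HasSig ω f GB N i v) (hv : (N : ℕ∞) ≤ gaussVal v)
    (hr : RegularReduce ω (((0, i) : TMon n) : TMon₀ n) v G v₀)
    (hval : ((N + 1 : ℕ) : ℕ∞) ≤ gaussVal v₀) {P : Set (Tate R n)} (hP : values G ⊆ P)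
    (hv₀ : v₀ ∈ P) :
    term 1 i * f ∈ signed f GB N (below ω i) ⊔ (tail N P).toAddSubgroup := by
  suffices ∃ w, HasSig ω f GB N i w ∧ w ∈ tail N P by
    obtain ⟨w, hw, hwt⟩ := this
    have := sub_mem (AddSubgroup.mem_sup_right (S := signed f GB N (below ω i))
      (show w ∈ (tail N P).toAddSubgroup from hwt)) (AddSubgroup.mem_sup_left hw)
    rwa [sub_sub_cancel] at this
  rcases hr.cases with ⟨hrt, -⟩ | ⟨-, w, rfl, hw⟩
  · refine ⟨v₀, (hasSig_of_reflTransGen hG h hv hrt).1, ?_⟩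
    have := mul_mem_tail (b := 1) hv₀ (hval.trans le_add_self)
    rwa [one_mul] at this
  · obtain ⟨J, hJ⟩ := exists_mem_tail_of_regTopRed hR hfin hw N
    refine ⟨w J, (hasSig_of_reflTransGen hG h hv ?_).1, tail_mono hP hJ⟩
    clear hJ
    induction J with
    | zero => exact .refl
    | succ J ih => exact ih.tail (hw J)

end reduction

/-! ### The cover criterion -/

lemma isJPair_symm {ω : MonomialOrder (Fin n)} {ϖ : R} {p₁ p₂ p : SPair R n}
    (h : IsJPair ω ϖ p₁ p₂ p) : IsJPair ω ϖ p₂ p₁ p := by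
  obtain ⟨h1, h2, h⟩ := h
  refine ⟨h2, h1, ?_⟩
  dsimp only at h ⊢
  rw [sup_comm]
  exact h.symm

lemma monDvd_coe {s : TMon₀ n} {T : TMon n} (h : MonDvd s (T : TMon₀ n)) :
    ∃ T' : TMon n, s = T' ∧ T' ≤ T := by
  obtain ⟨t, ht⟩ := h
  induction s using WithBot.recBotCoe with
  | bot => rw [WithBot.add_bot] at ht; exact absurd ht WithBot.coe_ne_bot
  | coe s =>
    refine ⟨s, rfl, ?_⟩
    rw [coe_add_coe] at ht
    rw [WithBot.coe_injective ht]
    exact le_add_self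

lemma MonDvd.add {s u : TMon₀ n} (h : MonDvd s u) (t : TMon n) : MonDvd s ((t : TMon₀ n) + u) := by
  obtain ⟨t', rfl⟩ := h
  exact ⟨t + t', by rw [← add_assoc, coe_add_coe]⟩

/-- If a term multiple of `p`, of leading monomial `(N, e)` and signature `X^d`, has the leading
monomial of a term multiple of `q` of smaller signature, then it is a multiple of the J-pair
of `p` and `q`. -/
lemma exists_isJPair {ω : MonomialOrder (Fin n)} (ϖ : R) {f : Tate R n} {GB : Set (Tate R n)}
    {N : ℕ} {p q : SPair R n} {i t e₀ : Fin n →₀ ℕ} (hp1 : p.1 = (((0, i) : TMon n) : TMon₀ n))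
    (hp : IsLead ω p.2 (N, e₀)) (hq : IsGPair ω f GB N q) {c : R} {j : Fin n →₀ ℕ}
    (hlead : IsLead ω (term c j * q.2) (N, t + e₀))
    (hsig : ∀ k, q.1 = (((0, k) : TMon n) : TMon₀ n) →
      1 ≤ addVal R c ∨ ω.toSyn (j + k) < ω.toSyn (t + i)) :
    ∃ e₁ ≤ t, IsJPair ω ϖ p q (p.scale ϖ (0, e₁)) := by
  have hq0 : q.2 ≠ 0 := fun h => hlead.ne_zero (by rw [h, mul_zero])
  have hlq := isLead_lm ω hq0
  obtain ⟨k, hk, heq⟩ := hlq.of_term_mul hlead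
  generalize hlmq : lm ω q.2 = T at hlq heq
  obtain ⟨a, ex⟩ := T
  obtain ⟨rfl, he⟩ := Prod.ext_iff.mp heq
  simp only at he hk
  -- `r` is the cofactor of the J-pair
  have hle : e₀ ⊔ ex ≤ t + e₀ := sup_le le_add_self (he ▸ le_add_self)
  obtain ⟨r, hr⟩ := exists_add_of_le hle
  have ht : t = r + (e₀ ⊔ ex - e₀) := by
    refine add_right_cancel (b := e₀) ?_
    rw [add_assoc, tsub_add_cancel_of_le le_sup_left, add_comm r, hr]
  have hj : j = r + (e₀ ⊔ ex - ex) := by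
    refine add_right_cancel (b := ex) ?_
    rw [add_assoc, tsub_add_cancel_of_le le_sup_right, add_comm r, ← hr, he]
  have hsup : lm ω p.2 ⊔ lm ω q.2 = (k + a, e₀ ⊔ ex) := by
    rw [hp.lm_eq, hlmq]
    exact Prod.ext (sup_of_le_left (Nat.le_add_left a k)) rfl
  have ht₁ : lm ω p.2 ⊔ lm ω q.2 - lm ω p.2 = (0, e₀ ⊔ ex - e₀) := by
    rw [hsup, hp.lm_eq]
    exact Prod.ext (Nat.sub_self _) rfl
  have ht₂ : lm ω p.2 ⊔ lm ω q.2 - lm ω q.2 = (k, e₀ ⊔ ex - ex) := by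
    rw [hsup, hlmq]
    exact Prod.ext (Nat.add_sub_cancel k a) rfl
  refine ⟨e₀ ⊔ ex - e₀, ht ▸ le_add_self, hp.ne_zero, hq0, Or.inr ⟨?_, ?_⟩⟩
  · rw [ht₁, ht₂, hp1, coe_add_coe]
    rcases hq with ⟨hbot, -⟩ | ⟨l, hl, -, hval⟩
    · rw [hbot, WithBot.add_bot]
      exact bot_lt_tKey_coe ω _
    · rw [hl, coe_add_coe, tKey_coe_lt]
      have hk0 : k = 0 := by
        rw [gaussVal_eq_lm ω hq0, hlmq] at hval
        have : a = k + a := by exact_mod_cast hval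
        omega
      subst hk0
      refine Or.inr ⟨rfl, ?_⟩
      rcases hsig l hl with h | h
      · rw [hk] at h
        exact absurd h (by simp)
      · rw [ht, hj, add_assoc, add_assoc, map_add _ r, map_add _ r] at h
        exact lt_of_add_lt_add_left h
  · rw [ht₁]

/-- The sums of term multiples of values of `G` with signature in `D` and which belong to
`low N E`, up to `W`. -/
def sigStd (G : Set (SPair R n)) (W : Ideal (Tate R n)) (N : ℕ) (D E : Set (Fin n →₀ ℕ)) :
    AddSubgroup (Tate R n) :=
  AddSubgroup.closure {y | ∃ q ∈ G, ∃ (c : R) (d : Fin n →₀ ℕ), y = term c d * q.2 ∧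
    y ∈ low N E ∧ ∀ i, q.1 = (((0, i) : TMon n) : TMon₀ n) → 1 ≤ addVal R c ∨ d + i ∈ D} ⊔
  W.toAddSubgroup

section sigStd

variable {G : Set (SPair R n)} {W : Ideal (Tate R n)} {N : ℕ} {D E : Set (Fin n →₀ ℕ)}

lemma term_mul_mem_sigStd {q : SPair R n} (hq : q ∈ G) {c : R} {d : Fin n →₀ ℕ}
    (hl : term c d * q.2 ∈ low N E)
    (hs : ∀ i, q.1 = (((0, i) : TMon n) : TMon₀ n) → 1 ≤ addVal R c ∨ d + i ∈ D) :
    term c d * q.2 ∈ sigStd G W N D E :=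
  AddSubgroup.mem_sup_left (AddSubgroup.subset_closure ⟨q, hq, c, d, rfl, hl, hs⟩)

lemma sigStd_le {A : AddSubgroup (Tate R n)}
    (h : ∀ q ∈ G, ∀ (c : R) (d : Fin n →₀ ℕ), term c d * q.2 ∈ low N E →
      (∀ i, q.1 = (((0, i) : TMon n) : TMon₀ n) → 1 ≤ addVal R c ∨ d + i ∈ D) →
      term c d * q.2 ∈ A)
    (hW : W.toAddSubgroup ≤ A) : sigStd G W N D E ≤ A := by
  refine sup_le ((AddSubgroup.closure_le A).mpr ?_) hW
  rintro _ ⟨q, hq, c, d, rfl, hl, hs⟩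
  exact h q hq c d hl hs

lemma le_sigStd : W.toAddSubgroup ≤ sigStd G W N D E := le_sup_right

lemma sigStd_mono {D' : Set (Fin n →₀ ℕ)} (hD : D ⊆ D') : sigStd G W N D E ≤ sigStd G W N D' E :=
  sigStd_le (fun _ hq _ _ hl hs => term_mul_mem_sigStd hq hl
    fun i hi => (hs i hi).imp_right (@hD _))
    le_sigStd

lemma sigStd_le_std : sigStd G W N D E ≤ std (values G) W N E :=
  sigStd_le (fun _ hq _ _ hl _ => term_mul_mem_std (mem_values hq) hl) le_std

end sigStd

/-- The situation in which the inner loop ends: all J-pairs of `G` meet one of the two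
criteria. -/
structure CoverData (ω : MonomialOrder (Fin n)) (ϖ : R) (f : Tate R n) (GB : Set (Tate R n)) (N : ℕ)
    (G : Set (SPair R n)) (S : Set (TMon₀ n)) (W : Ideal (Tate R n)) : Prop where
  gaussVal_f : gaussVal f = N
  le_GB : ∀ g ∈ GB, gaussVal g ≤ N
  isGPair : ∀ q ∈ G, IsGPair ω f GB N q
  bot_mem : ∀ g ∈ GB, (⊥, g) ∈ G
  one_mem : (((0 : TMon n) : TMon₀ n), f) ∈ G
  criterion : ∀ p₁ ∈ G, ∀ p₂ ∈ G, ∀ p, IsJPair ω ϖ p₁ p₂ p → Criterion ω G S p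
  syzygy : ∀ i, (((0, i) : TMon n) : TMon₀ n) ∈ S →
    term 1 i * f ∈ signed f GB N (below ω i) ⊔ W.toAddSubgroup
  le_W : tail N (values G) ≤ W
  W_le : ∀ y ∈ W, ((N + 1 : ℕ) : ℕ∞) ≤ gaussVal y
  sPairs : ∀ e, SPairsAt ω GB W N e

section CoverData

variable {ω : MonomialOrder (Fin n)} {ϖ : R} {f : Tate R n} {GB : Set (Tate R n)} {N : ℕ}
  {G : Set (SPair R n)} {S : Set (TMon₀ n)} {W : Ideal (Tate R n)}

lemma CoverData.GB_subset (h : CoverData ω ϖ f GB N G S W) : GB ⊆ values G :=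
  fun g hg => ⟨⊥, h.bot_mem g hg⟩

/-- Elements without signature have standard representations because `GB` satisfies Buchberger's
criterion at valuation `N`. -/
lemma CoverData.std_of_unsigned (h : CoverData ω ϖ f GB N G S W) {E D : Set (Fin n →₀ ℕ)}
    (hE : IsInitial ω E) {v : Tate R n}
    (hv : v ∈ (unsigned f GB N).toAddSubgroup ⊔ W.toAddSubgroup) (hl : v ∈ low N E) :
    v ∈ sigStd G W N D E := by
  have htail : tail N GB ≤ W := (tail_mono h.GB_subset).trans h.le_W
  have hstd : v ∈ std GB W N Set.univ := by
    refine (sup_le (fun y hy => ?_) le_std : _ ≤ std GB W N Set.univ) hv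
    refine mem_of_mem_span ?_ hy
    rintro _ ⟨x, b, rfl, ⟨rfl, hb⟩ | ⟨hx, hb⟩⟩ a
    · refine le_std (W.mul_mem_left _ (h.le_W (mul_mem_tail (mem_values h.one_mem) ?_)))
      rw [h.gaussVal_f]
      push_cast
      rw [add_comm]
      exact add_le_add hb le_rfl
    · rw [← mul_assoc]
      exact mul_mem_std_univ htail hx (hb.trans (add_le_add (le_gaussVal_mul a le_rfl) le_rfl))
  refine std_le (fun x hx c d hlow => ?_) le_sigStd (std_of_low h.W_le h.sPairs hE hstd hl)
  refine term_mul_mem_sigStd (q := (⊥, x)) (h.bot_mem x hx) hlow fun i hi => ?_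
  exact absurd hi.symm WithBot.coe_ne_bot

/-- Among the multiples of signature `X^d` of pairs of `G`, one with the smallest leading monomial
is not regularly top-reducible, unless `X^d` is divisible by an element of `S`. -/
lemma CoverData.exists_irreducible (h : CoverData ω ϖ f GB N G S W) {d : Fin n →₀ ℕ}
    (hd : ∀ s ∈ S, ¬ MonDvd s (((0, d) : TMon n) : TMon₀ n)) :
    ∃ p ∈ G, ∃ i t e₀ : Fin n →₀ ℕ, p.1 = (((0, i) : TMon n) : TMon₀ n) ∧ HasSig ω f GB N i p.2 ∧
      d = t + i ∧ IsLead ω p.2 (N, e₀) ∧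
      ∀ q ∈ G, ∀ (c : R) (j : Fin n →₀ ℕ),
        (∀ k, q.1 = (((0, k) : TMon n) : TMon₀ n) → 1 ≤ addVal R c ∨ j + k ∈ below ω d) →
        ¬ IsLead ω (term c j * q.2) (N, t + e₀) := by
  -- the exponents of the leading monomials of the multiples of signature `X^d`
  let X : Set ω.syn := {x | ∃ p ∈ G, ∃ i t e₀ : Fin n →₀ ℕ,
    p.1 = (((0, i) : TMon n) : TMon₀ n) ∧ d = t + i ∧ IsLead ω p.2 (N, e₀) ∧
      x = ω.toSyn (t + e₀)}
  have hlead : ∀ p ∈ G, ∀ i : Fin n →₀ ℕ, p.1 = (((0, i) : TMon n) : TMon₀ n) →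
      HasSig ω f GB N i p.2 ∧ ∃ e₀, IsLead ω p.2 (N, e₀) := by
    intro p hp i hi
    rcases h.isGPair p hp with ⟨hbot, -⟩ | hsp
    · rw [hbot] at hi
      exact absurd hi.symm WithBot.coe_ne_bot
    · have hp0 := hsp.ne_zero
      obtain ⟨k, hk, hsig, hval⟩ := hsp
      rw [hk] at hi
      have : k = i := (Prod.ext_iff.mp (WithBot.coe_injective hi)).2
      subst this
      refine ⟨hsig, (lm ω p.2).2, ?_⟩
      have hL := isLead_lm ω hp0
      have hN : (lm ω p.2).1 = N := by exact_mod_cast hL.gaussVal.symm.trans hval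
      rwa [← hN]
  have hX : X.Nonempty := by
    obtain ⟨-, e₀, he₀⟩ := hlead _ h.one_mem 0 rfl
    exact ⟨_, _, h.one_mem, 0, d, e₀, rfl, (add_zero d).symm, he₀, rfl⟩
  obtain ⟨_, ⟨p, hp, i, t, e₀, hp1, hdt, hpl, rfl⟩, hmin⟩ :=
    (wellFounded_lt (α := ω.syn)).has_min X hX
  refine ⟨p, hp, i, t, e₀, hp1, (hlead p hp i hp1).1, hdt, hpl, fun q hq c j hs hqlead => ?_⟩
  rw [hdt] at hs
  obtain ⟨e₁, he₁, hJ⟩ := exists_isJPair ϖ hp1 hpl (h.isGPair q hq) hqlead hs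
  obtain ⟨r, rfl⟩ := exists_add_of_le he₁
  have hsc1 : (p.scale ϖ (0, e₁)).1 = (((0, e₁ + i) : TMon n) : TMon₀ n) := by
    simp [SPair.scale, hp1, coe_add_coe]
  have hsc2 : IsLead ω (p.scale ϖ (0, e₁)).2 (N, e₁ + e₀) := by
    have := hpl.term_mul (c := ϖ ^ 0) (a := 0) (by simp) e₁
    rwa [zero_add] at this
  have hdi : d = r + (e₁ + i) := by rw [hdt]; abel
  rcases h.criterion p hp q hq _ hJ with ⟨q', hq', T, hT, hlt⟩ | ⟨s, hs, hdvd⟩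
  · -- a pair covering the J-pair would have a multiple with a smaller leading monomial
    rw [hsc1] at hT
    rw [LM_of_ne hsc2.ne_zero, hsc2.lm_eq] at hlt
    rcases h.isGPair q' hq' with ⟨hbot, -⟩ | ⟨k, hk, -, -⟩
    · rw [hbot, WithBot.add_bot] at hT
      exact absurd hT WithBot.coe_ne_bot
    · rw [hk, coe_add_coe] at hT
      obtain ⟨hT1, hT2⟩ := Prod.ext_iff.mp (WithBot.coe_injective hT)
      simp only [Prod.fst_add, Prod.snd_add, add_zero] at hT1 hT2
      obtain ⟨-, e', he'⟩ := hlead q' hq' k hk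
      rw [LM_of_ne he'.ne_zero, he'.lm_eq, coe_add_coe, tKey_coe_lt] at hlt
      simp only [Prod.fst_add, Prod.snd_add, ← hT1, zero_add, lt_irrefl, true_and,
        false_or] at hlt
      refine hmin _ ⟨q', hq', k, r + T.2, e', hk, by rw [hdi, hT2, add_assoc], he', rfl⟩ ?_
      have hrw : e₁ + r + e₀ = r + (e₁ + e₀) := by abel
      rw [hrw, add_assoc, map_add _ r, map_add _ r]
      exact add_lt_add_right hlt _
  · rw [hsc1] at hdvd
    refine hd s hs ?_
    have := hdvd.add (0, r)
    rwa [coe_add_coe, Prod.mk_add_mk, zero_add, ← hdi] at this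

/-- Every element of signature at most `X^d` has a standard representation by pairs of `G` of
signature at most `X^d`. -/
theorem CoverData.sigStd_of_low_upTo (h : CoverData ω ϖ f GB N G S W) (d : Fin n →₀ ℕ)
    {E : Set (Fin n →₀ ℕ)} (hE : IsInitial ω E) {v : Tate R n}
    (hv : v ∈ signed f GB N (upTo ω d) ⊔ W.toAddSubgroup) (hl : v ∈ low N E) :
    v ∈ sigStd G W N (upTo ω d) E := by
  induction d using (InvImage.wf ω.toSyn (wellFounded_lt (α := ω.syn))).induction
    generalizing v E with
  | _ d ih =>
  have ih' : ∀ {E : Set (Fin n →₀ ℕ)}, IsInitial ω E → ∀ {v : Tate R n},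
      v ∈ signed f GB N (below ω d) ⊔ W.toAddSubgroup → v ∈ low N E →
      v ∈ sigStd G W N (below ω d) E := by
    intro E hE v hv hl
    obtain ⟨y, hy, w, hw, rfl⟩ := AddSubgroup.mem_sup.mp hv
    rcases signed_cases (ω := ω) hy with h' | ⟨d', hd', h'⟩
    · exact h.std_of_unsigned hE (AddSubgroup.add_mem_sup h' hw) hl
    · exact sigStd_mono (upTo_subset_below hd') (ih d' hd' hE (AddSubgroup.add_mem_sup h' hw) hl)
  obtain ⟨y, hy, w, hw, rfl⟩ := AddSubgroup.mem_sup.mp hv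
  obtain ⟨c, hc⟩ := exists_sub_mem_signed_below hy
  have hsmall : term c d * f ∈ signed f GB N (below ω d) ⊔ W.toAddSubgroup →
      y + w ∈ sigStd G W N (upTo ω d) E := fun hcd => by
    refine sigStd_mono (below_subset_upTo ω d) (ih' hE ?_ hl)
    have := add_mem (add_mem (AddSubgroup.mem_sup_left hc) hcd) (AddSubgroup.mem_sup_right hw)
    rwa [sub_add_cancel] at this
  by_cases hS : ∃ s ∈ S, MonDvd s (((0, d) : TMon n) : TMon₀ n)
  · obtain ⟨s, hs, hdvd⟩ := hS
    obtain ⟨⟨a, i⟩, rfl, hle⟩ := monDvd_coe hdvd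
    obtain ⟨ha, hi⟩ := Prod.mk_le_mk.mp hle
    obtain rfl := Nat.le_zero.mp ha
    obtain ⟨r, rfl⟩ := exists_add_of_le hi
    obtain ⟨z, hz, x, hx, hzx⟩ := AddSubgroup.mem_sup.mp (h.syzygy i hs)
    refine hsmall ?_
    have : term c (i + r) * f = term c r * z + term c r * x := by
      rw [← mul_add, hzx, ← mul_assoc, term_mul_term, mul_one, add_comm]
    rw [this]
    refine AddSubgroup.add_mem_sup (term_mul_mem_signed_of_mem c (fun j hj => ?_) hz)
      (W.mul_mem_left _ hx)
    change ω.toSyn (r + j) < ω.toSyn (i + r)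
    rw [add_comm i, map_add, map_add]
    exact add_lt_add_right (show ω.toSyn j < ω.toSyn i from hj) _
  push Not at hS
  by_cases hc1 : 1 ≤ addVal R c
  · refine hsmall (AddSubgroup.mem_sup_left (unsigned_le_signed (mul_mem_unsigned_left ?_)))
    rwa [gaussVal_term]
  have hc0 : addVal R c = (0 : ℕ) := by simpa [Order.one_le_iff_ne_zero] using hc1
  obtain ⟨p, hp, i, t, e₀, hp1, hsig, rfl, hpl, hirr⟩ := h.exists_irreducible hS
  have hlt : IsLead ω (term c t * p.2) (N, t + e₀) := by
    have := hpl.term_mul hc0 t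
    rwa [zero_add] at this
  have hrest : y + w - term c t * p.2 ∈ signed f GB N (below ω (t + i)) ⊔ W.toAddSubgroup := by
    have h1 := term_mul_mem_signed_of_mem (D' := below ω (t + i)) c (d := 0) (by simp)
      (hsig.term_mul t)
    have h2 := add_mem (AddSubgroup.mem_sup_left (sub_mem hc h1)) (AddSubgroup.mem_sup_right hw)
    convert h2 using 1
    rw [mul_sub, ← mul_assoc, ← mul_assoc, term_mul_term, term_mul_term]
    simp only [mul_one, zero_add]
    ring
  by_cases he : t + e₀ ∈ E
  · have hlow : term c t * p.2 ∈ low N E := low_mono (hE.upTo_subset he) hlt.2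
    have h1 := sigStd_mono (below_subset_upTo ω _) (ih' hE hrest (sub_mem hl hlow))
    have h2 : term c t * p.2 ∈ sigStd G W N (upTo ω (t + i)) E := by
      refine term_mul_mem_sigStd hp hlow fun k hk => Or.inr ?_
      rw [hp1] at hk
      obtain rfl : i = k := (Prod.ext_iff.mp (WithBot.coe_injective hk)).2
      exact le_refl (ω.toSyn (t + i))
    have := add_mem h1 h2
    rwa [sub_add_cancel] at this
  · -- the difference has leading monomial `(N, t + e₀)` and smaller signature
    exfalso
    have hsub : E ⊆ below ω (t + e₀) := fun k hk => by
      by_contra hlt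
      exact he (hE k hk _ (not_lt.mp hlt))
    have hlow : y + w - term c t * p.2 ∈ low N (upTo ω (t + e₀)) :=
      sub_mem (low_mono (hsub.trans (below_subset_upTo ω _)) hl) hlt.2
    have hbelow : y + w - term c t * p.2 ∈ low N (below ω (t + e₀)) := by
      refine sigStd_le (fun q hq c' j hl' hs => ?_) (fun z hz => low_of_lt (h.W_le z hz))
        (ih' (isInitial_upTo ω _) hrest hlow)
      rcases low_below_or_isLead hl' with h' | h'
      · exact h'
      · exact absurd h' (hirr q hq c' j hs)
    have := sub_mem (low_mono hsub hl) hbelow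
    rw [sub_sub_cancel] at this
    exact hlt.not_mem_low (not_mem_below ω _) this

lemma CoverData.std_of_low (h : CoverData ω ϖ f GB N G S W) {E : Set (Fin n →₀ ℕ)}
    (hE : IsInitial ω E) {v : Tate R n} (hv : v ∈ signed f GB N Set.univ) (hl : v ∈ low N E) :
    v ∈ std (values G) W N E := by
  rcases signed_cases (ω := ω) hv with h' | ⟨d, -, h'⟩
  · exact sigStd_le_std (h.std_of_unsigned (D := ∅) hE (AddSubgroup.mem_sup_left h') hl)
  · exact sigStd_le_std (h.sigStd_of_low_upTo d hE (AddSubgroup.mem_sup_left h') hl)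

/-- At the end of the inner loop, the new basis satisfies Buchberger's criterion up to the
elements put off. -/
theorem CoverData.closed {Q : Set (Tate R n)}
    (h : CoverData ω ϖ f GB N G S (tail N (values G ∪ Q))) (hGB : Closed ω GB (values G ∪ Q)) :
    Closed ω (values G) Q := by
  have key : ∀ x₁, (∃ q ∈ G, IsSigPair ω f GB N q ∧ q.2 = x₁) → ∀ x₂ ∈ values G,
      ∀ (M : ℕ) (e : Fin n →₀ ℕ) (c₁ c₂ : R) (d₁ d₂ : Fin n →₀ ℕ),
      IsLead ω (term c₁ d₁ * x₁) (M, e) → IsLead ω (term c₂ d₂ * x₂) (M, e) →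
      coeff e (term c₁ d₁ * x₁).1 = coeff e (term c₂ d₂ * x₂).1 →
      term c₁ d₁ * x₁ - term c₂ d₂ * x₂ ∈ std (values G) (tail M (values G ∪ Q)) M (below ω e) := by
    rintro _ ⟨⟨u₁, x₁⟩, -, hsp, rfl⟩ x₂ ⟨u₂, hx₂⟩ M e c₁ c₂ d₁ d₂ h₁ h₂ heq
    have hx₁0 := hsp.ne_zero
    obtain ⟨i, -, hsig, hval⟩ := hsp
    simp only at hx₁0 hsig hval h₁ heq ⊢
    have hx₂0 : x₂ ≠ 0 := fun h => h₂.ne_zero (by rw [h, mul_zero])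
    obtain ⟨a₁, ha₁, hT₁⟩ := (isLead_lm ω hx₁0).of_term_mul h₁
    obtain ⟨a₂, ha₂, hT₂⟩ := (isLead_lm ω hx₂0).of_term_mul h₂
    have hv₁ : (lm ω x₁).1 = N := by
      rw [gaussVal_eq_lm ω hx₁0] at hval
      exact_mod_cast hval
    have hle₂ : gaussVal x₂ ≤ N := by
      rcases h.isGPair _ hx₂ with ⟨-, hg⟩ | ⟨-, -, -, hg⟩
      · exact h.le_GB _ hg
      · exact hg.le
    have hv₂ : (lm ω x₂).1 ≤ N := by
      rw [gaussVal_eq_lm ω hx₂0] at hle₂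
      exact_mod_cast hle₂
    have hM₁ : M = a₁ + N := by rw [← hv₁]; exact (Prod.ext_iff.mp hT₁).1
    have hM₂ : M = a₂ + (lm ω x₂).1 := (Prod.ext_iff.mp hT₂).1
    -- the common factor `c₁` brings the situation back to valuation `N`
    have hdvd : c₁ ∣ c₂ := by
      rw [← addVal_le_iff_dvd, ha₁, ha₂]
      exact_mod_cast (by omega : a₁ ≤ a₂)
    obtain ⟨c, rfl⟩ := hdvd
    have hc₁ : c₁ ≠ 0 := fun h0 => by
      rw [h0, addVal_zero] at ha₁
      exact ENat.top_ne_natCast _ ha₁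
    have hfac₁ : term c₁ d₁ * x₁ = term c₁ 0 * (term 1 d₁ * x₁) := by
      rw [← mul_assoc, term_mul_term, mul_one, zero_add]
    have hfac₂ : term (c₁ * c) d₂ * x₂ = term c₁ 0 * (term c d₂ * x₂) := by
      rw [← mul_assoc, term_mul_term, zero_add]
    rw [hfac₁] at h₁ heq ⊢
    rw [hfac₂] at h₂ heq ⊢
    have hdown : ∀ y : Tate R n, IsLead ω (term c₁ 0 * y) (M, e) → IsLead ω y (N, e) := by
      intro y hy
      have hy0 : y ≠ 0 := fun h => hy.ne_zero (by rw [h, mul_zero])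
      obtain ⟨a, ha, hT⟩ := (isLead_lm ω hy0).of_term_mul hy
      have haa : a = a₁ := by exact_mod_cast ha.symm.trans ha₁
      obtain ⟨hT1, hT2⟩ := Prod.ext_iff.mp hT
      simp only [zero_add] at hT1 hT2
      have : lm ω y = (N, e) := Prod.ext (by omega) hT2.symm
      rw [← this]
      exact isLead_lm ω hy0
    have hl₁ := hdown _ h₁
    have hl₂ := hdown _ h₂
    have hcoeff : ∀ y : Tate R n, coeff e (term c₁ 0 * y).1 = c₁ * coeff e y.1 := fun y => by
      have := coeff_add_term_mul c₁ 0 e y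
      rwa [zero_add] at this
    have heq' : coeff e (term 1 d₁ * x₁).1 = coeff e (term c d₂ * x₂).1 := by
      rw [hcoeff, hcoeff] at heq
      exact mul_left_cancel₀ hc₁ heq
    have hs₁ : term 1 d₁ * x₁ ∈ signed f GB N Set.univ :=
      term_mul_mem_signed_of_mem (D := upTo ω i) 1 (fun _ _ => Set.mem_univ _) hsig.mem_signed
    have hs₂ : term c d₂ * x₂ ∈ signed f GB N Set.univ := by
      rcases h.isGPair _ hx₂ with ⟨-, hg⟩ | ⟨j, -, hsig₂, -⟩
      · refine unsigned_le_signed (mul_mem_unsigned_right hg ?_)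
        rw [gaussVal_term, ← gaussVal_term_mul, hl₂.gaussVal]
      · exact term_mul_mem_signed_of_mem (D := upTo ω j) c (fun _ _ => Set.mem_univ _)
            hsig₂.mem_signed
    have hstd := h.std_of_low (isInitial_below ω e) (sub_mem hs₁ hs₂)
      (hl₁.sub_mem_low hl₂ heq')
    have := term_mul_mem_std_below ha₁ 0 hstd
    rwa [zero_add, mul_sub, ← hM₁] at this
  intro M e x₁ hx₁ x₂ hx₂ c₁ c₂ d₁ d₂ h₁ h₂ heq
  obtain ⟨u₁, hu₁⟩ := id hx₁
  obtain ⟨u₂, hu₂⟩ := id hx₂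
  rcases h.isGPair _ hu₁ with ⟨-, hg₁⟩ | hsp₁
  · rcases h.isGPair _ hu₂ with ⟨-, hg₂⟩ | hsp₂
    · have := hGB M e x₁ hg₁ x₂ hg₂ c₁ c₂ d₁ d₂ h₁ h₂ heq
      refine std_mono h.GB_subset (tail_mono ?_) le_rfl this
      exact Set.union_subset (h.GB_subset.trans Set.subset_union_left) le_rfl
    · rw [← neg_sub]
      exact neg_mem (key x₂ ⟨_, hu₂, hsp₂, rfl⟩ x₁ hx₁ M e c₂ c₁ d₂ d₁ h₂ h₁ heq.symm)
  · exact key x₁ ⟨_, hu₁, hsp₁, rfl⟩ x₂ hx₂ M e c₁ c₂ d₁ d₂ h₁ h₂ heq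

end CoverData

/-! ### Invariants of the algorithm -/

lemma Closed.mono {ω : MonomialOrder (Fin n)} {P Q Q' : Set (Tate R n)} (h : Closed ω P Q)
    (hQ : Q ⊆ P ∪ Q') : Closed ω P Q' := fun N e x₁ h₁ x₂ h₂ c₁ c₂ d₁ d₂ hl₁ hl₂ heq =>
  std_mono le_rfl (tail_mono (Set.union_subset Set.subset_union_left hQ)) le_rfl
    (h N e x₁ h₁ x₂ h₂ c₁ c₂ d₁ d₂ hl₁ hl₂ heq)

/-- A J-pair of pairs of `G` has a signature, and can be regularly top-reduced: one of the two
pairs from which it is formed reduces the multiple of the other one. -/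
lemma isSigPair_of_isJPair {ω : MonomialOrder (Fin n)} {ϖ : R} {f : Tate R n}
    {GB : Set (Tate R n)} {N : ℕ} (hle : ∀ g ∈ GB, gaussVal g ≤ N) {G : Set (SPair R n)}
    (hG : ∀ q ∈ G, IsGPair ω f GB N q) {p₁ p₂ p : SPair R n} (hp₁ : p₁ ∈ G) (hp₂ : p₂ ∈ G)
    (h : IsJPair ω ϖ p₁ p₂ p) :
    IsSigPair ω f GB N p ∧ ∃ v', RegTopRed ω p.1 G p.2 v' := by
  wlog hc : tKey ω (((lm ω p₁.2 ⊔ lm ω p₂.2 - lm ω p₁.2 : TMon n) : TMon₀ n) + p₁.1) <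
      tKey ω (((lm ω p₁.2 ⊔ lm ω p₂.2 - lm ω p₂.2 : TMon n) : TMon₀ n) + p₂.1) ∧
      p = p₂.scale ϖ (lm ω p₁.2 ⊔ lm ω p₂.2 - lm ω p₂.2) generalizing p₁ p₂
  · refine this hp₂ hp₁ (isJPair_symm h) ?_
    rw [sup_comm]
    exact h.2.2.resolve_left hc
  obtain ⟨h₁0, h₂0, -⟩ := h
  obtain ⟨hlt, rfl⟩ := hc
  rcases hG p₂ hp₂ with ⟨hbot, -⟩ | ⟨i, hi, hsig, hval⟩
  · rw [hbot, WithBot.add_bot, tKey_bot] at hlt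
    exact absurd hlt not_lt_bot
  have hv₁ : (lm ω p₁.2).1 ≤ N := by
    have : gaussVal p₁.2 ≤ N := by
      rcases hG p₁ hp₁ with ⟨-, hg⟩ | ⟨-, -, -, hg⟩
      · exact hle _ hg
      · exact hg.le
    rw [gaussVal_eq_lm ω h₁0] at this
    exact_mod_cast this
  have hv₂ : (lm ω p₂.2).1 = N := by
    rw [gaussVal_eq_lm ω h₂0] at hval
    exact_mod_cast hval
  have ht : (lm ω p₁.2 ⊔ lm ω p₂.2 - lm ω p₂.2).1 = 0 := by
    change max (lm ω p₁.2).1 (lm ω p₂.2).1 - (lm ω p₂.2).1 = 0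
    omega
  have hsum₁ : lm ω p₁.2 ⊔ lm ω p₂.2 - lm ω p₁.2 + lm ω p₁.2 = lm ω p₁.2 ⊔ lm ω p₂.2 :=
    tsub_add_cancel_of_le le_sup_left
  have hsum₂ : lm ω p₁.2 ⊔ lm ω p₂.2 - lm ω p₂.2 + lm ω p₂.2 = lm ω p₁.2 ⊔ lm ω p₂.2 :=
    tsub_add_cancel_of_le le_sup_right
  generalize lm ω p₁.2 ⊔ lm ω p₂.2 - lm ω p₂.2 = t at *
  obtain ⟨a, d⟩ := t
  obtain rfl : a = 0 := ht
  have hlead : IsLead ω (p₂.scale ϖ (0, d)).2 (lm ω p₁.2 ⊔ lm ω p₂.2) := by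
    rw [← hsum₂]
    exact (isLead_lm ω h₂0).term_mul (by simp) d
  have hfst : (p₂.scale ϖ (0, d)).1 = (((0, d + i) : TMon n) : TMon₀ n) := by
    simp [SPair.scale, hi, coe_add_coe]
  refine ⟨⟨d + i, hfst, ?_, ?_⟩, exists_regTopRed hlead.ne_zero hp₁ h₁0
    (hlead.lm_eq.trans hsum₁.symm) hlt⟩
  · simpa only [SPair.scale, pow_zero] using hsig.term_mul d
  · simp [SPair.scale, gaussVal_term_mul, hval]

/-- The monomials divisible by the leading monomial of a nonzero element of `A`. -/
def leadMonomials (ω : MonomialOrder (Fin n)) (A : Set (Tate R n)) : UpperSet (TMon n) where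
  carrier := {T | ∃ g ∈ A, g ≠ 0 ∧ lm ω g ≤ T}
  upper' := fun _ _ hab ⟨g, hg, hg0, hle⟩ => ⟨g, hg, hg0, hle.trans hab⟩

lemma mem_leadMonomials {ω : MonomialOrder (Fin n)} {A : Set (Tate R n)} {T : TMon n} :
    T ∈ leadMonomials ω A ↔ ∃ g ∈ A, g ≠ 0 ∧ lm ω g ≤ T := Iff.rfl

/-- The invariant of the main loop: Buchberger's criterion holds for `GB`, except that multiples
of elements of `Q` of large valuation are allowed in standard representations. -/
structure OuterInv (ω : MonomialOrder (Fin n)) (I : Ideal (Tate R n)) (Q : Multiset (Tate R n))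
    (GB : Set (Tate R n)) : Prop where
  finite : GB.Finite
  span_eq : Ideal.span (GB ∪ {q | q ∈ Q}) = I
  le : ∀ g ∈ GB, ∀ q ∈ Q, gaussVal g ≤ gaussVal q
  closed : Closed ω GB {q | q ∈ Q}

/-- The initial value of `G` in the inner loop. -/
def initG (GB : Set (Tate R n)) (f : Tate R n) : Set (SPair R n) :=
  {p | ∃ g ∈ GB, p = (⊥, g)} ∪ {(((0 : TMon n) : TMon₀ n), f)}

lemma values_initG (GB : Set (Tate R n)) (f : Tate R n) : values (initG GB f) = insert f GB := by
  ext v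
  constructor
  · rintro ⟨u, ⟨g, hg, h⟩ | h⟩
    · obtain rfl : v = g := (Prod.ext_iff.mp h).2
      exact Or.inr hg
    · exact Or.inl (Prod.ext_iff.mp h).2
  · rintro (rfl | h)
    · exact ⟨_, Or.inr rfl⟩
    · exact ⟨⊥, Or.inl ⟨v, h, rfl⟩⟩

/-- The progress made by an inner loop started with an `f` whose leading monomial is already
divisible by that of an element of `GB`: either a new leading monomial has been found, or the
J-pair `(1, f)` is still to be treated, or this pair has led to a syzygy, which makes all other
J-pairs superfluous. -/
def Progress (ω : MonomialOrder (Fin n)) (f : Tate R n) (GB : Set (Tate R n))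
    (Q₀ Q : Multiset (Tate R n)) (G : Set (SPair R n)) (S : Set (TMon₀ n))
    (B : Set (SPair R n)) : Prop :=
  (∃ v ∈ values G, v ≠ 0 ∧ lm ω v ∉ leadMonomials ω GB) ∨
  (G = initG GB f ∧ Q = Q₀ ∧ (((0 : TMon n) : TMon₀ n), f) ∈ B ∧
    ∀ p ∈ B, p.1 = ((0 : TMon n) : TMon₀ n) → p.2 = f) ∨
  ((∃ s ∈ S, MonDvd s ((0 : TMon n) : TMon₀ n)) ∧
    (Q = Q₀ ∨ ∃ v₀, Q = v₀ ::ₘ Q₀ ∧ (v₀ = 0 ∨ lm ω v₀ ∉ leadMonomials ω GB)))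

/-- The invariant of the inner loop for `f ≠ 0` of valuation `N`, where `Q₀` is the value of `Q`
when the loop is entered. -/
structure InnerInv (ω : MonomialOrder (Fin n)) (ϖ : R) (I : Ideal (Tate R n)) (f : Tate R n)
    (GB : Set (Tate R n)) (N : ℕ) (Q₀ Q : Multiset (Tate R n)) (G : Set (SPair R n))
    (S : Set (TMon₀ n)) (B : Set (SPair R n)) : Prop where
  gaussVal_f : gaussVal f = N
  le_GB : ∀ g ∈ GB, gaussVal g ≤ N
  finite_G : G.Finite
  finite_B : B.Finite
  isGPair : ∀ q ∈ G, IsGPair ω f GB N q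
  bot_mem : ∀ g ∈ GB, (⊥, g) ∈ G
  one_mem : (((0 : TMon n) : TMon₀ n), f) ∈ G
  mem_B : ∀ p ∈ B, IsSigPair ω f GB N p ∧ ∃ v', RegTopRed ω p.1 G p.2 v'
  criterion : ∀ p₁ ∈ G, ∀ p₂ ∈ G, ∀ p, IsJPair ω ϖ p₁ p₂ p → p ∈ B ∨ Criterion ω G S p
  syzygy : ∀ i, (((0, i) : TMon n) : TMon₀ n) ∈ S → term 1 i * f ∈
    signed f GB N (below ω i) ⊔ (tail N (values G ∪ {q | q ∈ Q})).toAddSubgroup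
  le_Q : Q₀ ≤ Q
  gaussVal_Q : ∀ q ∈ Q, (N : ℕ∞) ≤ gaussVal q
  span_le : Ideal.span (insert f GB) ≤ I
  mem_Q : ∀ q ∈ Q, q ∈ I
  progress : lm ω f ∈ leadMonomials ω GB → Progress ω f GB Q₀ Q G S B

lemma Criterion.mono {ω : MonomialOrder (Fin n)} {G G' : Set (SPair R n)} {S S' : Set (TMon₀ n)}
    (hG : G ⊆ G') (hS : S ⊆ S') {p : SPair R n} (h : Criterion ω G S p) : Criterion ω G' S' p := by
  rcases h with ⟨q, hq, h⟩ | ⟨s, hs, h⟩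
  · exact Or.inl ⟨q, hG hq, h⟩
  · exact Or.inr ⟨s, hS hs, h⟩

lemma finite_setOf_isJPair (ω : MonomialOrder (Fin n)) (ϖ : R) (p₁ : SPair R n)
    {A : Set (SPair R n)} (hA : A.Finite) : {p | ∃ q ∈ A, IsJPair ω ϖ p₁ q p}.Finite := by
  refine ((hA.image fun q => q.scale ϖ (lm ω p₁.2 ⊔ lm ω q.2 - lm ω q.2)).union
    (hA.image fun q => p₁.scale ϖ (lm ω p₁.2 ⊔ lm ω q.2 - lm ω p₁.2))).subset ?_
  rintro p ⟨q, hq, -, -, ⟨-, rfl⟩ | ⟨-, rfl⟩⟩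
  · exact Or.inl ⟨q, hq, rfl⟩
  · exact Or.inr ⟨q, hq, rfl⟩

lemma setOf_isJPair_eq (ω : MonomialOrder (Fin n)) (ϖ : R) (p₁ : SPair R n)
    (GB : Set (Tate R n)) : {p | ∃ g ∈ GB, IsJPair ω ϖ p₁ (⊥, g) p} =
      {p | ∃ q ∈ {q : SPair R n | ∃ g ∈ GB, q = (⊥, g)}, IsJPair ω ϖ p₁ q p} := by
  ext p
  constructor
  · rintro ⟨g, hg, h⟩
    exact ⟨_, ⟨g, hg, rfl⟩, h⟩
  · rintro ⟨_, ⟨g, hg, rfl⟩, h⟩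
    exact ⟨g, hg, h⟩

lemma finite_bot_pairs {GB : Set (Tate R n)} (h : GB.Finite) :
    {q : SPair R n | ∃ g ∈ GB, q = (⊥, g)}.Finite :=
  (h.image fun g => ((⊥, g) : SPair R n)).subset fun _ ⟨g, hg, hq⟩ => ⟨g, hg, hq.symm⟩

lemma lm_not_mem_leadMonomials {ω : MonomialOrder (Fin n)} {GB : Set (Tate R n)}
    {G : Set (SPair R n)} (hG : ∀ g ∈ GB, (⊥, g) ∈ G) {T : TMon n} {v₀ : Tate R n}
    (hv₀ : v₀ ≠ 0) (hirr : ¬ ∃ v', RegTopRed ω (T : TMon₀ n) G v₀ v') :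
    lm ω v₀ ∉ leadMonomials ω GB := by
  rintro ⟨g, hg, hg0, hle⟩
  refine hirr (exists_regTopRed hv₀ (hG g hg) hg0 (t := lm ω v₀ - lm ω g)
    (tsub_add_cancel_of_le hle).symm ?_)
  rw [WithBot.add_bot]
  exact bot_lt_tKey_coe ω T

section InnerInv

variable {ω : MonomialOrder (Fin n)} {ϖ : R} {I : Ideal (Tate R n)} {f : Tate R n}
  {GB : Set (Tate R n)} {N : ℕ} {Q₀ Q : Multiset (Tate R n)} {G : Set (SPair R n)}
  {S : Set (TMon₀ n)} {B : Set (SPair R n)} {p : SPair R n} {v₀ : Tate R n}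

lemma InnerInv.init (h : OuterInv ω I (f ::ₘ Q₀) GB) (hmin : ∀ q ∈ Q₀, gaussVal f ≤ gaussVal q)
    (hf : gaussVal f = N) :
    InnerInv ω ϖ I f GB N Q₀ Q₀ (initG GB f) {s | ∃ g ∈ GB, s = LM ω g}
      {p | ∃ g ∈ GB, IsJPair ω ϖ (((0 : TMon n) : TMon₀ n), f) (⊥, g) p} := by
  have hle : ∀ g ∈ GB, gaussVal g ≤ N := fun g hg => hf ▸ h.le g hg f (Multiset.mem_cons_self f Q₀)
  have hG : ∀ q ∈ initG GB f, IsGPair ω f GB N q := by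
    rintro q (⟨g, hg, rfl⟩ | rfl)
    · exact Or.inl ⟨rfl, hg⟩
    · exact Or.inr (isSigPair_one ω GB hf)
  have hbot : ∀ g ∈ GB, (⊥, g) ∈ initG GB f := fun g hg => Or.inl ⟨g, hg, rfl⟩
  have hone : (((0 : TMon n) : TMon₀ n), f) ∈ initG GB f := Or.inr rfl
  have hf0 : f ≠ 0 := (isSigPair_one ω GB hf).ne_zero
  have hspan : ∀ x ∈ GB ∪ {q | q ∈ f ::ₘ Q₀}, x ∈ I := fun x hx => by
    rw [← h.span_eq]
    exact Ideal.subset_span hx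
  refine ⟨hf, hle, ?_, ?_, hG, hbot, hone, ?_, ?_, ?_, le_rfl, fun q hq => hf ▸ hmin q hq, ?_,
    fun q hq => hspan q (Or.inr (Multiset.mem_cons_of_mem hq)), ?_⟩
  · exact (finite_bot_pairs h.finite).union (Set.finite_singleton _)
  · rw [setOf_isJPair_eq]
    exact finite_setOf_isJPair ω ϖ _ (finite_bot_pairs h.finite)
  · rintro p ⟨g, hg, hJ⟩
    exact isSigPair_of_isJPair hle hG hone (hbot g hg) hJ
  · have hirr : ∀ p₁ p₂ p : SPair R n, p₁.1 = p₂.1 → lm ω p₁.2 = lm ω p₂.2 →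
        ¬ IsJPair ω ϖ p₁ p₂ p := by
      rintro p₁ p₂ p h1 h2 ⟨-, -, ⟨h, -⟩ | ⟨h, -⟩⟩ <;> simp [h1, h2] at h
    rintro p₁ (⟨g₁, hg₁, rfl⟩ | rfl) p₂ (⟨g₂, hg₂, rfl⟩ | rfl) p hJ
    · obtain ⟨-, -, ⟨h, -⟩ | ⟨h, -⟩⟩ := hJ <;> simp [WithBot.add_bot] at h
    · exact Or.inl ⟨g₁, hg₁, isJPair_symm hJ⟩
    · exact Or.inl ⟨g₂, hg₂, hJ⟩
    · exact absurd hJ (hirr _ _ _ rfl rfl)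
  · rintro i ⟨g, hg, hgi⟩
    have hg0 : g ≠ 0 := by
      rintro rfl
      rw [LM_zero] at hgi
      exact WithBot.coe_ne_bot hgi
    rw [LM_of_ne hg0] at hgi
    refine AddSubgroup.mem_sup_left (term_mul_mem_signed_below_of_isLead hf hg ?_)
    rw [WithBot.coe_injective hgi]
    exact isLead_lm ω hg0
  · refine Ideal.span_le.mpr ?_
    rintro x (rfl | hx)
    · exact hspan x (Or.inr (Multiset.mem_cons_self x Q₀))
    · exact hspan x (Or.inl hx)
  · rintro ⟨g, hg, hg0, hle'⟩
    refine Or.inr (Or.inl ⟨rfl, rfl, ⟨g, hg, hf0, hg0, Or.inr ⟨?_, ?_⟩⟩, ?_⟩)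
    · rw [WithBot.add_bot, coe_add_coe]
      exact bot_lt_tKey_coe ω _
    · have : lm ω f ⊔ lm ω g - lm ω f = 0 := by rw [sup_of_le_left hle', tsub_self]
      simp only [this, SPair.scale, Prod.fst_zero, pow_zero, Prod.snd_zero, term_one_zero, one_mul,
        coe_add_coe, add_zero]
    · rintro p ⟨g', hg', -, -, ⟨hlt, -⟩ | ⟨-, rfl⟩⟩ hp
      · rw [WithBot.add_bot, tKey_bot] at hlt
        exact absurd hlt not_lt_bot
      · simp only [SPair.scale, coe_add_coe, add_zero] at hp ⊢
        rw [WithBot.coe_injective hp]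
        simp [term_one_zero]

/-- While the J-pair `(1, f)` is pending, it is the one with smallest signature. -/
lemma InnerInv.eq_of_isMinSig (h : InnerInv ω ϖ I f GB N Q₀ Q G S B)
    (h1 : (((0 : TMon n) : TMon₀ n), f) ∈ B)
    (h2 : ∀ p ∈ B, p.1 = ((0 : TMon n) : TMon₀ n) → p.2 = f) (hp : IsMinSig ω B p) :
    p = (((0 : TMon n) : TMon₀ n), f) := by
  obtain ⟨⟨i, hi, -, -⟩, -⟩ := h.mem_B p hp.1
  have hle := hp.2 _ h1
  rw [hi, tKey_coe_le] at hle
  have h0 : i = 0 := by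
    rcases hle with hle | ⟨-, hle⟩
    · exact absurd hle (lt_irrefl 0)
    · change ω.toSyn i ≤ ω.toSyn 0 at hle
      rw [map_zero] at hle
      exact (ω.toSyn_eq_zero_iff i).mp (ω.eq_zero_iff.mpr hle)
  have hp1 : p.1 = ((0 : TMon n) : TMon₀ n) := by rw [hi, h0]; rfl
  exact Prod.ext hp1 (h2 p hp.1 hp1)

lemma InnerInv.criterion_of_dvd_one (h : InnerInv ω ϖ I f GB N Q₀ Q G S B)
    (hS : ∃ s ∈ S, MonDvd s ((0 : TMon n) : TMon₀ n)) (hp : p ∈ B) : Criterion ω G S p := by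
  obtain ⟨s, hs, hdvd⟩ := hS
  obtain ⟨⟨i, hi, -, -⟩, -⟩ := h.mem_B p hp
  refine Or.inr ⟨s, hs, ?_⟩
  have := hdvd.add (0, i)
  rwa [coe_add_coe, add_zero, ← hi] at this

lemma InnerInv.skip (h : InnerInv ω ϖ I f GB N Q₀ Q G S B) (hp : IsMinSig ω B p)
    (hc : Criterion ω G S p) : InnerInv ω ϖ I f GB N Q₀ Q G S (B \ {p}) where
  gaussVal_f := h.gaussVal_f
  le_GB := h.le_GB
  finite_G := h.finite_G
  finite_B := h.finite_B.subset Set.sdiff_subset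
  isGPair := h.isGPair
  bot_mem := h.bot_mem
  one_mem := h.one_mem
  mem_B q hq := h.mem_B q hq.1
  criterion p₁ hp₁ p₂ hp₂ q hq := by
    rcases h.criterion p₁ hp₁ p₂ hp₂ q hq with hB | hB
    · by_cases hqp : q = p
      · exact Or.inr (hqp ▸ hc)
      · exact Or.inl ⟨hB, hqp⟩
    · exact Or.inr hB
  syzygy := h.syzygy
  le_Q := h.le_Q
  gaussVal_Q := h.gaussVal_Q
  span_le := h.span_le
  mem_Q := h.mem_Q
  progress hf := by
    rcases h.progress hf with h' | ⟨rfl, rfl, h1, h2⟩ | h'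
    · exact Or.inl h'
    · obtain rfl := h.eq_of_isMinSig h1 h2 hp
      rcases hc with ⟨q, ⟨g, hg, rfl⟩ | rfl, t, ht, hlt⟩ | hdvd
      · rw [WithBot.add_bot] at ht
        exact absurd ht WithBot.coe_ne_bot
      · -- a pair does not cover itself
        rw [coe_add_coe, add_zero] at ht
        obtain rfl := WithBot.coe_injective ht
        rw [LM_of_ne (isSigPair_one ω GB h.gaussVal_f).ne_zero, coe_add_coe, zero_add] at hlt
        exact absurd hlt (lt_irrefl _)
      · exact Or.inr (Or.inr ⟨hdvd, Or.inl rfl⟩)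
    · exact Or.inr (Or.inr h')

lemma InnerInv.reflTransGen (h : InnerInv ω ϖ I f GB N Q₀ Q G S B) (hp : p ∈ B)
    (hr : Relation.ReflTransGen (RegTopRed ω p.1 G) p.2 v₀) :
    ∃ i, p.1 = (((0, i) : TMon n) : TMon₀ n) ∧ HasSig ω f GB N i v₀ ∧ (N : ℕ∞) ≤ gaussVal v₀ := by
  obtain ⟨⟨i, hi, hsig, hval⟩, -⟩ := h.mem_B p hp
  rw [hi] at hr
  exact ⟨i, hi, hasSig_of_reflTransGen h.isGPair hsig hval.ge hr⟩

lemma InnerInv.mem_of_regularReduce (h : InnerInv ω ϖ I f GB N Q₀ Q G S B) (hp : p ∈ B)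
    (hr : RegularReduce ω p.1 p.2 G v₀) : v₀ ∈ I := by
  rcases hr.cases with ⟨hr, -⟩ | ⟨rfl, -⟩
  · obtain ⟨i, -, hsig, -⟩ := h.reflTransGen hp hr
    exact h.span_le hsig.mem_span
  · exact zero_mem I

lemma InnerInv.add_syzygy (hR : NullSeriesConverge R) (h : InnerInv ω ϖ I f GB N Q₀ Q G S B)
    (hp : IsMinSig ω B p) (hc : ¬ Criterion ω G S p) (hr : RegularReduce ω p.1 p.2 G v₀)
    (hval : gaussVal f < gaussVal v₀) :
    InnerInv ω ϖ I f GB N Q₀ (v₀ ::ₘ Q) G (S ∪ {p.1}) (B \ {p}) where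
  gaussVal_f := h.gaussVal_f
  le_GB := h.le_GB
  finite_G := h.finite_G
  finite_B := h.finite_B.subset Set.sdiff_subset
  isGPair := h.isGPair
  bot_mem := h.bot_mem
  one_mem := h.one_mem
  mem_B q hq := h.mem_B q hq.1
  criterion p₁ hp₁ p₂ hp₂ q hq := by
    rcases h.criterion p₁ hp₁ p₂ hp₂ q hq with hB | hB
    · by_cases hqp : q = p
      · refine Or.inr (Or.inr ⟨p.1, Or.inr rfl, 0, ?_⟩)
        rw [hqp, WithBot.coe_zero, zero_add]
      · exact Or.inl ⟨hB, hqp⟩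
    · exact Or.inr (hB.mono le_rfl Set.subset_union_left)
  syzygy i hi := by
    rcases hi with hi | hi
    · refine (sup_le_sup_left ?_ _ : _ ≤ signed f GB N (below ω i) ⊔ _) (h.syzygy i hi)
      exact tail_mono (Set.union_subset_union_right _ fun q hq => Multiset.mem_cons_of_mem hq)
    · obtain ⟨⟨j, hj, hsig, hvalp⟩, -⟩ := h.mem_B p hp.1
      have hij : i = j := by
        rw [Set.mem_singleton_iff, hj] at hi
        exact (Prod.ext_iff.mp (WithBot.coe_injective hi)).2
      subst hij
      rw [hj] at hr
      refine term_mul_mem_of_regularReduce hR h.finite_G h.isGPair hsig hvalp.ge hr ?_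
        Set.subset_union_left (Or.inr (Multiset.mem_cons_self v₀ Q))
      rw [h.gaussVal_f] at hval
      push_cast
      exact Order.add_one_le_of_lt hval
  le_Q := h.le_Q.trans (Multiset.le_cons_self Q v₀)
  gaussVal_Q q hq := by
    rcases Multiset.mem_cons.mp hq with rfl | hq
    · exact h.gaussVal_f ▸ hval.le
    · exact h.gaussVal_Q q hq
  span_le := h.span_le
  mem_Q q hq := by
    rcases Multiset.mem_cons.mp hq with rfl | hq
    · exact h.mem_of_regularReduce hp.1 hr
    · exact h.mem_Q q hq
  progress hf := by
    rcases h.progress hf with h' | ⟨rfl, rfl, h1, h2⟩ | ⟨h', -⟩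
    · exact Or.inl h'
    · obtain rfl := h.eq_of_isMinSig h1 h2 hp
      refine Or.inr (Or.inr ⟨⟨_, Or.inr rfl, 0, rfl⟩, Or.inr ⟨v₀, rfl, ?_⟩⟩)
      by_cases hv0 : v₀ = 0
      · exact Or.inl hv0
      · exact Or.inr (lm_not_mem_leadMonomials h.bot_mem hv0 hr.irreducible)
    · exact absurd (h.criterion_of_dvd_one h' hp.1) hc

/-- A series of valuation at most `N` returned by `regular_reduce` is the result of finitely many
reductions. -/
lemma InnerInv.isSigPair_of_regularReduce (h : InnerInv ω ϖ I f GB N Q₀ Q G S B) (hp : p ∈ B)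
    (hr : RegularReduce ω p.1 p.2 G v₀) (hval : ¬ gaussVal f < gaussVal v₀) :
    IsSigPair ω f GB N (p.1, v₀) := by
  rw [h.gaussVal_f, not_lt] at hval
  rcases hr.cases with ⟨hrt, -⟩ | ⟨rfl, -⟩
  · obtain ⟨i, hi, hsig, hle⟩ := h.reflTransGen hp hrt
    exact ⟨i, hi, hsig, hval.antisymm hle⟩
  · rw [gaussVal_zero, top_le_iff] at hval
    exact absurd hval (ENat.natCast_ne_top N)

lemma InnerInv.add_pair (h : InnerInv ω ϖ I f GB N Q₀ Q G S B)
    (hp : IsMinSig ω B p) (hc : ¬ Criterion ω G S p) (hr : RegularReduce ω p.1 p.2 G v₀)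
    (hval : ¬ gaussVal f < gaussVal v₀) :
    InnerInv ω ϖ I f GB N Q₀ Q (G ∪ {(p.1, v₀)}) S
      ((B \ {p}) ∪ {p' | ∃ q ∈ G, IsJPair ω ϖ (p.1, v₀) q p'}) := by
  have hsp := h.isSigPair_of_regularReduce hp.1 hr hval
  have hsub : G ⊆ G ∪ {(p.1, v₀)} := Set.subset_union_left
  have hG : ∀ q ∈ G ∪ {(p.1, v₀)}, IsGPair ω f GB N q := by
    rintro q (hq | rfl)
    · exact h.isGPair q hq
    · exact Or.inr hsp
  refine ⟨h.gaussVal_f, h.le_GB, h.finite_G.union (Set.finite_singleton _),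
    (h.finite_B.subset Set.sdiff_subset).union (finite_setOf_isJPair ω ϖ _ h.finite_G), hG,
    fun g hg => hsub (h.bot_mem g hg), hsub h.one_mem, ?_, ?_, fun i hi => ?_, h.le_Q,
    h.gaussVal_Q, h.span_le, h.mem_Q, fun hf => ?_⟩
  · rintro q (hq | ⟨q', hq', hJ⟩)
    · obtain ⟨hq, v', hv'⟩ := h.mem_B q hq.1
      exact ⟨hq, v', hv'.mono hsub⟩
    · exact isSigPair_of_isJPair h.le_GB hG (Or.inr rfl) (hsub hq') hJ
  · rintro p₁ (hp₁ | rfl) p₂ (hp₂ | rfl) q hJ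
    · rcases h.criterion p₁ hp₁ p₂ hp₂ q hJ with hB | hB
      · by_cases hqp : q = p
        · -- the pair `p` is covered by its own reduction
          refine Or.inr (Or.inl ⟨(p.1, v₀), Or.inr rfl, 0, ?_, ?_⟩)
          · rw [hqp, WithBot.coe_zero, zero_add]
          · rw [hqp, WithBot.coe_zero, zero_add]
            exact hr.LM_lt (h.mem_B p hp.1).2
        · exact Or.inl (Or.inl ⟨hB, hqp⟩)
      · exact Or.inr (hB.mono hsub le_rfl)
    · exact Or.inl (Or.inr ⟨p₁, hp₁, isJPair_symm hJ⟩)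
    · exact Or.inl (Or.inr ⟨p₂, hp₂, hJ⟩)
    · obtain ⟨-, -, ⟨hlt, -⟩ | ⟨hlt, -⟩⟩ := hJ <;> exact absurd hlt (lt_irrefl _)
  · refine (sup_le_sup_left ?_ _ : _ ≤ signed f GB N (below ω i) ⊔ _) (h.syzygy i hi)
    exact tail_mono (Set.union_subset_union_left _ (values_mono hsub))
  · rcases h.progress hf with ⟨v, hv, hv0, hvL⟩ | ⟨rfl, rfl, h1, h2⟩ | ⟨h', -⟩
    · exact Or.inl ⟨v, values_mono hsub hv, hv0, hvL⟩
    · obtain rfl := h.eq_of_isMinSig h1 h2 hp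
      exact Or.inl ⟨v₀, ⟨_, Or.inr rfl⟩, hsp.ne_zero,
        lm_not_mem_leadMonomials h.bot_mem hsp.ne_zero hr.irreducible⟩
    · exact absurd (h.criterion_of_dvd_one h' hp.1) hc

/-- The invariant of the main loop is restored at the end of the inner loop. -/
lemma InnerInv.finish (h : InnerInv ω ϖ I f GB N Q₀ Q G S ∅) (ho : OuterInv ω I (f ::ₘ Q₀) GB) :
    OuterInv ω I Q (values G) := by
  have hGB : GB ⊆ values G := fun g hg => ⟨⊥, h.bot_mem g hg⟩
  have hold : {q | q ∈ f ::ₘ Q₀} ⊆ values G ∪ {q | q ∈ Q} := by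
    intro q hq
    rcases Multiset.mem_cons.mp hq with rfl | hq
    · exact Or.inl (mem_values h.one_mem)
    · exact Or.inr (Multiset.mem_of_le h.le_Q hq)
  have hclosed : Closed ω GB (values G ∪ {q | q ∈ Q}) :=
    ho.closed.mono (hold.trans Set.subset_union_right)
  have hval : ∀ q ∈ G, gaussVal q.2 ≤ N := fun q hq => by
    rcases h.isGPair q hq with ⟨-, hg⟩ | ⟨-, -, -, hg⟩
    · exact h.le_GB _ hg
    · exact hg.le
  refine ⟨(h.finite_G.image Prod.snd).subset fun v ⟨u, hu⟩ => ⟨_, hu, rfl⟩, ?_, ?_, ?_⟩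
  · apply le_antisymm
    · refine Ideal.span_le.mpr (Set.union_subset ?_ h.mem_Q)
      rintro v ⟨u, hu⟩
      refine h.span_le ?_
      rcases h.isGPair _ hu with ⟨-, hg⟩ | ⟨i, -, hsig, -⟩
      · exact Ideal.subset_span (Or.inr hg)
      · exact hsig.mem_span
    · rw [← ho.span_eq]
      exact Ideal.span_mono (Set.union_subset (hGB.trans Set.subset_union_left) hold)
  · rintro g ⟨u, hu⟩ q hq
    exact (hval _ hu).trans (h.gaussVal_Q q hq)
  · refine CoverData.closed (ϖ := ϖ) (S := S) ⟨h.gaussVal_f, h.le_GB, h.isGPair, h.bot_mem,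
      h.one_mem,
      fun p₁ hp₁ p₂ hp₂ p hp => (h.criterion p₁ hp₁ p₂ hp₂ p hp).resolve_left (Set.notMem_empty p),
      h.syzygy, tail_mono Set.subset_union_left,
      fun y hy => le_gaussVal_of_mem_tail hy, fun e => ?_⟩
      hclosed
    intro x₁ h₁ x₂ h₂ c₁ c₂ d₁ d₂ hl₁ hl₂ heq
    refine std_mono le_rfl (tail_mono ?_) le_rfl (hclosed N e x₁ h₁ x₂ h₂ c₁ c₂ d₁ d₂ hl₁ hl₂ heq)
    exact Set.union_subset (hGB.trans Set.subset_union_left) le_rfl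

end InnerInv

/-- A zero popped from `Q` is added to the basis without further effect. -/
lemma OuterInv.insert_zero {ω : MonomialOrder (Fin n)} {I : Ideal (Tate R n)}
    {Q₀ : Multiset (Tate R n)} {GB : Set (Tate R n)} (h : OuterInv ω I (0 ::ₘ Q₀) GB)
    (hmin : ∀ q ∈ Q₀, gaussVal (0 : Tate R n) ≤ gaussVal q) : OuterInv ω I Q₀ (insert 0 GB) := by
  refine ⟨h.finite.insert 0, ?_, ?_, ?_⟩
  · rw [← h.span_eq]
    congr 1
    ext x
    simp only [Set.mem_union, Set.mem_insert_iff, Set.mem_ofPred_eq, Multiset.mem_cons]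
    tauto
  · rintro g (rfl | hg) q hq
    · exact hmin q hq
    · exact h.le g hg q (Multiset.mem_cons_of_mem hq)
  · intro N e x₁ hx₁ x₂ hx₂ c₁ c₂ d₁ d₂ h₁ h₂ heq
    have hne : ∀ {x : Tate R n} {c : R} {d : Fin n →₀ ℕ}, x ∈ insert 0 GB →
        IsLead ω (term c d * x) (N, e) → x ∈ GB := by
      rintro x c d (rfl | hx) hl
      · exact absurd (mul_zero _) hl.ne_zero
      · exact hx
    refine std_mono (Set.subset_insert 0 GB) (tail_mono ?_) le_rfl
      (h.closed N e x₁ (hne hx₁ h₁) x₂ (hne hx₂ h₂) c₁ c₂ d₁ d₂ h₁ h₂ heq)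
    rintro x (hx | hx)
    · exact Or.inl (Or.inr hx)
    · rcases Multiset.mem_cons.mp hx with rfl | hx
      · exact Or.inl (Or.inl rfl)
      · exact Or.inr hx

/-! ### Termination -/

/-- Dickson's lemma: upper sets of a well-quasi-order cannot grow for ever. -/
lemma wellFounded_upperSet (α : Type*) [PartialOrder α] [WellQuasiOrderedLE α] :
    WellFounded fun s t : UpperSet α => s < t := by
  rw [wellFounded_iff_isEmpty_descending_chain]
  refine ⟨fun ⟨F, hF⟩ => ?_⟩
  have hanti : Antitone F := antitone_nat_of_succ_le fun k => (hF k).le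
  have hex : ∀ k, ∃ x, x ∈ F (k + 1) ∧ x ∉ F k := fun k => by
    obtain ⟨x, hx, hx'⟩ := Set.exists_of_ssubset (UpperSet.coe_ssubset_coe.mpr (hF k))
    exact ⟨x, hx, hx'⟩
  choose x hx hx' using hex
  obtain ⟨k, l, hkl, hle⟩ := wellQuasiOrdered_le (α := α) x
  exact hx' l ((F l).upper hle (hanti (Nat.succ_le_of_lt hkl) (hx k)))

/-- The contribution of `q ∈ Q` to the measure which decreases as long as the set `L` of the
leading monomials of the basis does not grow: most for the elements whose leading monomial is in
`L`, none for the others, since these will make `L` grow. -/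
def weight (ω : MonomialOrder (Fin n)) (L : UpperSet (TMon n)) (q : Tate R n) : ℕ :=
  open Classical in if q = 0 then 1 else if lm ω q ∈ L then 2 else 0

/-- The measure of a state at the test of the main loop. -/
def outerRank (ω : MonomialOrder (Fin n)) (Q : Multiset (Tate R n)) (GB : Set (Tate R n)) :
    UpperSet (TMon n) × ℕ :=
  (leadMonomials ω GB, (Q.map (weight ω (leadMonomials ω GB))).sum)

/-- The pairs (signature, exponent of the leading monomial) of the elements of `G`, and their
multiples. -/
def sigLeadExps (ω : MonomialOrder (Fin n)) (G : Set (SPair R n)) :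
    UpperSet ((Fin n →₀ ℕ) × (Fin n →₀ ℕ)) where
  carrier := {x | ∃ q ∈ G, ∃ i : Fin n →₀ ℕ, q.1 = (((0, i) : TMon n) : TMon₀ n) ∧
    (i, (lm ω q.2).2) ≤ x}
  upper' := fun _ _ hab ⟨q, hq, i, hi, hle⟩ => ⟨q, hq, i, hi, hle.trans hab⟩

section termination

variable {ω : MonomialOrder (Fin n)} {ϖ : R} {I : Ideal (Tate R n)} {f : Tate R n}
  {GB : Set (Tate R n)} {N : ℕ} {Q₀ Q : Multiset (Tate R n)} {G : Set (SPair R n)}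
  {S : Set (TMon₀ n)} {B : Set (SPair R n)} {p : SPair R n} {v₀ : Tate R n}

/-- A pair added to `G` is not divisible by an older one `(u, v)`: comparing the multiple of
`(u, v)` of the same signature with the new pair, either the latter is covered or it can be
regularly top-reduced. -/
lemma InnerInv.sigLeadExps_lt (h : InnerInv ω ϖ I f GB N Q₀ Q G S B) (hp : IsMinSig ω B p)
    (hc : ¬ Criterion ω G S p) (hr : RegularReduce ω p.1 p.2 G v₀)
    (hval : ¬ gaussVal f < gaussVal v₀) :
    sigLeadExps ω (G ∪ {(p.1, v₀)}) < sigLeadExps ω G := by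
  have hsp := h.isSigPair_of_regularReduce hp.1 hr hval
  have hv0 : v₀ ≠ 0 := hsp.ne_zero
  obtain ⟨i, hi, -, hvN⟩ := hsp
  simp only at hi hvN
  refine UpperSet.coe_ssubset_coe.mp ((Set.ssubset_iff_of_subset ?_).mpr
    ⟨(i, (lm ω v₀).2), ⟨_, Or.inr rfl, i, hi, le_rfl⟩, ?_⟩)
  · rintro x ⟨q, hq, hx⟩
    exact ⟨q, Or.inl hq, hx⟩
  rintro ⟨q, hq, j, hj, hle⟩
  obtain ⟨hij, hexp⟩ := Prod.mk_le_mk.mp hle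
  have hsq : IsSigPair ω f GB N q := by
    rcases h.isGPair q hq with ⟨hbot, -⟩ | hsq
    · rw [hbot] at hj
      exact absurd hj.symm WithBot.coe_ne_bot
    · exact hsq
  have hq0 := hsq.ne_zero
  obtain ⟨-, -, -, hqN⟩ := hsq
  have h1 : (lm ω v₀).1 = N := by
    rw [gaussVal_eq_lm ω hv0] at hvN
    exact_mod_cast hvN
  have h2 : (lm ω q.2).1 = N := by
    rw [gaussVal_eq_lm ω hq0] at hqN
    exact_mod_cast hqN
  obtain ⟨t, rfl⟩ := exists_add_of_le hij
  by_cases hlt : ω.toSyn (t + (lm ω q.2).2) ≤ ω.toSyn (lm ω v₀).2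
  · -- `(u, v)` covers the new pair
    refine hc (Or.inl ⟨q, hq, (0, t), ?_, ?_⟩)
    · rw [hi, hj, coe_add_coe, Prod.mk_add_mk, zero_add, add_comm]
    · refine lt_of_le_of_lt ?_ (hr.LM_lt (h.mem_B p hp.1).2)
      rw [LM_of_ne hq0, LM_of_ne hv0, coe_add_coe, tKey_coe_le]
      refine Or.inr ⟨?_, hlt⟩
      rw [h1, Prod.fst_add, h2, zero_add]
  · -- the new pair could be reduced further by `(u, v)`
    obtain ⟨t', ht'⟩ := exists_add_of_le hexp
    refine hr.irreducible (exists_regTopRed hv0 hq hq0 (t := (0, t')) ?_ ?_)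
    · refine Prod.ext ?_ ?_
      · rw [Prod.fst_add, h1, h2, zero_add]
      · rw [Prod.snd_add, ht', add_comm]
    · rw [hi, hj, coe_add_coe, tKey_coe_lt]
      refine Or.inr ⟨rfl, ?_⟩
      rw [not_le, ht', add_comm, map_add, map_add] at hlt
      have := lt_of_add_lt_add_right hlt
      rw [Prod.mk_add_mk, add_comm j t, map_add, map_add]
      exact add_lt_add_left this _

/-- The rank decreases from one passage at the test of the main loop to the next one. -/
lemma InnerInv.outerRank_lt (h : InnerInv ω ϖ I f GB N Q₀ Q G S ∅) :
    Prod.Lex (· < ·) (· < ·) (outerRank ω Q (values G)) (outerRank ω (f ::ₘ Q₀) GB) := by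
  have hGB : GB ⊆ values G := fun g hg => ⟨⊥, h.bot_mem g hg⟩
  have hf0 : f ≠ 0 := (isSigPair_one ω GB h.gaussVal_f).ne_zero
  have hle : leadMonomials ω (values G) ≤ leadMonomials ω GB :=
    fun T ⟨g, hg, hT⟩ => ⟨g, hGB hg, hT⟩
  have hstrict : ∀ v ∈ values G, v ≠ 0 → lm ω v ∉ leadMonomials ω GB →
      leadMonomials ω (values G) < leadMonomials ω GB := fun v hv hv0 hvL =>
    lt_of_le_of_ne hle fun heq => hvL (heq ▸ ⟨v, hv, hv0, le_rfl⟩)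
  by_cases hfL : lm ω f ∈ leadMonomials ω GB
  swap
  · exact Prod.Lex.left _ _ (hstrict f (mem_values h.one_mem) hf0 hfL)
  rcases hle.lt_or_eq with hlt | heq
  · exact Prod.Lex.left _ _ hlt
  rcases h.progress hfL with ⟨v, hv, hv0, hvL⟩ | ⟨-, -, h1, -⟩ | ⟨-, hQ⟩
  · exact absurd heq (hstrict v hv hv0 hvL).ne
  · exact absurd h1 (Set.notMem_empty _)
  · rw [outerRank, outerRank, heq]
    refine Prod.Lex.right _ ?_
    have hwf : weight ω (leadMonomials ω GB) f = 2 := by simp [weight, hf0, hfL]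
    rw [Multiset.map_cons, Multiset.sum_cons, hwf]
    rcases hQ with rfl | ⟨v₀, rfl, hv₀⟩
    · omega
    · have hw : weight ω (leadMonomials ω GB) v₀ ≤ 1 := by
        rcases hv₀ with rfl | hv₀
        · simp [weight]
        · simp [weight, hv₀]
          split_ifs <;> omega
      rw [Multiset.map_cons, Multiset.sum_cons]
      omega

lemma outerRank_insert_zero_lt :
    Prod.Lex (· < ·) (· < ·) (outerRank ω Q₀ (insert 0 GB)) (outerRank ω (0 ::ₘ Q₀) GB) := by
  have heq : leadMonomials ω (insert 0 GB) = leadMonomials ω GB := by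
    ext T
    simp only [SetLike.mem_coe, mem_leadMonomials]
    constructor
    · rintro ⟨g, rfl | hg, hg0, hT⟩
      · exact absurd rfl hg0
      · exact ⟨g, hg, hg0, hT⟩
    · rintro ⟨g, hg, hT⟩
      exact ⟨g, Or.inr hg, hT⟩
  rw [outerRank, outerRank, heq]
  refine Prod.Lex.right _ ?_
  rw [Multiset.map_cons, Multiset.sum_cons]
  simp [weight]

end termination

/-- The invariant of the algorithm. -/
def StateInv (ω : MonomialOrder (Fin n)) (ϖ : R) (I : Ideal (Tate R n)) : State R n → Prop
  | .outer Q GB => OuterInv ω I Q GB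
  | .inner Q GB f G S B => ∃ Q₀, OuterInv ω I (f ::ₘ Q₀) GB ∧
      (∀ q ∈ Q₀, gaussVal f ≤ gaussVal q) ∧
      ((f = 0 ∧ Q = Q₀ ∧ B = ∅ ∧ values G = insert 0 GB) ∨
        ∃ N, InnerInv ω ϖ I f GB N Q₀ Q G S B)

lemma exists_cons_of_step_outer {ω : MonomialOrder (Fin n)} {ϖ : R} {Q : Multiset (Tate R n)}
    {GB : Set (Tate R n)} {s : State R n} (h : Step ω ϖ (.outer Q GB) s) :
    ∃ f Q₀, Q = f ::ₘ Q₀ ∧ (∀ q ∈ Q₀, gaussVal f ≤ gaussVal q) ∧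
      s = .inner Q₀ GB f (initG GB f) {s | ∃ g ∈ GB, s = LM ω g}
        {p | ∃ g ∈ GB, IsJPair ω ϖ (((0 : TMon n) : TMon₀ n), f) (⊥, g) p} := by
  cases h with
  | pop Q₀ _ f hmin => exact ⟨f, Q₀, rfl, hmin, rfl⟩

lemma setOf_isJPair_zero (ω : MonomialOrder (Fin n)) (ϖ : R) (u : TMon₀ n)
    (GB : Set (Tate R n)) :
    {p | ∃ g ∈ GB, IsJPair ω ϖ (u, (0 : Tate R n)) (⊥, g) p} = ∅ :=
  Set.eq_empty_iff_forall_notMem.mpr fun _ ⟨_, _, h, _⟩ => h rfl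

lemma stateInv_pop {ω : MonomialOrder (Fin n)} {ϖ : R} {I : Ideal (Tate R n)} {f : Tate R n}
    {Q₀ : Multiset (Tate R n)} {GB : Set (Tate R n)} (h : OuterInv ω I (f ::ₘ Q₀) GB)
    (hmin : ∀ q ∈ Q₀, gaussVal f ≤ gaussVal q) :
    StateInv ω ϖ I (.inner Q₀ GB f (initG GB f) {s | ∃ g ∈ GB, s = LM ω g}
      {p | ∃ g ∈ GB, IsJPair ω ϖ (((0 : TMon n) : TMon₀ n), f) (⊥, g) p}) := by
  refine ⟨Q₀, h, hmin, ?_⟩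
  by_cases hf : f = 0
  · subst hf
    exact Or.inl ⟨rfl, rfl, setOf_isJPair_zero ω ϖ _ GB, values_initG GB 0⟩
  · exact Or.inr ⟨(lm ω f).1, InnerInv.init h hmin (gaussVal_eq_lm ω hf)⟩

lemma stateInv_step (hR : NullSeriesConverge R) {ω : MonomialOrder (Fin n)} {ϖ : R}
    {I : Ideal (Tate R n)} {s s' : State R n} (h : StateInv ω ϖ I s) (hs : Step ω ϖ s s') :
    StateInv ω ϖ I s' := by
  cases hs with
  | pop Q GB f hmin => exact stateInv_pop h hmin
  | skip Q GB f G S B p hp hc =>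
    obtain ⟨Q₀, ho, hmin, ⟨-, -, rfl, -⟩ | ⟨N, hi⟩⟩ := h
    · exact absurd hp.1 (Set.notMem_empty p)
    · exact ⟨Q₀, ho, hmin, Or.inr ⟨N, hi.skip hp hc⟩⟩
  | syzygy Q GB f G S B p v₀ hp hc hr hval =>
    obtain ⟨Q₀, ho, hmin, ⟨-, -, rfl, -⟩ | ⟨N, hi⟩⟩ := h
    · exact absurd hp.1 (Set.notMem_empty p)
    · exact ⟨Q₀, ho, hmin, Or.inr ⟨N, hi.add_syzygy hR hp hc hr hval⟩⟩
  | add Q GB f G S B p v₀ hp hc hr hval =>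
    obtain ⟨Q₀, ho, hmin, ⟨-, -, rfl, -⟩ | ⟨N, hi⟩⟩ := h
    · exact absurd hp.1 (Set.notMem_empty p)
    · exact ⟨Q₀, ho, hmin, Or.inr ⟨N, hi.add_pair hp hc hr hval⟩⟩
  | finish Q GB f G S =>
    obtain ⟨Q₀, ho, hmin, ⟨rfl, rfl, -, hG⟩ | ⟨N, hi⟩⟩ := h
    · change OuterInv ω I Q (values G)
      rw [hG]
      exact ho.insert_zero hmin
    · exact hi.finish ho

/-- The inner loop terminates, if the algorithm terminates after it. -/
lemma acc_inner (hR : NullSeriesConverge R) {ω : MonomialOrder (Fin n)} {ϖ : R}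
    {I : Ideal (Tate R n)} {f : Tate R n} {GB : Set (Tate R n)} {N : ℕ}
    {Q₀ : Multiset (Tate R n)} (ho : OuterInv ω I (f ::ₘ Q₀) GB)
    (hout : ∀ Q' GB', OuterInv ω I Q' GB' →
      Prod.Lex (· < ·) (· < ·) (outerRank ω Q' GB') (outerRank ω (f ::ₘ Q₀) GB) →
      Acc (fun s' s => Step ω ϖ s s') (.outer Q' GB'))
    {Q : Multiset (Tate R n)} {G : Set (SPair R n)} {S : Set (TMon₀ n)} {B : Set (SPair R n)}
    (hi : InnerInv ω ϖ I f GB N Q₀ Q G S B) :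
    Acc (fun s' s => Step ω ϖ s s') (.inner Q GB f G S B) := by
  have hwf : WellFounded (Prod.Lex (· < ·) (· < ·) :
      UpperSet ((Fin n →₀ ℕ) × (Fin n →₀ ℕ)) × ℕ → _ → Prop) :=
    WellFounded.prod_lex (wellFounded_upperSet _) wellFounded_lt
  generalize hr : (sigLeadExps ω G, B.ncard) = r
  induction r using hwf.induction generalizing Q G S B with
  | _ r ih =>
  subst hr
  refine Acc.intro _ fun s' hs => ?_
  cases hs with
  | skip _ _ _ _ _ _ p hp hc =>
    exact ih _ (Prod.Lex.right _ (Set.ncard_sdiff_singleton_lt_of_mem hp.1 hi.finite_B))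
      (hi.skip hp hc) rfl
  | syzygy _ _ _ _ _ _ p v₀ hp hc hr hval =>
    exact ih _ (Prod.Lex.right _ (Set.ncard_sdiff_singleton_lt_of_mem hp.1 hi.finite_B))
      (hi.add_syzygy hR hp hc hr hval) rfl
  | add _ _ _ _ _ _ p v₀ hp hc hr hval =>
    exact ih _ (Prod.Lex.left _ _ (hi.sigLeadExps_lt hp hc hr hval))
      (hi.add_pair hp hc hr hval) rfl
  | finish _ _ _ _ _ => exact hout _ _ (hi.finish ho) hi.outerRank_lt

theorem acc_outer (hR : NullSeriesConverge R) {ω : MonomialOrder (Fin n)} {ϖ : R}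
    {I : Ideal (Tate R n)} {Q : Multiset (Tate R n)} {GB : Set (Tate R n)}
    (ho : OuterInv ω I Q GB) : Acc (fun s' s => Step ω ϖ s s') (.outer Q GB) := by
  have hwf : WellFounded (Prod.Lex (· < ·) (· < ·) : UpperSet (TMon n) × ℕ → _ → Prop) :=
    WellFounded.prod_lex (wellFounded_upperSet _) wellFounded_lt
  generalize hr : outerRank ω Q GB = r
  induction r using hwf.induction generalizing Q GB with
  | _ r ih =>
  subst hr
  refine Acc.intro _ fun s' hs => ?_
  obtain ⟨f, Q₀, rfl, hmin, rfl⟩ := exists_cons_of_step_outer hs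
  have hout : ∀ Q' GB', OuterInv ω I Q' GB' →
      Prod.Lex (· < ·) (· < ·) (outerRank ω Q' GB') (outerRank ω (f ::ₘ Q₀) GB) →
      Acc (fun s' s => Step ω ϖ s s') (.outer Q' GB') := fun Q' GB' h' hlt => ih _ hlt h' rfl
  by_cases hf : f = 0
  · subst hf
    rw [setOf_isJPair_zero]
    refine Acc.intro _ fun s' hs => ?_
    generalize hB : (∅ : Set (SPair R n)) = B at hs
    cases hs with
    | skip _ _ _ _ _ _ p hp _ => exact absurd (hB ▸ hp.1) (Set.notMem_empty p)
    | syzygy _ _ _ _ _ _ p _ hp _ _ _ => exact absurd (hB ▸ hp.1) (Set.notMem_empty p)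
    | add _ _ _ _ _ _ p _ hp _ _ _ => exact absurd (hB ▸ hp.1) (Set.notMem_empty p)
    | finish _ _ _ _ _ =>
      change Acc _ (State.outer Q₀ (values (initG GB 0)))
      rw [values_initG]
      exact hout _ _ (ho.insert_zero hmin) outerRank_insert_zero_lt
  · exact acc_inner hR ho hout (InnerInv.init ho hmin (gaussVal_eq_lm ω hf))

/-- The algorithm is never stuck. -/
lemma exists_step {ω : MonomialOrder (Fin n)} {ϖ : R} {I : Ideal (Tate R n)} {s : State R n}
    (h : StateInv ω ϖ I s) (hs : ¬ s.Final) : ∃ s', Step ω ϖ s s' := by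
  cases s with
  | outer Q GB =>
    obtain ⟨f, hf, hmin⟩ : ∃ f ∈ Q, ∀ q ∈ Q, gaussVal f ≤ gaussVal q := by
      classical
      obtain ⟨q, hq⟩ := Multiset.exists_mem_of_ne_zero hs
      obtain ⟨f, hf, hmin⟩ := Finset.exists_min_image Q.toFinset gaussVal
        ⟨q, Multiset.mem_toFinset.mpr hq⟩
      exact ⟨f, Multiset.mem_toFinset.mp hf, fun q hq => hmin q (Multiset.mem_toFinset.mpr hq)⟩
    obtain ⟨Q₀, rfl⟩ := Multiset.exists_cons_of_mem hf
    exact ⟨_, Step.pop Q₀ GB f fun q hq => hmin q (Multiset.mem_cons_of_mem hq)⟩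
  | inner Q GB f G S B =>
    by_cases hB : B = ∅
    · subst hB
      exact ⟨_, Step.finish Q GB f G S⟩
    obtain ⟨Q₀, -, -, ⟨-, -, hB', -⟩ | ⟨N, hi⟩⟩ := h
    · exact absurd hB' hB
    obtain ⟨p, hp, hmin⟩ := Set.exists_min_image B (fun p => tKey ω p.1) hi.finite_B
      (Set.nonempty_iff_ne_empty.mpr hB)
    by_cases hc : Criterion ω G S p
    · exact ⟨_, Step.skip Q GB f G S B p ⟨hp, hmin⟩ hc⟩
    obtain ⟨v₀, hr⟩ := exists_regularReduce ω p.1 p.2 G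
    by_cases hval : gaussVal f < gaussVal v₀
    · exact ⟨_, Step.syzygy Q GB f G S B p v₀ ⟨hp, hmin⟩ hc hr hval⟩
    · exact ⟨_, Step.add Q GB f G S B p v₀ ⟨hp, hmin⟩ hc hr hval⟩

lemma outerInv_init (ω : MonomialOrder (Fin n)) {m : ℕ} (f : Fin m → Tate R n) :
    OuterInv ω (Ideal.span (Set.range f)) (Multiset.map f Finset.univ.val) ∅ := by
  refine ⟨Set.finite_empty, ?_, fun g hg => hg.elim, fun N e x hx => hx.elim⟩
  congr 1
  ext x
  simp

lemma exists_not_rel_of_acc {α : Type*} {r : α → α → Prop} {u : ℕ → α} (h : Acc r (u 0)) :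
    ∃ k, ¬ r (u (k + 1)) (u k) := by
  by_contra! hcon
  obtain ⟨k, hk⟩ : ∃ k, u k = u 0 := ⟨0, rfl⟩
  generalize u 0 = a at h hk
  induction h generalizing k with
  | intro a _ ih =>
    subst hk
    exact ih _ (hcon k) (k + 1) rfl

/-! ### Complete discretely valued fields -/

section Complete

variable {K : Type*} [Field K] [hK : Valued K (WithZero (Multiplicative ℤ))]
  [hK.v.IsRankOneDiscrete]

lemma natCast_le_addVal_iff {ϖ : hK.v.valuationSubring} (hϖ : Irreducible ϖ) (N : ℕ)
    (r : hK.v.valuationSubring) :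
    (N : ℕ∞) ≤ addVal hK.v.valuationSubring r ↔
      hK.v (r : K) ≤ hK.v ((ϖ ^ N : hK.v.valuationSubring) : K) := by
  rw [← hϖ.addVal_pow N, addVal_le_iff_dvd]
  exact (Valuation.valuationSubring.integers hK.v).dvd_iff_le

lemma nonarchimedeanAddGroup_of_valued {L : Type*} [Field L]
    [Valued L (WithZero (Multiplicative ℤ))] : NonarchimedeanAddGroup L where
  is_nonarchimedean U hU := by
    obtain ⟨γ, hγ⟩ := Valued.mem_nhds_zero.mp hU
    exact ⟨⟨Valued.v.restrict.ltAddSubgroup γ, Valued.isOpen_ball L γ.1⟩, hγ⟩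

lemma nullSeriesConverge [CompleteSpace K] {ϖ : hK.v.valuationSubring} (hϖ : Irreducible ϖ) :
    NullSeriesConverge hK.v.valuationSubring := by
  intro s hs
  have hlt : hK.v (ϖ : K) < 1 := by
    refine lt_of_le_of_ne ϖ.2 fun h => hϖ.not_isUnit ?_
    exact (Valuation.valuationSubring.integers hK.v).isUnit_iff_valuation_eq_one.mpr h
  have hnull : Filter.Tendsto (fun k => (s k : K)) Filter.atTop (nhds 0) := by
    refine (Valued.hasBasis_nhds_zero K _).tendsto_right_iff.mpr fun γ _ => ?_
    have hγ : MonoidWithZeroHom.ValueGroup₀.embedding γ.1 ≠ 0 := by simp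
    obtain ⟨N, hN⟩ := exists_pow_lt₀ hlt (Units.mk0 _ hγ)
    obtain ⟨J, hJ⟩ := hs N
    filter_upwards [Filter.eventually_ge_atTop J] with k hk
    have := (natCast_le_addVal_iff hϖ N (s k)).mp (hJ k hk)
    rw [Valuation.restrict_lt_iff_lt_embedding]
    refine lt_of_le_of_lt this ?_
    simpa using hN
  have := nonarchimedeanAddGroup_of_valued (L := K)
  have hcauchy : CauchySeq fun J => ∑ k ∈ Finset.range J, (s k : K) := by
    refine NonarchimedeanAddGroup.cauchySeq_of_tendsto_sub_nhds_zero ?_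
    simpa [Finset.sum_range_succ] using hnull
  obtain ⟨a, ha⟩ := cauchySeq_tendsto_of_complete hcauchy
  have hmem : a ∈ hK.v.valuationSubring := by
    refine (Valued.isClosed_valuationSubring K).mem_of_tendsto ha (Filter.Eventually.of_forall ?_)
    exact fun J => sum_mem fun k _ => (s k).2
  refine ⟨⟨a, hmem⟩, fun N J hJ => ?_⟩
  rw [natCast_le_addVal_iff hϖ, ← Valuation.restrict_le_iff]
  have hlim := ha.sub_const (∑ k ∈ Finset.range J, (s k : K))
  have hcl := Valued.isClosed_closedBall K (hK.v.restrict ((ϖ ^ N : hK.v.valuationSubring) : K))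
  have := hcl.mem_of_tendsto hlim ?_
  · simpa using this
  · filter_upwards [Filter.eventually_ge_atTop J] with M hM
    rw [Valuation.restrict_le_iff, ← Finset.sum_Ico_eq_sub _ hM]
    refine Valuation.map_sum_le _ fun k hk => ?_
    exact (natCast_le_addVal_iff hϖ N (s k)).mp (hJ k (Finset.mem_Ico.mp hk).1)

end Complete

/-! ### Gröbner bases of the reductions -/

lemma coeff_red (f : Tate R n) (i : Fin n →₀ ℕ) :
    (red f).coeff i = IsLocalRing.residue R (coeff i f.1) := by
  have h : (red f : MvPowerSeries (Fin n) (IsLocalRing.ResidueField R)) =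
      MvPowerSeries.map (IsLocalRing.residue R) f.1 := coe_redFun f
  rw [← MvPolynomial.coeff_coe, h, coeff_map]

lemma residue_ne_zero_iff (r : R) : IsLocalRing.residue R r ≠ 0 ↔ addVal R r = 0 := by
  rw [addVal_eq_zero_iff, IsLocalRing.residue_ne_zero_iff_isUnit]

/-- The leading exponent of the reduction of a series of valuation `0`. -/
lemma IsLead.degree_red {ω : MonomialOrder (Fin n)} {f : Tate R n} {e : Fin n →₀ ℕ}
    (h : IsLead ω f (0, e)) : red f ≠ 0 ∧ ω.degree (red f) = e := by
  have he : (red f).coeff e ≠ 0 := by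
    rw [coeff_red, residue_ne_zero_iff]
    exact h.1
  have hne : red f ≠ 0 := fun h0 => he (by rw [h0, MvPolynomial.coeff_zero])
  refine ⟨hne, ω.toSyn.injective (le_antisymm ?_ ?_)⟩
  · rw [ω.degree_le_iff]
    intro i hi
    rw [MvPolynomial.mem_support_iff, coeff_red, residue_ne_zero_iff] at hi
    by_contra hlt
    have := (h.2 i).2 hlt
    rw [hi] at this
    simp at this
  · exact ω.le_degree (MvPolynomial.mem_support_iff.mpr he)

lemma isLead_of_red_ne_zero (ω : MonomialOrder (Fin n)) {f : Tate R n} (h : red f ≠ 0) :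
    IsLead ω f (0, ω.degree (red f)) := by
  have hf : f ≠ 0 := by
    rintro rfl
    exact h (map_zero red)
  obtain ⟨i, hi⟩ := MvPolynomial.ne_zero_iff.mp h
  rw [coeff_red, residue_ne_zero_iff] at hi
  have hl := isLead_lm ω hf
  have h0 : (lm ω f).1 = 0 := by
    have := gaussVal_le f i
    rw [hi, hl.gaussVal] at this
    exact Nat.le_zero.mp (by exact_mod_cast this)
  have heq : lm ω f = (0, (lm ω f).2) := Prod.ext h0 rfl
  rw [heq] at hl
  rw [hl.degree_red.2]
  exact hl

/-- `f` is `π^a` times a series of valuation `0`. -/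
lemma exists_eq_term_mul {ϖ : R} (hϖ : Irreducible ϖ) (f : Tate R n) {a : ℕ}
    (h : (a : ℕ∞) ≤ gaussVal f) : ∃ g : Tate R n, f = term ϖ 0 ^ a * g := by
  have hdvd : ∀ i, ∃ r, coeff i f.1 = ϖ ^ a * r := fun i => by
    have := h.trans (gaussVal_le f i)
    rwa [← hϖ.addVal_pow a, addVal_le_iff_dvd] at this
  choose r hr using hdvd
  let g : MvPowerSeries (Fin n) R := fun i => r i
  have hg : ∀ i, coeff i g = r i := fun _ => rfl
  have hgT : g ∈ Tate R n := fun N => (f.2 (a + N)).subset fun i hi => by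
    rw [Set.mem_ofPred_eq, hg] at hi
    rw [Set.mem_ofPred_eq, hr, addVal_mul, hϖ.addVal_pow]
    push_cast
    exact (ENat.add_lt_add_iff_left (ENat.natCast_ne_top a)).mpr hi
  refine ⟨⟨g, hgT⟩, tate_ext fun i => ?_⟩
  have := coeff_add_term_mul (ϖ ^ a) 0 i (⟨g, hgT⟩ : Tate R n)
  rw [zero_add] at this
  rw [term_pow_zero, this, hr, hg]

lemma isLead_term_pow_mul {ϖ : R} (hϖ : Irreducible ϖ) {ω : MonomialOrder (Fin n)} {a N : ℕ}
    {e : Fin n →₀ ℕ} {g : Tate R n} :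
    IsLead ω (term ϖ 0 ^ a * g) (a + N, e) ↔ IsLead ω g (N, e) := by
  rw [term_pow_zero]
  have hval := hϖ.addVal_pow a
  constructor
  · intro h
    have hg : g ≠ 0 := fun hg => h.ne_zero (by rw [hg, mul_zero])
    have hl := isLead_lm ω hg
    have := isLead_unique h (hl.term_mul hval 0)
    obtain ⟨h1, h2⟩ := Prod.ext_iff.mp this
    simp only [zero_add] at h1 h2
    have : lm ω g = (N, e) := Prod.ext (by omega) h2.symm
    rwa [this] at hl
  · intro h
    simpa using h.term_mul hval 0

lemma red_surjective : Function.Surjective (red : Tate R n → _) := by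
  classical
  intro p
  choose σ hσ using IsLocalRing.residue_surjective (R := R)
  let F : MvPowerSeries (Fin n) R := fun i => if p.coeff i = 0 then 0 else σ (p.coeff i)
  have hF : ∀ i, coeff i F = if p.coeff i = 0 then 0 else σ (p.coeff i) := fun _ => rfl
  refine ⟨⟨F, fun N => p.support.finite_toSet.subset fun i hi => ?_⟩,
    MvPolynomial.ext _ _ fun i => ?_⟩
  · rw [Finset.mem_coe, MvPolynomial.mem_support_iff]
    intro h0
    rw [Set.mem_ofPred_eq, hF, if_pos h0, addVal_zero] at hi
    exact absurd hi not_top_lt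
  · rw [coeff_red]
    change IsLocalRing.residue R (coeff i F) = _
    rw [hF]
    split_ifs with h0
    · rw [map_zero, h0]
    · rw [hσ]

/-- A Gröbner basis of `I` reduces, valuation by valuation, to Gröbner bases of the ideals
`barIdeal ϖ N I`: a nonzero element of `barIdeal ϖ N I` comes from an element of `I` of Gauss
valuation exactly `N`, and both have the same leading exponent. -/
theorem IsTateGB.isPolyGB {ϖ : R} (hϖ : Irreducible ϖ) {ω : MonomialOrder (Fin n)}
    {I : Ideal (Tate R n)} {G : Set (Tate R n)} (h : IsTateGB ω I G) (N : ℕ) :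
    IsPolyGB ω (barIdeal ϖ N I) (rho ϖ {g ∈ G | gaussVal g ≤ N}) := by
  obtain ⟨hfin, hsub, hdvd⟩ := h
  have hinj : ∀ (a : ℕ) (g g' : Tate R n), term ϖ 0 ^ a * g = term ϖ 0 ^ a * g' → g = g' := by
    intro a g g' h
    rw [← sub_eq_zero, ← mul_sub, term_pow_zero, ← gaussVal_eq_top_iff, gaussVal_term_mul,
      hϖ.addVal_pow] at h
    rw [← sub_eq_zero, ← gaussVal_eq_top_iff]
    generalize gaussVal (g - g') = k at h
    induction k with
    | top => rfl
    | coe k =>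
      rw [← Nat.cast_add] at h
      exact absurd h (ENat.natCast_ne_top _)
  refine ⟨?_, ?_, ?_⟩
  · classical
    choose! ν hν using fun f : Tate R n => exists_eq_term_mul hϖ f (a := (gaussVal f).toNat)
      (ENat.natCast_toNat_le_self _)
    refine (hfin.image fun g => red (ν g)).subset ?_
    rintro p ⟨g, hg, -, g', heq, rfl⟩
    exact ⟨g, hg.1, congrArg red (hinj _ _ _ ((hν g).symm.trans heq))⟩
  · rintro p ⟨g, ⟨hg, hle⟩, hg0, g', heq, rfl⟩
    have ha : (gaussVal g).toNat ≤ N := ENat.toNat_le_of_le_natCast hle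
    refine Ideal.mem_map_of_mem red (?_ : term ϖ 0 ^ N * g' ∈ I)
    rw [← Nat.sub_add_cancel ha, pow_add, mul_assoc, ← heq]
    exact I.mul_mem_left _ (hsub hg)
  · intro p hp hp0
    obtain ⟨x, hx, rfl⟩ := (Ideal.mem_map_iff_of_surjective red (red_surjective)).mp hp
    have hl := isLead_of_red_ne_zero ω hp0
    have hl' := (isLead_term_pow_mul hϖ (a := N)).mpr hl
    obtain ⟨g, hg, hgd⟩ := hdvd _ hx hl'.ne_zero
    rw [LM_of_ne hl'.ne_zero, hl'.lm_eq] at hgd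
    obtain ⟨T, hT, hle⟩ := monDvd_coe hgd
    have hg0 : g ≠ 0 := by
      rintro rfl
      rw [LM_zero] at hT
      exact WithBot.bot_ne_coe hT
    rw [LM_of_ne hg0] at hT
    obtain rfl := WithBot.coe_injective hT
    obtain ⟨hle1, hle2⟩ := Prod.mk_le_mk.mp (show ((lm ω g).1, (lm ω g).2) ≤ _ from hle)
    have hlg := isLead_lm ω hg0
    have hval : (gaussVal g).toNat = (lm ω g).1 := by rw [hlg.gaussVal, ENat.toNat_natCast]
    obtain ⟨g', hg'⟩ := exists_eq_term_mul hϖ g (a := (gaussVal g).toNat)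
      (ENat.natCast_toNat_le_self _)
    have hlg' : IsLead ω g' (0, (lm ω g).2) := by
      rw [← isLead_term_pow_mul hϖ (a := (gaussVal g).toNat), ← hg', hval]
      exact hlg
    refine ⟨red g', ⟨g, ⟨hg, ?_⟩, hg0, g', hg', rfl⟩, hlg'.degree_red.1, ?_⟩
    · rw [hlg.gaussVal]
      exact_mod_cast hle1
    · rw [hlg'.degree_red.2]
      exact hle2


/-! ### Executions -/

lemma OuterInv.isTateGB {ω : MonomialOrder (Fin n)} {I : Ideal (Tate R n)} {GB : Set (Tate R n)}
    (h : OuterInv ω I 0 GB) : IsTateGB ω I GB := by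
  have hset : {q : Tate R n | q ∈ (0 : Multiset (Tate R n))} = ∅ := by simp
  have hspan := h.span_eq
  have hclosed := h.closed
  rw [hset] at hspan hclosed
  rw [Set.union_empty] at hspan
  refine ⟨h.finite, fun g hg => hspan ▸ Ideal.subset_span hg, fun x hx hx0 => ?_⟩
  obtain ⟨g, hg, hg0, hle⟩ := exists_lm_le_of_mem_span hclosed (hspan ▸ hx) hx0
  refine ⟨g, hg, lm ω x - lm ω g, ?_⟩
  rw [LM_of_ne hx0, LM_of_ne hg0, coe_add_coe, tsub_add_cancel_of_le hle]

lemma stateInv_of_reflTransGen (hR : NullSeriesConverge R) {ω : MonomialOrder (Fin n)} {ϖ : R}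
    {I : Ideal (Tate R n)} {s s' : State R n} (h : StateInv ω ϖ I s)
    (hs : Relation.ReflTransGen (Step ω ϖ) s s') : StateInv ω ϖ I s' := by
  induction hs with
  | refl => exact h
  | tail _ hst ih => exact stateInv_step hR ih hst

lemma not_step_of_final {ω : MonomialOrder (Fin n)} {ϖ : R} {s s' : State R n} (h : s.Final) :
    ¬ Step ω ϖ s s' := by
  intro hs
  cases hs with
  | pop Q GB f _ => exact Multiset.cons_ne_zero (show f ::ₘ Q = 0 from h)
  | skip => exact h
  | syzygy => exact h
  | add => exact h
  | finish => exact h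

/-- An execution leaves the main loop with a Gröbner basis. -/
theorem exists_isTateGB_of_isExecution (hR : NullSeriesConverge R) {ω : MonomialOrder (Fin n)}
    {ϖ : R} {m : ℕ} {f : Fin m → Tate R n} {st : ℕ → State R n} (h : IsExecution ω ϖ f st) :
    ∃ G : Set (Tate R n), (∃ T : ℕ, ∀ t ≥ T, (st t).gbasis = G) ∧
      IsTateGB ω (Ideal.span (Set.range f)) G := by
  obtain ⟨h0, hstep⟩ := h
  have hacc : Acc (fun s' s => Step ω ϖ s s') (st 0) := h0 ▸ acc_outer hR (outerInv_init ω f)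
  obtain ⟨T, hT⟩ := exists_not_rel_of_acc hacc
  have hfinal := ((hstep T).resolve_left hT).1
  have hconst : ∀ k, st (T + k) = st T := by
    intro k
    induction k with
    | zero => rfl
    | succ k ih => exact (((hstep (T + k)).resolve_left
        (not_step_of_final (ih ▸ hfinal))).2).trans ih
  have hinv : StateInv ω ϖ (Ideal.span (Set.range f)) (st T) := by
    clear hfinal hconst hT
    induction T with
    | zero => rw [h0]; exact outerInv_init ω f
    | succ T ih =>
      rcases hstep T with hs | ⟨-, hs⟩
      · exact stateInv_step hR ih hs
      · rwa [hs]
  refine ⟨(st T).gbasis, ⟨T, fun t ht => ?_⟩, ?_⟩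
  · obtain ⟨k, rfl⟩ := Nat.exists_eq_add_of_le ht
    rw [hconst]
  · generalize st T = s at hfinal hinv
    cases s with
    | outer Q GB =>
      obtain rfl : Q = 0 := hfinal
      exact OuterInv.isTateGB hinv
    | inner _ _ _ _ _ _ => exact hfinal.elim

end VaPoTe

end

theorem mainTheorem4 {K : Type*} [Field K] [hK : Valued K (WithZero (Multiplicative ℤ))]
    [hK.v.IsRankOneDiscrete] [CompleteSpace K]
    (n : ℕ) (ω : MonomialOrder (Fin n))
    (ϖ : hK.v.valuationSubring) (hϖ : Irreducible ϖ)
    (m : ℕ) (f : Fin m → VaPoTe.Tate hK.v.valuationSubring n) :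
    (∀ s, Relation.ReflTransGen (VaPoTe.Step ω ϖ) (VaPoTe.initState f) s → ¬ s.Final →
        ∃ s', VaPoTe.Step ω ϖ s s') ∧
    ∀ st : ℕ → VaPoTe.State hK.v.valuationSubring n, VaPoTe.IsExecution ω ϖ f st →
      ∃ G : Set (VaPoTe.Tate hK.v.valuationSubring n),
        (∃ T : ℕ, ∀ t ≥ T, (st t).gbasis = G) ∧
        VaPoTe.IsTateGB ω (Ideal.span (Set.range f)) G ∧
        ∀ N : ℕ, VaPoTe.IsPolyGB ω (VaPoTe.barIdeal ϖ N (Ideal.span (Set.range f)))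
          (VaPoTe.rho ϖ {g ∈ G | VaPoTe.gaussVal g ≤ N}) := by
  have hR := VaPoTe.nullSeriesConverge hϖ
  refine ⟨fun s hs hfin => ?_, fun st hst => ?_⟩
  · have hinit : VaPoTe.StateInv ω ϖ (Ideal.span (Set.range f)) (VaPoTe.initState f) :=
      VaPoTe.outerInv_init ω f
    exact VaPoTe.exists_step (VaPoTe.stateInv_of_reflTransGen hR hinit hs) hfin
  · obtain ⟨G, hconst, hG⟩ := VaPoTe.exists_isTateGB_of_isExecution hR hst
    exact ⟨G, hconst, hG, fun N => hG.isPolyGB hϖ N⟩
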